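/- Let $\Theta=\{-1,0,1\}$, $A=[-1,1]$, let $\mu\in\Delta\Theta$ have full support and let $\kappa>0$. For $u(a,\theta)=-(a-\theta)^2$ put $U(\nu)=\max_{a\in A}\sum_\theta u(a,\theta)\nu(\theta)$ and $U_A(\nu)=U(\nu)-\kappa\|\nu-\mu\|^2$ for $\nu\in\Delta\Theta$ (Euclidean norm). A policy is a Borel probability measure on $\Delta\Theta$ with mean $\mu$; write $p\succeq q$ if $p$ is a mean-preserving spread of $q$. An optimal attention outcome is a policy $q^*$ such that, for some policy $p^*$, the pair $(p^*,q^*)$ maximizes $\int U\,dq$ over all pairs of policies $(p,q)$ in which $q$ maximizes $\int U_A\,dq'$ over the policies $q'\preceq p$. Let $a(\nu)=\nu(1)-\nu(-1)$, $a_\mu=a(\mu)$, $\mu_0=\mu(0)$. A policy with finite support $\{\nu^1,\dots,\nu^N\}$, $N\ge 2$, $a(\nu^1)\le\dots\le a(\nu^N)$, makes order-IC bind if $|a(\nu^{n+1})-a(\nu^n)|=\sqrt{\kappa}\,\|\nu^{n+1}-\nu^n\|$ for all $n<N$. A downplaying policy is induced by a signal in which state $0$ reports $0$ and each state $\theta=\pm1$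 reports $0$ with some probability $\pi_\theta\in[0,1]$ and $\theta$ otherwise. The exaggerating policy $p^E_\pi$, $\pi\in[0,1]$, is induced by the signal in which states $\pm1$ report themselves and state $0$ reports $-1$ with probability $\pi$ and $1$ otherwise; it is separating if $\pi\in\{0,1\}$. Let $$\kappa_1=\tfrac12,\quad \kappa_2=\frac{2}{\frac34\left(\frac{1-|a_\mu|+\mu_0}{1-|a_\mu|}\right)^2+1},\quad \kappa_3=\frac{2}{3\left(\frac{\mu_0}{1-|a_\mu|}\right)^2+1},\quad \kappa_4=2,\quad \bar\kappa=\frac{2}{3\left(\frac{\mu_0}{1+|a_\mu|}\right)^2+1}.$$ Then $\kappa_1<\kappa_2<\kappa_3<\kappa_4$, and: 1. If $\kappa\le\kappa_1$, full revelation is the unique optimal attention outcome. 2. If $\kappa_1<\kappa\le\kappa_2$, there is a downplaying policy that makes order-IC bind, and every such policy is an optimal attention outcome; if $\kappa\ne\kappa_2$, every optimal attention outcome is of this form. 3. If $\kappa_2\le\kappa\le\kappa_3$, then $p^E_1$ is an optimal attention outcome if and only if $a_\mu\ge0$, and $p^E_0$ is one if and only if $a_\mu\le0$; if $\kappa\ne\kappa_2$,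 there are no others. 4. If $\kappa_3<\kappa\le\kappa_4$, there is an exaggerating policy that makes order-IC bind, and the optimal attention outcomes are exactly the policies of this form. 5. If $\kappa>\kappa_4$, no information is the unique optimal attention outcome. Uniqueness. Let $\kappa\neq\kappa_2$. If $a_\mu=0$, the optimal attention outcome is unique up to exchanging the roles of $1$ and $-1$. If $a_\mu\ne0$, it is unique when $\kappa<\bar\kappa$ or $\kappa\ge\kappa_4$; when $\bar\kappa\le\kappa<\kappa_4$ there are exactly two, which differ by reversing the slope: with $s=\sqrt{(2-\kappa)/(3\kappa)}$, every $\nu$ in the support of one satisfies $\nu(0)-\mu_0=s\,(a(\nu)-a_\mu)$, and every $\nu$ in the support of the other satisfies $\nu(0)-\mu_0=-s\,(a(\nu)-a_\mu)$. If $\kappa=\kappa_2$, there are an extreme state $e\in\{-1,1\}$ and pairwise distinct optimal attention outcomes $q_\rho$, $\rho\in[0,1]$, where $q_\rho$ is induced by a signal in which state $0$ reports $e$ with probability $\rho$ and $0$ otherwise, and each state $\theta=\pm1$ reports $0$ with some probability $\pi_\theta$ (depending on $\rho$) and $\theta$ otherwise; $q_0$ is a downplaying policy that makes order-IC bind and $q_1$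 is a separating exaggeration. -/

import Mathlib

open MeasureTheory ProbabilityTheory

namespace AttentionManagement

noncomputable section

/-! ### States, actions, beliefs -/

/-- The three states `-1, 0, 1`, coerced to the reals `-1, 0, 1`. -/
abbrev State : Type := SignType

/-- Beliefs: probability vectors on the states, with the topology and Borel structure inherited
from `State → ℝ`. -/
abbrev Belief : Type := stdSimplex ℝ State

/-- The action set: the convex hull of the state space. -/
def actions : Set ℝ := convexHull ℝ (Set.range fun θ : State => (θ : ℝ))

/-- Material payoff, common to the principal and the agent. -/
def payoff (a : ℝ) (θ : State) : ℝ := -(a - (θ : ℝ)) ^ 2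

/-- The mean of the state under a belief, `E_ν θ`. -/
def meanState (ν : Belief) : ℝ := ∑ θ, ν θ * (θ : ℝ)

/-- Euclidean distance of beliefs. -/
def beliefDist (ν ν' : Belief) : ℝ := Real.sqrt (∑ θ, (ν θ - ν' θ) ^ 2)

/-- Indirect material utility `U(ν) = max_{a ∈ A} ∑ θ, u(a, θ) ν(θ)`; this is also the principal's
indirect utility `U_P`. -/
def indirectU (ν : Belief) : ℝ := sSup ((fun a => ∑ θ, payoff a θ * ν θ) '' actions)

/-- The attention cost `c(ν) = κ ‖ν - μ‖²` of reaching the belief `ν`. -/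
def cost (μ : Belief) (κ : ℝ) (ν : Belief) : ℝ := κ * beliefDist ν μ ^ 2

/-- The agent's indirect utility net of the attention cost. -/
def agentU (μ : Belief) (κ : ℝ) (ν : Belief) : ℝ := indirectU ν - cost μ κ ν

/-! ### Information policies and the principal's problem -/

/-- `R(μ)`: the Borel probability measures on beliefs whose mean is `μ`. -/
def policies (μ : Belief) : Set (Measure Belief) :=
  {p | IsProbabilityMeasure p ∧ ∀ θ, ∫ ν, ν θ ∂p = μ θ}

/-- `p` is (weakly Blackwell) more informative than `q`: a mean-preserving spread of `q`. -/
def MoreInformative (p q : Measure Belief) : Prop :=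
  ∃ r : Kernel Belief Belief, p = q.bind r ∧ ∀ ν, r ν ∈ policies ν

/-- `G*(p)`: the agent's optimal garblings of `p`. -/
def optimalGarblings (μ : Belief) (κ : ℝ) (p : Measure Belief) : Set (Measure Belief) :=
  {q | (q ∈ policies μ ∧ MoreInformative p q) ∧
    ∀ q', q' ∈ policies μ → MoreInformative p q' →
      ∫ ν, agentU μ κ ν ∂q' ≤ ∫ ν, agentU μ κ ν ∂q}

/-- `(p, q)` solves the principal's problem: maximise `∫ U_P dq` over `p ∈ R(μ)` and
`q ∈ G*(p)`. -/
def SolvesPrincipal (μ : Belief) (κ : ℝ) (p q : Measure Belief) : Prop :=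
  (p ∈ policies μ ∧ q ∈ optimalGarblings μ κ p) ∧
    ∀ p' q', p' ∈ policies μ → q' ∈ optimalGarblings μ κ p' →
      ∫ ν, indirectU ν ∂q' ≤ ∫ ν, indirectU ν ∂q

/-- `q` is an optimal attention outcome. -/
def IsOptimalOutcome (μ : Belief) (κ : ℝ) (q : Measure Belief) : Prop :=
  ∃ p, SolvesPrincipal μ κ p q

/-- Order-IC holds with equality: the support of `p` is `{ν 0, …, ν N}` with at least two elements,
listed by increasing induced action, and the choice distance of any two consecutive elements equals
their psychological distance. -/
def OrderICBinds (κ : ℝ) (p : Measure Belief) : Prop :=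
  ∃ (N : ℕ) (ν : Fin (N + 1) → Belief), 1 ≤ N ∧ Function.Injective ν ∧
    Set.range ν = p.support ∧ Monotone (fun n => meanState (ν n)) ∧
    ∀ n : Fin N, |meanState (ν n.succ) - meanState (ν n.castSucc)| =
      Real.sqrt κ * beliefDist (ν n.succ) (ν n.castSucc)

/-! ### Signals (messages are named after states) -/

/-- The point mass at `m`. -/
def point (m : State) : Belief := ⟨Pi.single m 1, single_mem_stdSimplex ℝ m⟩

/-- The lottery that yields `m` with probability `t` and `m'` with probability `1 - t`. -/
def lottery (t : unitInterval) (m m' : State) : Belief :=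
  ⟨(t : ℝ) • (point m).1 + (1 - (t : ℝ)) • (point m').1,
    convex_stdSimplex ℝ State (point m).2 (point m').2 t.2.1 (sub_nonneg.2 t.2.2) (by ring)⟩

/-- The total probability of message `m` when state `θ` sends a message drawn from `σ θ`. -/
def msgProb (μ : Belief) (σ : State → Belief) (m : State) : ℝ := ∑ θ, μ θ * σ θ m

/-- The Bayesian posterior after message `m` (for a message of probability zero, the prior). -/
def posterior (μ : Belief) (σ : State → Belief) (m : State) : Belief :=
  if h : msgProb μ σ m = 0 then μ
  else ⟨fun θ => μ θ * σ θ m / msgProb μ σ m,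
    fun θ => div_nonneg (mul_nonneg (μ.2.1 θ) ((σ θ).2.1 m))
      (Finset.sum_nonneg fun θ' _ => mul_nonneg (μ.2.1 θ') ((σ θ').2.1 m)),
    by rw [← Finset.sum_div]; exact div_self h⟩

/-- The information policy induced by a signal: the law of the posterior. -/
def induced (μ : Belief) (σ : State → Belief) : Measure Belief :=
  ∑ m, ENNReal.ofReal (msgProb μ σ m) • Measure.dirac (posterior μ σ m)

/-- Full revelation of the state. -/
def fullInfo (μ : Belief) : Measure Belief := induced μ point

/-- No information. -/
def noInfo (μ : Belief) : Measure Belief := Measure.dirac μ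

/-- Downplaying: state `0` reports `0`; state `-1` (resp. `1`) reports `0` with probability `πm`
(resp. `πp`) and itself otherwise. -/
def downplay (μ : Belief) (πm πp : unitInterval) : Measure Belief :=
  induced μ fun
    | .zero => point 0
    | .neg => lottery πm 0 (-1)
    | .pos => lottery πp 0 1

/-- Exaggeration: states `-1` and `1` report themselves; state `0` reports `-1` with probability
`π` and `1` otherwise. -/
def exaggerate (μ : Belief) (π : unitInterval) : Measure Belief :=
  induced μ fun
    | .zero => lottery π (-1) 1
    | .neg => point (-1)
    | .pos => point 1

/-- Downplaying mixed with exaggeration towards the message `e`: as in downplaying, except that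
state `0` reports `e` with probability `ρ` and `0` otherwise. -/
def mixedPolicy (μ : Belief) (e : State) (ρ πm πp : unitInterval) : Measure Belief :=
  induced μ fun
    | .zero => lottery ρ e 0
    | .neg => lottery πm 0 (-1)
    | .pos => lottery πp 0 1

/-! ### Reflection and thresholds -/

/-- Exchange the roles of the states `1` and `-1` in a belief. -/
def reflectBelief (ν : Belief) : Belief := stdSimplex.map (fun θ : State => -θ) ν

/-- Exchange the roles of the states `1` and `-1` in a policy. -/
def reflect (q : Measure Belief) : Measure Belief := q.map reflectBelief

/-- The critical slope `s*(κ)`. -/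
def critSlope (κ : ℝ) : ℝ := Real.sqrt ((2 - κ) / (3 * κ))

/-- `κ₁`. -/
def kappa1 : ℝ := 1 / 2

/-- `κ₂`, with `|meanState μ| = |μ 1 - μ (-1)|`. -/
def kappa2 (μ : Belief) : ℝ :=
  2 / (3 / 4 * ((1 - |meanState μ| + μ 0) / (1 - |meanState μ|)) ^ 2 + 1)

/-- `κ₃`. -/
def kappa3 (μ : Belief) : ℝ := 2 / (3 * (μ 0 / (1 - |meanState μ|)) ^ 2 + 1)

/-- `κ₄`. -/
def kappa4 : ℝ := 2

/-- The cost from which on an exaggeration in either direction can make order-IC bind: the solution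
of `s*(κ) = μ 0 / (1 + |meanState μ|)`. -/
def kappaTwo (μ : Belief) : ℝ := 2 / (3 * (μ 0 / (1 + |meanState μ|)) ^ 2 + 1)

end

end AttentionManagement

namespace AttentionManagement

noncomputable section

/-! ### Coordinates of a belief -/

/-! In the coordinates `a = meanState ν`, `z = ν 0`, beliefs form the triangle `0 ≤ z`, `|a| ≤ 1 -
z`. Material utility is `a² - 1 + z`, and the agent's payoff is `(1 - κ/2) a² - (3κ/2) z²` plus an
affine function. Policies fix the integrals of affine functions, so the principal maximises `∫ a²`.

An optimal garbling of `p` is an optimal garbling of itself, so `p = q` is no loss. The agent keeps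
`q` exactly when no two beliefs of the support are worth pooling, that is `3κ (Δz)² ≤ (2 - κ) (Δa)²`
for all pairs (`mem_optimalGarblings_self_iff`): averaging over pairs gives sufficiency, pooling
small balls gives necessity. For `κ ≤ 2` this bounds the slope `|Δz / Δa|` by `s = critSlope κ`; for
`κ > 2` it leaves a single belief. The problem is thus to maximise `∫ a²` under a slope bound on the
support (`isOptimalOutcome_iff`).

Each regime has its own upper bound with an equality case. If `s ≥ 1`, full revelation is feasible
and `a² ≤ 1 - z` suffices. Otherwise let `-1 + l` and `1 - r` be the extreme actions. By
`exists_variance_bounds`, the variance of `a` is at most that of a two-point law on the extremes,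
and the slope bounds towards both extremes tie it to `μ 0`. For steep `s` the second bound alone is
largest at `l = r = 0`, where it is attained by downplaying with actions `-1, 0, 1`. For
intermediate `s` a positive combination of the two is free of `s` and tight at separating
exaggeration (`exaggerate_arith`). For flat `s`, the pairwise variance inequality added to `a² ≤ (1
- z)²` gives `binding_bound`, tight exactly for two beliefs, one on each edge of the triangle, on a
line of slope `± s` through the prior. How many of the two lines are feasible decides uniqueness
there. At `kappa2` the second bound with `r = 0` no longer depends on `l` (for `a_μ ≥ 0`), which
yields the continuum of `Kinked` policies.

Equality cases are read off by `eq_zero_on_support`, policies are identified by `policy_ext`, and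
priors leaning to `-1` are handled by reflection. -/

lemma sum_state (f : State → ℝ) : ∑ θ, f θ = f 0 + f (-1) + f 1 := by
  have h : (Finset.univ : Finset State) = {0, -1, 1} := by decide
  rw [h, Finset.sum_insert (by decide), Finset.sum_insert (by decide), Finset.sum_singleton]
  ring

lemma meanState_eq (ν : Belief) : meanState ν = ν 1 - ν (-1) := by
  simp only [meanState, sum_state]
  simp
  ring

lemma belief_sum (ν : Belief) : ν 0 + ν (-1) + ν 1 = 1 := by
  rw [← sum_state]; exact stdSimplex.sum_eq_one ν

lemma belief_nonneg (ν : Belief) (θ : State) : 0 ≤ ν θ := ν.2.1 θ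

lemma belief_pos_eq (ν : Belief) : ν 1 = (1 - ν 0 + meanState ν) / 2 := by
  have := belief_sum ν; have := meanState_eq ν; linarith

lemma belief_neg_eq (ν : Belief) : ν (-1) = (1 - ν 0 - meanState ν) / 2 := by
  have := belief_sum ν; have := meanState_eq ν; linarith

lemma meanState_le (ν : Belief) : meanState ν ≤ 1 - ν 0 := by
  have := belief_neg_eq ν; have := belief_nonneg ν (-1); linarith

lemma neg_meanState_le (ν : Belief) : -meanState ν ≤ 1 - ν 0 := by
  have := belief_pos_eq ν; have := belief_nonneg ν 1; linarith

lemma belief_ext {ν ν' : Belief} (ha : meanState ν = meanState ν') (hz : ν 0 = ν' 0) :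
    ν = ν' := by
  apply stdSimplex.ext
  funext θ
  rcases SignType.trichotomy θ with rfl | rfl | rfl
  · rw [belief_neg_eq ν, belief_neg_eq ν', ha, hz]
  · exact hz
  · rw [belief_pos_eq ν, belief_pos_eq ν', ha, hz]

/-- The belief with mean state `a` and probability `z` of state `0`. -/
def ofCoords (a z : ℝ) (hz : 0 ≤ z) (hp : a ≤ 1 - z) (hm : -a ≤ 1 - z) : Belief :=
  ⟨fun | .zero => z | .neg => (1 - z - a) / 2 | .pos => (1 - z + a) / 2, by
    constructor
    · rintro (_ | _ | _) <;> simp only <;> linarith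
    · rw [sum_state]
      change z + (1 - z - a) / 2 + (1 - z + a) / 2 = 1
      ring⟩

lemma meanState_ofCoords {a z : ℝ} (hz : 0 ≤ z) (hp : a ≤ 1 - z) (hm : -a ≤ 1 - z) :
    meanState (ofCoords a z hz hp hm) = a := by
  rw [meanState_eq]
  change (1 - z + a) / 2 - (1 - z - a) / 2 = a
  ring

/-- The extreme probabilities are `(1 - z ± a) / 2`, so the Euclidean norm has no cross term in `(a,
z)`. The weights `3/2` and `1/2` are the source of the constants in `critSlope`. -/
lemma beliefDist_sq (ν ν' : Belief) : beliefDist ν ν' ^ 2 =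
    3 / 2 * (ν 0 - ν' 0) ^ 2 + 1 / 2 * (meanState ν - meanState ν') ^ 2 := by
  rw [beliefDist, Real.sq_sqrt (Finset.sum_nonneg fun _ _ => sq_nonneg _), sum_state,
    belief_pos_eq ν, belief_pos_eq ν', belief_neg_eq ν, belief_neg_eq ν']
  ring

lemma beliefDist_nonneg (ν ν' : Belief) : 0 ≤ beliefDist ν ν' := Real.sqrt_nonneg _

lemma mem_actions {a : ℝ} : a ∈ actions ↔ -1 ≤ a ∧ a ≤ 1 := by
  have h : (Set.range fun θ : State => (θ : ℝ)) ⊆ Set.Icc (-1) 1 := by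
    rintro _ ⟨θ, rfl⟩
    rcases SignType.trichotomy θ with rfl | rfl | rfl <;> simp
  constructor
  · intro ha
    exact convexHull_min h (convex_Icc _ _) ha
  · rintro ⟨h1, h2⟩
    have hseg : segment ℝ (-1 : ℝ) 1 ⊆ actions :=
      (convex_convexHull ℝ _).segment_subset
        (subset_convexHull ℝ _ ⟨-1, by simp⟩) (subset_convexHull ℝ _ ⟨1, by simp⟩)
    apply hseg
    rw [segment_eq_Icc (by norm_num)]
    exact ⟨h1, h2⟩

/-- Completing the square: the best action is the mean state, which lies in `[-1, 1]`, and what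
remains is minus the variance of the state. -/
lemma indirectU_eq (ν : Belief) : indirectU ν = meanState ν ^ 2 - 1 + ν 0 := by
  have hval : ∀ a : ℝ, ∑ θ, payoff a θ * ν θ
      = meanState ν ^ 2 - 1 + ν 0 - (a - meanState ν) ^ 2 := by
    intro a
    rw [sum_state, belief_pos_eq, belief_neg_eq]
    simp only [payoff]
    simp
    ring
  have hg : IsGreatest ((fun a => ∑ θ, payoff a θ * ν θ) '' actions)
      (meanState ν ^ 2 - 1 + ν 0) := by
    constructor
    · refine ⟨meanState ν, mem_actions.2 ?_, ?_⟩
      · have := meanState_le ν; have := neg_meanState_le ν; have := belief_nonneg ν 0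
        constructor <;> linarith
      · simp only [hval]; ring
    · rintro _ ⟨a, -, rfl⟩
      simp only [hval]
      nlinarith [sq_nonneg (a - meanState ν)]
  exact hg.csSup_eq

/-! ### Continuity and integrability -/

lemma continuous_coord (θ : State) : Continuous fun ν : Belief => ν θ :=
  (continuous_apply θ).comp continuous_subtype_val

@[fun_prop]
lemma continuous_zero : Continuous fun ν : Belief => ν 0 := continuous_coord 0

@[fun_prop]
lemma continuous_meanState : Continuous meanState := by
  have : meanState = fun ν : Belief => ν 1 - ν (-1) := funext meanState_eq
  rw [this]
  exact (continuous_coord 1).sub (continuous_coord (-1))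

lemma integrable_of_continuous {f : Belief → ℝ} (hf : Continuous f) (q : Measure Belief)
    [IsFiniteMeasure q] : Integrable f q := by
  obtain ⟨C, hC⟩ := isCompact_univ.exists_bound_of_continuousOn hf.continuousOn
  exact Integrable.of_bound hf.aestronglyMeasurable C
    (Filter.Eventually.of_forall fun x => hC x (Set.mem_univ x))

lemma mem_policies_iff {μ : Belief} {p : Measure Belief} : p ∈ policies μ ↔
    IsProbabilityMeasure p ∧ ∫ ν, meanState ν ∂p = meanState μ ∧ ∫ ν, ν 0 ∂p = μ 0 := by
  have hi : ∀ θ : State, IsProbabilityMeasure p → Integrable (fun ν : Belief => ν θ) p :=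
    fun θ _ => integrable_of_continuous (continuous_coord θ) p
  constructor
  · rintro ⟨hp, h⟩
    refine ⟨hp, ?_, h 0⟩
    simp only [meanState_eq]
    rw [integral_sub (hi 1 hp) (hi (-1) hp), h, h]
  · rintro ⟨hp, ha, hz⟩
    refine ⟨hp, fun θ => ?_⟩
    have ia := integrable_of_continuous continuous_meanState p
    have iz := hi 0 hp
    have i1 : Integrable (fun ν : Belief => 1 - ν 0) p :=
      integrable_of_continuous (by fun_prop) p
    rcases SignType.trichotomy θ with rfl | rfl | rfl
    · simp only [belief_neg_eq]
      rw [integral_div, integral_sub i1 ia,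
        integral_sub (integrable_const _) iz, ha, hz]
      simp
    · exact hz
    · simp only [belief_pos_eq]
      rw [integral_div, integral_add i1 ia,
        integral_sub (integrable_const _) iz, ha, hz]
      simp

/-- Integral of a quadratic function of the coordinates. -/
lemma integral_quadratic (p : Measure Belief) [IsProbabilityMeasure p] (b c d e f g : ℝ) :
    ∫ ν : Belief, (b * meanState ν ^ 2 + c * ν 0 ^ 2 + d * (meanState ν * ν 0) + e * meanState ν
      + f * ν 0 + g) ∂p =
    b * (∫ ν, meanState ν ^ 2 ∂p) + c * (∫ ν, ν 0 ^ 2 ∂p) + d * (∫ ν, meanState ν * ν 0 ∂p)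
      + e * (∫ ν, meanState ν ∂p) + f * (∫ ν, ν 0 ∂p) + g := by
  have ic : ∀ {h : Belief → ℝ}, Continuous h → Integrable h p :=
    fun hh => integrable_of_continuous hh p
  rw [integral_add (ic (by fun_prop)) (ic (by fun_prop)),
    integral_add (ic (by fun_prop)) (ic (by fun_prop)),
    integral_add (ic (by fun_prop)) (ic (by fun_prop)),
    integral_add (ic (by fun_prop)) (ic (by fun_prop)),
    integral_add (ic (by fun_prop)) (ic (by fun_prop))]
  simp only [integral_const_mul]
  simp

/-- Utility is `a²` plus an affine function, whose integral is fixed by the mean. Only the second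
moment of the action matters to the principal. -/
lemma integral_indirectU {μ : Belief} {q : Measure Belief} (hq : q ∈ policies μ) :
    ∫ ν, indirectU ν ∂q = (∫ ν, meanState ν ^ 2 ∂q) - 1 + μ 0 := by
  obtain ⟨hp, -, hz⟩ := mem_policies_iff.1 hq
  have := integral_quadratic q 1 0 0 0 1 (-1)
  rw [hz] at this
  rw [show (fun ν => indirectU ν) = fun ν : Belief => (1 * meanState ν ^ 2 + 0 * ν 0 ^ 2
    + 0 * (meanState ν * ν 0) + 0 * meanState ν + 1 * ν 0 + (-1)) from
    funext fun ν => by rw [indirectU_eq]; ring, this]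
  ring

lemma agentU_eq (μ : Belief) (κ : ℝ) (ν : Belief) : agentU μ κ ν =
    (1 - κ / 2) * meanState ν ^ 2 + (-(3 * κ / 2)) * ν 0 ^ 2 + 0 * (meanState ν * ν 0)
      + κ * meanState μ * meanState ν + (1 + 3 * κ * μ 0) * ν 0
      + (-1 - κ / 2 * meanState μ ^ 2 - 3 * κ / 2 * μ 0 ^ 2) := by
  rw [agentU, cost, indirectU_eq, beliefDist_sq]
  ring

@[fun_prop]
lemma continuous_agentU (μ : Belief) (κ : ℝ) : Continuous (agentU μ κ) := by
  rw [funext (agentU_eq μ κ)]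
  fun_prop

/-- Prior mean state, squared mean state and squared probability of `0` determine the agent's
payoff. -/
lemma integral_agentU (μ : Belief) (κ : ℝ) {ν : Belief} {q : Measure Belief}
    (hq : q ∈ policies ν) : ∫ x, agentU μ κ x ∂q = agentU μ κ ν
      + (1 - κ / 2) * ((∫ x, meanState x ^ 2 ∂q) - meanState ν ^ 2)
      - 3 * κ / 2 * ((∫ x, x 0 ^ 2 ∂q) - ν 0 ^ 2) := by
  obtain ⟨hp, ha, hz⟩ := mem_policies_iff.1 hq
  simp only [agentU_eq]
  rw [integral_quadratic, ha, hz]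
  ring

/-! ### Incentive compatibility -/

/-- Any two beliefs in `S` are at least as far apart in terms of choice as psychologically. -/
def Discernible (κ : ℝ) (S : Set Belief) : Prop :=
  ∀ x ∈ S, ∀ y ∈ S, κ * beliefDist x y ^ 2 ≤ (meanState x - meanState y) ^ 2

/-- In coordinates, discernibility is a bound on the slope `Δz / Δa`. -/
lemma Discernible.two_mul {κ : ℝ} {S : Set Belief} (h : Discernible κ S) {x y : Belief}
    (hx : x ∈ S) (hy : y ∈ S) :
    3 * κ * (x 0 - y 0) ^ 2 ≤ (2 - κ) * (meanState x - meanState y) ^ 2 := by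
  have := h x hx y hy
  rw [beliefDist_sq] at this
  linarith

/-- Variance comparison for a policy concentrated on a discernible set. -/
lemma Discernible.variance_le {κ : ℝ} {S : Set Belief} (h : Discernible κ S) {y : Belief}
    {ρ : Measure Belief} (hρ : ρ ∈ policies y) (hS : ∀ᵐ x ∂ρ, x ∈ S) :
    3 * κ * ((∫ x, x 0 ^ 2 ∂ρ) - y 0 ^ 2)
      ≤ (2 - κ) * ((∫ x, meanState x ^ 2 ∂ρ) - meanState y ^ 2) := by
  obtain ⟨hp, ha, hz⟩ := mem_policies_iff.1 hρ
  -- The pairwise inequality is integrated over `w` with `x` fixed, then over `x`; the double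
  -- integral of a squared difference is twice the variance.
  have inner : ∀ᵐ x ∂ρ, 0 ≤ (2 - κ) * meanState x ^ 2 + (-(3 * κ)) * x 0 ^ 2
      + 0 * (meanState x * x 0) + (-(2 * (2 - κ) * meanState y)) * meanState x
      + 6 * κ * y 0 * x 0
      + ((2 - κ) * (∫ w, meanState w ^ 2 ∂ρ) - 3 * κ * ∫ w, w 0 ^ 2 ∂ρ) := by
    filter_upwards [hS] with x hx
    have h1 : 0 ≤ ∫ w : Belief, ((2 - κ) * meanState w ^ 2 + (-(3 * κ)) * w 0 ^ 2
      + 0 * (meanState w * w 0) + (-(2 * (2 - κ) * meanState x)) * meanState w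
      + 6 * κ * x 0 * w 0 + ((2 - κ) * meanState x ^ 2 - 3 * κ * x 0 ^ 2)) ∂ρ := by
      apply integral_nonneg_of_ae
      filter_upwards [hS] with w hw
      have := h.two_mul hw hx
      simp only [Pi.zero_apply]
      linarith
    rw [integral_quadratic, ha, hz] at h1
    linarith
  have h2 := integral_nonneg_of_ae inner
  rw [integral_quadratic, ha, hz] at h2
  linarith

/-! ### Kernels and the Blackwell order -/

lemma bind_eq_comp (q : Measure Belief) (r : Kernel Belief Belief) :
    q.bind r = (r.comp (Kernel.const Unit q)) () := by
  rw [Kernel.comp_apply, Kernel.const_apply]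

lemma integral_bind_kernel {q : Measure Belief} [IsProbabilityMeasure q] {r : Kernel Belief Belief}
    [IsMarkovKernel r] {f : Belief → ℝ} (hf : Continuous f) :
    ∫ x, f x ∂(q.bind r) = ∫ y, ∫ x, f x ∂(r y) ∂q := by
  rw [bind_eq_comp, Kernel.integral_comp (integrable_of_continuous hf _), Kernel.const_apply]

lemma integrable_integral_kernel {q : Measure Belief} [IsProbabilityMeasure q]
    {r : Kernel Belief Belief} [IsMarkovKernel r] {f : Belief → ℝ} (hf : Continuous f) :
    Integrable (fun y => ∫ x, f x ∂(r y)) q := by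
  have h : Integrable f ((r.comp (Kernel.const Unit q)) ()) := integrable_of_continuous hf _
  simpa using h.integral_comp

lemma isMarkovKernel_of_policies {r : Kernel Belief Belief} (h : ∀ ν, r ν ∈ policies ν) :
    IsMarkovKernel r := ⟨fun ν => (h ν).1⟩

lemma MoreInformative.refl (q : Measure Belief) : MoreInformative q q := by
  refine ⟨Kernel.id, ?_, fun ν => ⟨?_, fun θ => ?_⟩⟩
  · change q = q.bind (fun x => Kernel.id x)
    simp [Kernel.id_apply]
  · rw [Kernel.id_apply]; infer_instance
  · rw [Kernel.id_apply, integral_dirac]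

lemma MoreInformative.trans {p q r : Measure Belief} (h : MoreInformative p q)
    (h' : MoreInformative q r) : MoreInformative p r := by
  obtain ⟨k, rfl, hk⟩ := h
  obtain ⟨k', rfl, hk'⟩ := h'
  have := isMarkovKernel_of_policies hk
  have := isMarkovKernel_of_policies hk'
  refine ⟨k.comp k', ?_, fun ν => ⟨inferInstance, fun θ => ?_⟩⟩
  · exact Measure.comp_assoc
  · rw [Kernel.comp_apply]
    have := (hk' ν).1
    rw [integral_bind_kernel (continuous_coord θ)]
    simp only [(hk _).2 θ]
    exact (hk' ν).2 θ

/-- A policy with discernible support is an optimal garbling of itself. -/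
lemma Discernible.mem_optimalGarblings {μ : Belief} {κ : ℝ} {q : Measure Belief}
    (hq : q ∈ policies μ) (h : Discernible κ q.support) : q ∈ optimalGarblings μ κ q := by
  refine ⟨⟨hq, MoreInformative.refl q⟩, fun q' hq' hqq' => ?_⟩
  obtain ⟨r, hr, hmean⟩ := hqq'
  have := isMarkovKernel_of_policies hmean
  have := hq'.1
  have := hq.1
  -- As `q = q'.bind r`, almost every `r y` is carried by the support of `q`. Splitting `y` into `r
  -- y` then never lowers the agent's payoff, by `Discernible.variance_le`.
  have hsupp : ∀ᵐ x ∂(q'.bind r), x ∈ q.support := by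
    rw [← hr]; exact Measure.support_mem_ae
  have hae := Measure.ae_ae_of_ae_bind r.measurable.aemeasurable hsupp
  conv_rhs => rw [hr, integral_bind_kernel (continuous_agentU μ κ)]
  refine integral_mono_ae (integrable_of_continuous (continuous_agentU μ κ) _) ?_ ?_
  · exact integrable_integral_kernel (continuous_agentU μ κ)
  · filter_upwards [hae] with y hy
    have hv := h.variance_le (hmean y) hy
    rw [integral_agentU μ κ (hmean y)]
    linarith

/-- Pooling part of a policy at its mean garbles it. -/
lemma moreInformative_pool (q₁ q₂ : Measure Belief) [IsFiniteMeasure q₁] [IsFiniteMeasure q₂]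
    (h₂ : q₂ Set.univ ≠ 0) (x : Belief) (hx : ∀ θ, ∫ ν, ν θ ∂q₂ = (q₂ Set.univ).toReal * x θ) :
    MoreInformative (q₁ + q₂) (q₁ + q₂ Set.univ • Measure.dirac x) := by
  -- The belief `x` may already be an atom of `q₁`. The kernel therefore sends `x` to the normalised
  -- sum of `q₂` and that atom, and leaves every other belief in place.
  set ρ : Measure Belief := q₂ + q₁.restrict {x} with hρ
  have hM : ρ Set.univ = q₂ Set.univ + q₁ {x} := by simp [hρ]
  have hM0 : ρ Set.univ ≠ 0 := by rw [hM]; simp [h₂]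
  have hMt : ρ Set.univ ≠ ⊤ := measure_ne_top _ _
  set ρ' : Measure Belief := (ρ Set.univ)⁻¹ • ρ with hρ'
  have hprob : IsProbabilityMeasure ρ' :=
    ⟨by rw [hρ', Measure.smul_apply, smul_eq_mul, ENNReal.inv_mul_cancel hM0 hMt]⟩
  classical
  set r : Kernel Belief Belief :=
    Kernel.piecewise (measurableSet_singleton x) (Kernel.const _ ρ') Kernel.id with hr
  have hrx : ∀ ν, r ν = if ν ∈ ({x} : Set Belief) then ρ' else Measure.dirac ν := by
    intro ν
    rw [hr, Kernel.piecewise_apply, Kernel.const_apply, Kernel.id_apply]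
  refine ⟨r, ?_, fun ν => ?_⟩
  · ext s hs
    rw [Measure.bind_apply hs r.measurable.aemeasurable, lintegral_add_measure,
      lintegral_smul_measure, lintegral_dirac, hrx x, if_pos (Set.mem_singleton x),
      ← lintegral_add_compl _ (measurableSet_singleton x),
      setLIntegral_congr_fun (g := fun _ => ρ' s) (measurableSet_singleton x)
        (fun ν hν => by simp only [hrx ν, if_pos hν]),
      setLIntegral_congr_fun (g := s.indicator 1) (measurableSet_singleton x).compl
        (fun ν hν => by simp only [hrx ν, if_neg hν, Measure.dirac_apply' ν hs]),
      setLIntegral_const, lintegral_indicator_one hs, Measure.restrict_apply hs,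
      Measure.add_apply]
    have e1 : ρ' s * q₁ {x} + q₂ Set.univ • ρ' s = ρ s := by
      rw [smul_eq_mul, mul_comm (ρ' s), ← add_mul, add_comm, ← hM, hρ', Measure.smul_apply,
        smul_eq_mul, ← mul_assoc, ENNReal.mul_inv_cancel hM0 hMt, one_mul]
    rw [add_right_comm, e1, hρ, Measure.add_apply, Measure.restrict_apply hs, add_assoc,
      ← Set.sdiff_eq, measure_inter_add_sdiff _ (measurableSet_singleton x), add_comm]
  · rw [hrx ν]
    split_ifs with hν
    · rw [Set.mem_singleton_iff] at hν
      subst hν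
      refine ⟨hprob, fun θ => ?_⟩
      have ic : ∀ (m : Measure Belief) [IsFiniteMeasure m], Integrable (fun ν : Belief => ν θ) m :=
        fun m _ => integrable_of_continuous (continuous_coord θ) m
      have hne : (ρ Set.univ).toReal ≠ 0 := (ENNReal.toReal_pos hM0 hMt).ne'
      have hint : ∫ w : Belief, w θ ∂ρ = (ρ Set.univ).toReal * ν θ := by
        rw [hM, ENNReal.toReal_add (measure_ne_top _ _) (measure_ne_top _ _), add_mul, hρ,
          integral_add_measure (ic _) (ic _), hx, Measure.restrict_singleton,
          integral_smul_measure, integral_dirac, smul_eq_mul]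
      rw [hρ', integral_smul_measure, hint, ENNReal.toReal_inv, smul_eq_mul, ← mul_assoc,
        inv_mul_cancel₀ hne, one_mul]
    · exact ⟨inferInstance, fun θ => integral_dirac _ _⟩

/-- The barycentre: the inequalities that cut out the triangle are affine and survive integration.
-/
lemma exists_mem_policies (ρ : Measure Belief) [IsProbabilityMeasure ρ] :
    ∃ m : Belief, ρ ∈ policies m := by
  have ia := integrable_of_continuous continuous_meanState ρ
  have iz := integrable_of_continuous continuous_zero ρ
  have i1 : Integrable (fun ν : Belief => 1 - ν 0) ρ :=
    integrable_of_continuous (by fun_prop) ρ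
  have e1 : ∫ ν : Belief, (1 - ν 0) ∂ρ = 1 - ∫ ν : Belief, ν 0 ∂ρ := by
    rw [integral_sub (integrable_const _) iz]; simp
  refine ⟨ofCoords (∫ ν, meanState ν ∂ρ) (∫ ν : Belief, ν 0 ∂ρ)
    (integral_nonneg fun ν => belief_nonneg ν 0) ?_ ?_, mem_policies_iff.2
      ⟨inferInstance, (meanState_ofCoords _ _ _).symm, rfl⟩⟩
  · rw [← e1]
    exact integral_mono ia i1 meanState_le
  · rw [← e1, ← integral_neg]
    exact integral_mono ia.neg i1 neg_meanState_le

/-- No part of a policy that is its own optimal garbling is worth pooling. -/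
lemma variance_le_of_mem_optimalGarblings {μ : Belief} {κ : ℝ} {q : Measure Belief}
    (hq : q ∈ optimalGarblings μ κ q) (ρ : Measure Belief) [IsProbabilityMeasure ρ] {C : ENNReal}
    (hC : C ≠ ⊤) (hρ : ρ ≤ C • q) :
    3 * κ * ((∫ x, x 0 ^ 2 ∂ρ) - (∫ x, x 0 ∂ρ) ^ 2)
      ≤ (2 - κ) * ((∫ x, meanState x ^ 2 ∂ρ) - (∫ x, meanState x ∂ρ) ^ 2) := by
  obtain ⟨m, hm⟩ := exists_mem_policies ρ
  obtain ⟨⟨hqμ, -⟩, hopt⟩ := hq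
  have := hqμ.1
  have hC0 : C ≠ 0 := by
    rintro rfl
    have h := hρ Set.univ
    simp at h
  have hH0 : C⁻¹ ≠ 0 := ENNReal.inv_ne_zero.2 hC
  have hHt : C⁻¹ ≠ ⊤ := ENNReal.inv_ne_top.2 hC0
  have hfin : IsFiniteMeasure (C⁻¹ • ρ) := Measure.smul_finite _ hHt
  -- Since `q` contains the measure `C⁻¹ • ρ`, replacing this part by a mass at its mean `m` is an
  -- available garbling.
  have hle : C⁻¹ • ρ ≤ q := by
    intro s
    have h := hρ s
    rw [Measure.smul_apply, smul_eq_mul] at h ⊢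
    calc C⁻¹ * ρ s ≤ C⁻¹ * (C * q s) := by gcongr
      _ = q s := by rw [← mul_assoc, ENNReal.inv_mul_cancel hC0 hC, one_mul]
  set q₁ : Measure Belief := q - C⁻¹ • ρ with hq₁
  have hfin₁ : IsFiniteMeasure q₁ := isFiniteMeasure_of_le q Measure.sub_le
  have hsum : q₁ + C⁻¹ • ρ = q := Measure.sub_add_cancel_of_le hle
  have huniv : (C⁻¹ • ρ) Set.univ = C⁻¹ := by simp
  have hmass : ∀ f : Belief → ℝ, Continuous f →
      ∫ x, f x ∂q = (∫ x, f x ∂q₁) + C⁻¹.toReal * ∫ x, f x ∂ρ := by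
    intro f hf
    conv_lhs => rw [← hsum]
    rw [integral_add_measure (integrable_of_continuous hf _) (integrable_of_continuous hf _),
      integral_smul_measure, smul_eq_mul]
  have hfin₂ : IsFiniteMeasure (C⁻¹ • Measure.dirac m) := Measure.smul_finite _ hHt
  have hmass' : ∀ f : Belief → ℝ, Continuous f →
      ∫ x, f x ∂(q₁ + C⁻¹ • Measure.dirac m) = (∫ x, f x ∂q₁) + C⁻¹.toReal * f m := by
    intro f hf
    rw [integral_add_measure (integrable_of_continuous hf _) (integrable_of_continuous hf _),
      integral_smul_measure, smul_eq_mul, integral_dirac]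
  have hgarb : MoreInformative q (q₁ + C⁻¹ • Measure.dirac m) := by
    have h := moreInformative_pool q₁ (C⁻¹ • ρ) (by rw [huniv]; exact hH0) m (fun θ => by
      rw [huniv, integral_smul_measure, hm.2 θ, smul_eq_mul])
    rwa [hsum, huniv] at h
  have hpol : q₁ + C⁻¹ • Measure.dirac m ∈ policies μ := by
    refine ⟨⟨?_⟩, fun θ => ?_⟩
    · have h : q Set.univ = 1 := measure_univ
      rw [← hsum, Measure.add_apply, huniv] at h
      simpa using h
    · rw [hmass' _ (continuous_coord θ), ← hqμ.2 θ, hmass _ (continuous_coord θ), hm.2 θ]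
  have h := hopt _ hpol hgarb
  rw [hmass' _ (continuous_agentU μ κ), hmass _ (continuous_agentU μ κ)] at h
  have hpos : 0 < C⁻¹.toReal := ENNReal.toReal_pos hH0 hHt
  have h' : agentU μ κ m ≤ ∫ x, agentU μ κ x ∂ρ := by
    nlinarith
  rw [integral_agentU μ κ hm] at h'
  obtain ⟨-, ha, hz⟩ := mem_policies_iff.1 hm
  rw [ha, hz]
  linarith

/-- Conditioning on small balls stands in for atoms, which a policy need not have: a ball around a
point of the support has positive mass. -/
lemma tendsto_integral_cond_ball {q : Measure Belief} [IsProbabilityMeasure q] {x : Belief}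
    (hx : x ∈ q.support) {f : Belief → ℝ} (hf : Continuous f) :
    Filter.Tendsto (fun n : ℕ => ∫ w, f w ∂(cond q (Metric.ball x (1 / ((n : ℝ) + 1)))))
      Filter.atTop (nhds (f x)) := by
  rw [Metric.tendsto_atTop]
  intro δ hδ
  obtain ⟨ε, hε, hball⟩ := Metric.continuous_iff.1 hf x (δ / 2) (half_pos hδ)
  obtain ⟨N, hN⟩ := exists_nat_one_div_lt hε
  refine ⟨N, fun n hn => ?_⟩
  set B := Metric.ball x (1 / ((n : ℝ) + 1)) with hB
  have hBpos : 0 < q B :=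
    (Measure.mem_support_iff_forall x).1 hx B (Metric.ball_mem_nhds x (by positivity))
  have hprob : IsProbabilityMeasure (cond q B) := cond_isProbabilityMeasure hBpos.ne'
  have hae : ∀ᵐ w ∂(cond q B), ‖f w - f x‖ ≤ δ / 2 := by
    filter_upwards [ae_cond_mem (μ := q) (s := B) Metric.isOpen_ball.measurableSet] with w hw
    rw [← dist_eq_norm]
    refine (hball w ?_).le
    have h1 : (1 : ℝ) / ((n : ℝ) + 1) ≤ 1 / ((N : ℝ) + 1) := by gcongr
    exact (Metric.mem_ball.1 hw).trans_le (h1.trans hN.le)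
  have hint : ∫ w, f w ∂(cond q B) - f x = ∫ w, (f w - f x) ∂(cond q B) := by
    rw [integral_sub (integrable_of_continuous hf _) (integrable_const _)]
    simp
  rw [Real.dist_eq, hint, ← Real.norm_eq_abs]
  have := norm_integral_le_of_norm_le_const hae
  simp at this
  rw [Real.norm_eq_abs]
  linarith

/-- Necessity of order-IC for all pairs of beliefs in the support. -/
lemma discernible_support_of_mem_optimalGarblings {μ : Belief} {κ : ℝ} {q : Measure Belief}
    (hq : q ∈ optimalGarblings μ κ q) : Discernible κ q.support := by
  intro x hx y hy
  have := hq.1.1.1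
  -- An equal mixture of the conditional laws near `x` and near `y` is dominated by a multiple of
  -- `q`. The pooling inequality for this mixture tends to the inequality for the pair `x`, `y`.
  set ρ : Belief → ℕ → Measure Belief :=
    fun w n => cond q (Metric.ball w (1 / ((n : ℝ) + 1))) with hρ
  have hball : ∀ w ∈ q.support, ∀ n : ℕ, q (Metric.ball w (1 / ((n : ℝ) + 1))) ≠ 0 := fun w hw n =>
    ((Measure.mem_support_iff_forall w).1 hw _ (Metric.ball_mem_nhds w (by positivity))).ne'
  have hprob : ∀ w ∈ q.support, ∀ n, IsProbabilityMeasure (ρ w n) := fun w hw n =>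
    cond_isProbabilityMeasure (hball w hw n)
  have hpair : ∀ n, 3 * κ * (((∫ w, w 0 ^ 2 ∂ρ x n) + ∫ w, w 0 ^ 2 ∂ρ y n) / 2
      - (((∫ w, w 0 ∂ρ x n) + ∫ w, w 0 ∂ρ y n) / 2) ^ 2)
      ≤ (2 - κ) * (((∫ w, meanState w ^ 2 ∂ρ x n) + ∫ w, meanState w ^ 2 ∂ρ y n) / 2
      - (((∫ w, meanState w ∂ρ x n) + ∫ w, meanState w ∂ρ y n) / 2) ^ 2) := by
    intro n
    have := hprob x hx n
    have := hprob y hy n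
    have h2t : (2 : ENNReal)⁻¹ ≠ ⊤ := by simp
    have hf1 : IsFiniteMeasure ((2 : ENNReal)⁻¹ • ρ x n) := Measure.smul_finite _ h2t
    have hf2 : IsFiniteMeasure ((2 : ENNReal)⁻¹ • ρ y n) := Measure.smul_finite _ h2t
    set σ : Measure Belief := (2 : ENNReal)⁻¹ • ρ x n + (2 : ENNReal)⁻¹ • ρ y n with hσ
    have hσp : IsProbabilityMeasure σ := by
      refine ⟨?_⟩
      simp [hσ, ENNReal.inv_two_add_inv_two]
    have hint : ∀ f : Belief → ℝ, Continuous f →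
        ∫ w, f w ∂σ = ((∫ w, f w ∂ρ x n) + ∫ w, f w ∂ρ y n) / 2 := by
      intro f hf
      rw [hσ, integral_add_measure (integrable_of_continuous hf _) (integrable_of_continuous hf _),
        integral_smul_measure, integral_smul_measure]
      simp
      ring
    have hcond : ∀ w, ρ w n ≤ (q (Metric.ball w (1 / ((n : ℝ) + 1))))⁻¹ • q := by
      intro w
      exact Measure.le_iff'.2 fun s => by
        simp only [hρ, ProbabilityTheory.cond, Measure.smul_apply, smul_eq_mul]
        gcongr
        exact Measure.restrict_le_self
    have hle : σ ≤ ((q (Metric.ball x (1 / ((n : ℝ) + 1))))⁻¹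
        + (q (Metric.ball y (1 / ((n : ℝ) + 1))))⁻¹) • q := by
      rw [hσ, add_smul]
      have h1 : ∀ m : Measure Belief, (2 : ENNReal)⁻¹ • m ≤ m := fun m => Measure.le_iff'.2 fun s => by
        rw [Measure.smul_apply, smul_eq_mul]
        exact mul_le_of_le_one_left zero_le (by simp)
      exact add_le_add ((h1 _).trans (hcond x)) ((h1 _).trans (hcond y))
    have h := variance_le_of_mem_optimalGarblings hq σ
      (ENNReal.add_ne_top.2 ⟨ENNReal.inv_ne_top.2 (hball x hx n),
        ENNReal.inv_ne_top.2 (hball y hy n)⟩) hle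
    rw [hint _ (by fun_prop), hint _ (by fun_prop), hint _ (by fun_prop), hint _ (by fun_prop)] at h
    exact h
  have lim : ∀ f : Belief → ℝ, Continuous f → Filter.Tendsto
      (fun n => ((∫ w, f w ∂ρ x n) + ∫ w, f w ∂ρ y n) / 2) Filter.atTop
      (nhds ((f x + f y) / 2)) := fun f hf =>
    ((tendsto_integral_cond_ball hx hf).add (tendsto_integral_cond_ball hy hf)).div_const 2
  have h := le_of_tendsto_of_tendsto'
    (((lim (fun w => w 0 ^ 2) (by fun_prop)).sub
      ((lim (fun w => w 0) (by fun_prop)).pow 2)).const_mul (3 * κ))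
    (((lim (fun w => meanState w ^ 2) (by fun_prop)).sub
      ((lim meanState (by fun_prop)).pow 2)).const_mul (2 - κ)) hpair
  rw [beliefDist_sq]
  linarith

/-- A policy is incentive compatible if and only if its support is discernible. -/
theorem mem_optimalGarblings_self_iff {μ : Belief} {κ : ℝ} {q : Measure Belief} :
    q ∈ optimalGarblings μ κ q ↔ q ∈ policies μ ∧ Discernible κ q.support :=
  ⟨fun h => ⟨h.1.1, discernible_support_of_mem_optimalGarblings h⟩,
    fun h => h.2.mem_optimalGarblings h.1⟩

/-- By transitivity, every garbling of the agent's choice was available from `p` already. The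
principal may therefore offer the outcome itself. -/
lemma mem_optimalGarblings_self {μ : Belief} {κ : ℝ} {p q : Measure Belief}
    (h : q ∈ optimalGarblings μ κ p) : q ∈ optimalGarblings μ κ q :=
  ⟨⟨h.1.1, MoreInformative.refl q⟩, fun q' hq' hqq' => h.2 q' hq' (h.1.2.trans hqq')⟩

/-- Optimal attention outcomes maximise the dispersion of the action subject to order-IC. -/
theorem isOptimalOutcome_iff {μ : Belief} {κ : ℝ} {q : Measure Belief} :
    IsOptimalOutcome μ κ q ↔ (q ∈ policies μ ∧ Discernible κ q.support) ∧
      ∀ q', q' ∈ policies μ → Discernible κ q'.support →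
        ∫ ν, meanState ν ^ 2 ∂q' ≤ ∫ ν, meanState ν ^ 2 ∂q := by
  constructor
  · rintro ⟨p, ⟨hp, hq⟩, hopt⟩
    refine ⟨mem_optimalGarblings_self_iff.1 (mem_optimalGarblings_self hq), fun q' hq' hd => ?_⟩
    have h := hopt q' q' hq' (mem_optimalGarblings_self_iff.2 ⟨hq', hd⟩)
    rw [integral_indirectU hq', integral_indirectU hq.1.1] at h
    linarith
  · rintro ⟨⟨hq, hd⟩, hopt⟩
    refine ⟨q, ⟨hq, mem_optimalGarblings_self_iff.2 ⟨hq, hd⟩⟩, fun p' q' _ hq' => ?_⟩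
    have h' := mem_optimalGarblings_self_iff.1 (mem_optimalGarblings_self hq')
    rw [integral_indirectU hq, integral_indirectU h'.1]
    linarith [hopt q' h'.1 h'.2]

/-! ### Bounds on the dispersion of the action -/

/-- The zero set is closed and of full measure, so it contains the support. This turns equality in
an integrated bound into a pointwise description of the support. -/
lemma eq_zero_on_support {q : Measure Belief} [IsFiniteMeasure q] {f : Belief → ℝ}
    (hf : Continuous f) (h0 : ∀ x ∈ q.support, 0 ≤ f x) (hint : ∫ x, f x ∂q = 0) :
    ∀ x ∈ q.support, f x = 0 := by
  have hae : 0 ≤ᵐ[q] f := by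
    filter_upwards [Measure.support_mem_ae (μ := q)] with x hx using h0 x hx
  have h := (integral_eq_zero_iff_of_nonneg_ae hae (integrable_of_continuous hf q)).1 hint
  have hsub : q.support ⊆ {x | f x = 0} :=
    Measure.support_subset_of_isClosed (isClosed_eq hf continuous_const) h
  exact fun x hx => hsub hx

lemma integral_nonneg_of_support {q : Measure Belief} {f : Belief → ℝ}
    (h0 : ∀ x ∈ q.support, 0 ≤ f x) : 0 ≤ ∫ x, f x ∂q := by
  apply integral_nonneg_of_ae
  filter_upwards [Measure.support_mem_ae (μ := q)] with x hx using h0 x hx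

lemma critSlope_sq {κ : ℝ} (h0 : 0 < κ) (h2 : κ ≤ 2) : 3 * κ * critSlope κ ^ 2 = 2 - κ := by
  rw [critSlope, Real.sq_sqrt (div_nonneg (by linarith) (by linarith))]
  field_simp

lemma critSlope_nonneg (κ : ℝ) : 0 ≤ critSlope κ := Real.sqrt_nonneg _

/-- For costs up to `κ₄`, order-IC bounds the slope. -/
lemma discernible_iff {κ : ℝ} (h0 : 0 < κ) (h2 : κ ≤ 2) {S : Set Belief} :
    Discernible κ S ↔
      ∀ x ∈ S, ∀ y ∈ S, |x 0 - y 0| ≤ critSlope κ * |meanState x - meanState y| := by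
  have hs := critSlope_sq h0 h2
  have key : ∀ x y : Belief, κ * beliefDist x y ^ 2 ≤ (meanState x - meanState y) ^ 2 ↔
      |x 0 - y 0| ≤ critSlope κ * |meanState x - meanState y| := by
    intro x y
    rw [← abs_of_nonneg (critSlope_nonneg κ), ← abs_mul, ← sq_le_sq, beliefDist_sq, mul_pow]
    constructor
    · intro h
      have h' : 3 * κ * (x 0 - y 0) ^ 2
          ≤ 3 * κ * (critSlope κ ^ 2 * (meanState x - meanState y) ^ 2) := by
        rw [← mul_assoc, hs]; linarith
      exact le_of_mul_le_mul_left h' (by linarith)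
    · intro h
      have h' : 3 * κ * (x 0 - y 0) ^ 2
          ≤ 3 * κ * (critSlope κ ^ 2 * (meanState x - meanState y) ^ 2) := by gcongr
      rw [← mul_assoc, hs] at h'
      linarith
  simp only [Discernible, key]

lemma exists_extreme_beliefs (q : Measure Belief) [IsProbabilityMeasure q] :
    ∃ x ∈ q.support, ∃ y ∈ q.support,
      ∀ w ∈ q.support, meanState x ≤ meanState w ∧ meanState w ≤ meanState y := by
  have hc : IsCompact q.support := Measure.isClosed_support.isCompact
  have hne : q.support.Nonempty := Measure.nonempty_support (IsProbabilityMeasure.ne_zero q)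
  obtain ⟨x, hx, hxm⟩ := hc.exists_isMinOn hne continuous_meanState.continuousOn
  obtain ⟨y, hy, hym⟩ := hc.exists_isMaxOn hne continuous_meanState.continuousOn
  exact ⟨x, hx, y, hy, fun w hw => ⟨hxm hw, hym hw⟩⟩

/-- Variance bounds in terms of the distances `l`, `r` of the extreme actions from `-1` and `1`. -/
lemma exists_variance_bounds {μ : Belief} {q : Measure Belief} {s : ℝ} (hq : q ∈ policies μ)
    (hs : ∀ x ∈ q.support, ∀ y ∈ q.support, |x 0 - y 0| ≤ s * |meanState x - meanState y|) :
    ∃ x ∈ q.support, ∃ y ∈ q.support, ∃ l r : ℝ, l = 1 + meanState x ∧ r = 1 - meanState y ∧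
      0 ≤ l ∧ 0 ≤ r ∧ l ≤ 1 + meanState μ ∧ r ≤ 1 - meanState μ ∧
      (∫ w, meanState w ^ 2 ∂q) - meanState μ ^ 2
          ≤ (1 + meanState μ - l) * (1 - meanState μ - r) ∧
      ((∫ w, meanState w ^ 2 ∂q) - meanState μ ^ 2
          = (1 + meanState μ - l) * (1 - meanState μ - r) →
        ∀ w ∈ q.support, (meanState w - meanState x) * (meanState y - meanState w) = 0) ∧
      2 * s * ((∫ w, meanState w ^ 2 ∂q) - meanState μ ^ 2)
          ≤ 2 * s * ((1 + meanState μ - l) * (1 - meanState μ - r)) + l * (1 - meanState μ - r)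
            + r * (1 + meanState μ - l) - (2 - l - r) * μ 0 ∧
      (2 * s * ((∫ w, meanState w ^ 2 ∂q) - meanState μ ^ 2)
          = 2 * s * ((1 + meanState μ - l) * (1 - meanState μ - r)) + l * (1 - meanState μ - r)
            + r * (1 + meanState μ - l) - (2 - l - r) * μ 0 →
        ∀ w ∈ q.support, w 0 * (2 - l - r) = l * (meanState y - meanState w)
          + r * (meanState w - meanState x)
          + 2 * s * ((meanState w - meanState x) * (meanState y - meanState w))) := by
  obtain ⟨hp, ha, hz⟩ := mem_policies_iff.1 hq
  obtain ⟨x, hx, y, hy, hxy⟩ := exists_extreme_beliefs q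
  have h1 := meanState_le y
  have h2 := neg_meanState_le x
  have h3 := belief_nonneg x 0
  have h4 := belief_nonneg y 0
  have iD : ∫ w, ((meanState w - meanState x) * (meanState y - meanState w)) ∂q
      = (meanState μ - meanState x) * (meanState y - meanState μ)
        - ((∫ w, meanState w ^ 2 ∂q) - meanState μ ^ 2) := by
    have h := integral_quadratic q (-1) 0 0 (meanState x + meanState y) 0
      (-(meanState x * meanState y))
    rw [ha, hz] at h
    rw [show (fun w => (meanState w - meanState x) * (meanState y - meanState w)) =
      fun w : Belief => -1 * meanState w ^ 2 + 0 * w 0 ^ 2 + 0 * (meanState w * w 0)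
        + (meanState x + meanState y) * meanState w + 0 * w 0 + -(meanState x * meanState y) from
      funext fun w => by ring, h]
    ring
  have hD : ∀ w ∈ q.support, 0 ≤ (meanState w - meanState x) * (meanState y - meanState w) :=
    fun w hw => mul_nonneg (by linarith [(hxy w hw).1]) (by linarith [(hxy w hw).2])
  -- The slope bounds towards the extremes give `z ≤ l + s (a - a_x)` and `z ≤ r + s (a_y - a)`.
  -- Weighting them by `a_y - a` and `a - a_x` makes the sum quadratic in `a`, with an integral that
  -- depends only on the mean and the variance.
  have hT : ∀ w ∈ q.support, 0 ≤ (1 + meanState x) * (meanState y - meanState w)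
      + (1 - meanState y) * (meanState w - meanState x)
      + 2 * s * ((meanState w - meanState x) * (meanState y - meanState w))
      - w 0 * (meanState y - meanState x) := by
    intro w hw
    obtain ⟨hw1, hw2⟩ := hxy w hw
    have e1 := (abs_le.1 (hs w hw x hx)).2
    rw [abs_of_nonneg (by linarith)] at e1
    have e2 := (abs_le.1 (hs w hw y hy)).2
    rw [abs_of_nonpos (by linarith)] at e2
    have f1 : w 0 ≤ 1 + meanState x + s * (meanState w - meanState x) := by linarith
    have f2 : w 0 ≤ 1 - meanState y + s * (meanState y - meanState w) := by linarith
    nlinarith [mul_le_mul_of_nonneg_right f1 (sub_nonneg.2 hw2),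
      mul_le_mul_of_nonneg_right f2 (sub_nonneg.2 hw1)]
  have iT : ∫ w : Belief, ((1 + meanState x) * (meanState y - meanState w)
      + (1 - meanState y) * (meanState w - meanState x)
      + 2 * s * ((meanState w - meanState x) * (meanState y - meanState w))
      - w 0 * (meanState y - meanState x)) ∂q
      = (1 + meanState x) * (meanState y - meanState μ)
        + (1 - meanState y) * (meanState μ - meanState x)
        + 2 * s * ((meanState μ - meanState x) * (meanState y - meanState μ)
          - ((∫ w, meanState w ^ 2 ∂q) - meanState μ ^ 2))
        - μ 0 * (meanState y - meanState x) := by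
    have h := integral_quadratic q (-(2 * s)) 0 0
      (2 * s * (meanState x + meanState y) - (1 + meanState x) + (1 - meanState y))
      (-(meanState y - meanState x))
      (-(2 * s * (meanState x * meanState y)) + (1 + meanState x) * meanState y
        - (1 - meanState y) * meanState x)
    rw [ha, hz] at h
    refine (integral_congr_ae (Filter.Eventually.of_forall fun w => ?_)).trans (h.trans ?_)
    · ring
    · ring
  have bxμ : meanState x ≤ meanState μ := by
    rw [← ha]
    have h0 := integral_nonneg_of_support (q := q) (f := fun w => meanState w - meanState x)
      fun w hw => by linarith [(hxy w hw).1]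
    rw [integral_sub (integrable_of_continuous continuous_meanState q) (integrable_const _)] at h0
    simpa using h0
  have byμ : meanState μ ≤ meanState y := by
    rw [← ha]
    have h0 := integral_nonneg_of_support (q := q) (f := fun w => meanState y - meanState w)
      fun w hw => by linarith [(hxy w hw).2]
    rw [integral_sub (integrable_const _) (integrable_of_continuous continuous_meanState q)] at h0
    simpa using h0
  have cD := integral_nonneg_of_support hD
  have cT := integral_nonneg_of_support hT
  refine ⟨x, hx, y, hy, 1 + meanState x, 1 - meanState y, rfl, rfl, by linarith, by linarith,
    by linarith, by linarith, ?_, fun he => ?_, ?_, fun he => ?_⟩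
  · rw [iD] at cD; linarith
  · exact eq_zero_on_support (by fun_prop) hD (by rw [iD]; linarith)
  · rw [iT] at cT; linarith
  · intro w hw
    have := eq_zero_on_support (by fun_prop) hT (by rw [iT]; linarith) w hw
    linarith

/-- Dispersion under full revelation is maximal. -/
lemma sq_integral_le {μ : Belief} {q : Measure Belief} (hq : q ∈ policies μ) :
    ∫ w, meanState w ^ 2 ∂q ≤ 1 - μ 0 ∧
      (∫ w, meanState w ^ 2 ∂q = 1 - μ 0 → ∀ w ∈ q.support, meanState w ^ 2 = 1 - w 0) := by
  obtain ⟨hp, ha, hz⟩ := mem_policies_iff.1 hq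
  have i1 : ∫ w : Belief, (1 - w 0 - meanState w ^ 2) ∂q
      = 1 - μ 0 - ∫ w, meanState w ^ 2 ∂q := by
    have h := integral_quadratic q (-1) 0 0 0 (-1) 1
    rw [ha, hz] at h
    refine (integral_congr_ae (Filter.Eventually.of_forall fun w => ?_)).trans (h.trans ?_)
    · ring
    · ring
  -- `a² ≤ |a| ≤ 1 - z` on the triangle.
  have h0 : ∀ w : Belief, 0 ≤ 1 - w 0 - meanState w ^ 2 := by
    intro w
    have h1 := meanState_le w
    have h2 := neg_meanState_le w
    have h3 := belief_nonneg w 0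
    nlinarith
  constructor
  · have := integral_nonneg_of_support (q := q) fun w _ => h0 w
    rw [i1] at this
    linarith
  · intro he w hw
    have := eq_zero_on_support (q := q) (by fun_prop) (fun w _ => h0 w) (by rw [i1]; linarith) w hw
    linarith

/-- Bound attained by downplaying. -/
lemma downplay_bound {μ : Belief} {q : Measure Belief} {s : ℝ} (hq : q ∈ policies μ)
    (hs : ∀ x ∈ q.support, ∀ y ∈ q.support, |x 0 - y 0| ≤ s * |meanState x - meanState y|)
    (hs1 : s < 1) (hA : 1 + meanState μ + μ 0 ≤ 2 * s * (1 + meanState μ))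
    (hB : 1 - meanState μ + μ 0 ≤ 2 * s * (1 - meanState μ)) :
    s * (∫ w, meanState w ^ 2 ∂q) ≤ s - μ 0 := by
  obtain ⟨x, hx, y, hy, l, r, -, -, hl0, hr0, -, -, -, -, hG, -⟩ := exists_variance_bounds hq hs
  -- With `A = 1 + a_μ`, `B = 1 - a_μ`, `z = μ 0`, the bound falls short of its value at `l = r = 0`
  -- by `l (2sB - B - z) + r (2sA - A - z) + 2lr (1 - s)`.
  nlinarith [mul_nonneg hl0 (sub_nonneg.2 hB), mul_nonneg hr0 (sub_nonneg.2 hA),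
    mul_nonneg (mul_nonneg hl0 hr0) (sub_nonneg.2 hs1.le)]

/-- Strictness forces `l = r = 0`, so both corners `(a, z) = (∓1, 0)` are in the support. The
parabola is equality in the second variance bound, the tent is the slope bound towards the corners.
-/
lemma downplay_bound_eq {μ : Belief} {q : Measure Belief} {s : ℝ} (hq : q ∈ policies μ)
    (hs : ∀ x ∈ q.support, ∀ y ∈ q.support, |x 0 - y 0| ≤ s * |meanState x - meanState y|)
    (hs1 : s < 1) (hA : 1 + meanState μ + μ 0 < 2 * s * (1 + meanState μ))
    (hB : 1 - meanState μ + μ 0 < 2 * s * (1 - meanState μ))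
    (he : s * (∫ w, meanState w ^ 2 ∂q) = s - μ 0) :
    ∀ w ∈ q.support, w 0 = s * (1 - meanState w ^ 2) ∧ w 0 ≤ s * (1 - |meanState w|) := by
  obtain ⟨x, hx, y, hy, l, r, hl, hr, hl0, hr0, hlA, hrB, -, -, hG, hGe⟩ :=
    exists_variance_bounds hq hs
  have n1 := mul_nonneg hl0 (sub_nonneg.2 hB.le)
  have n2 := mul_nonneg hr0 (sub_nonneg.2 hA.le)
  have n3 := mul_nonneg (mul_nonneg hl0 hr0) (sub_nonneg.2 hs1.le)
  have z1 : l * (2 * s * (1 - meanState μ) - (1 - meanState μ + μ 0)) = 0 := by nlinarith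
  have z2 : r * (2 * s * (1 + meanState μ) - (1 + meanState μ + μ 0)) = 0 := by nlinarith
  have l0 : l = 0 := by
    rcases mul_eq_zero.1 z1 with h | h
    · exact h
    · linarith
  have r0 : r = 0 := by
    rcases mul_eq_zero.1 z2 with h | h
    · exact h
    · linarith
  subst l0 r0
  have hxm : meanState x = -1 := by linarith
  have hym : meanState y = 1 := by linarith
  have hx0 : x 0 = 0 := by linarith [belief_nonneg x 0, neg_meanState_le x]
  have hy0 : y 0 = 0 := by linarith [belief_nonneg y 0, meanState_le y]
  intro w hw
  have h := hGe (by nlinarith) w hw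
  rw [hxm, hym] at h
  refine ⟨by linarith, ?_⟩
  have b1 := meanState_le w
  have b2 := neg_meanState_le w
  have b3 := belief_nonneg w 0
  have e1 := (abs_le.1 (hs w hw x hx)).2
  rw [hx0, hxm, abs_of_nonneg (by linarith)] at e1
  have e2 := (abs_le.1 (hs w hw y hy)).2
  rw [hy0, hym, abs_of_nonpos (by linarith)] at e2
  rcases abs_cases (meanState w) with ⟨h, -⟩ | ⟨h, -⟩ <;> rw [h] <;> linarith

/-- The weighted combination of the variance bounds that is tight at separating exaggeration. -/
lemma exaggerate_arith {A B z l r s V : ℝ} (hAB : B ≤ A) (hzB : z < B) (hz : 0 < z)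
    (hl : 0 ≤ l) (hr : 0 ≤ r) (hsB : 2 * s * B ≤ B + z) (hV : V ≤ (A - l) * (B - r))
    (hV' : 2 * s * V ≤ 2 * s * ((A - l) * (B - r)) + l * (B - r) + r * (A - l)
      - (2 - l - r) * z) :
    (B + z) * V + r * z * (A - B) + l * r * (B - z) ≤ (B + z) * (A * B) - 2 * z * B ∧
    ((B + z) * V = (B + z) * (A * B) - 2 * z * B → 2 * s * B < B + z →
      V = (A - l) * (B - r) ∧ (r = 0 ∨ l = 0 ∧ A = B)) := by
  have hB : 0 < B := by linarith
  -- The multipliers `B + z - 2sB` and `B` are those for which `s` drops out of the sum.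
  have m1 := mul_le_mul_of_nonneg_left hV (sub_nonneg.2 hsB)
  have m2 := mul_le_mul_of_nonneg_left hV' hB.le
  have key : (B + z) * V + r * z * (A - B) + l * r * (B - z) ≤ (B + z) * (A * B) - 2 * z * B := by
    nlinarith
  refine ⟨key, fun he hlt => ?_⟩
  have n1 : 0 ≤ r * z * (A - B) := by have := sub_nonneg.2 hAB; positivity
  have n2 : 0 ≤ l * r * (B - z) := by have := sub_nonneg.2 hzB.le; positivity
  have hVeq : V = (A - l) * (B - r) := by
    refine le_antisymm hV ?_
    by_contra hc
    push Not at hc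
    have m1' := mul_lt_mul_of_pos_left hc (sub_pos.2 hlt)
    nlinarith
  refine ⟨hVeq, ?_⟩
  have z1 : r * z * (A - B) = 0 := by linarith
  have z2 : l * r * (B - z) = 0 := by linarith
  rcases eq_or_ne r 0 with h | h
  · exact Or.inl h
  · right
    constructor
    · have := sub_pos.2 hzB
      rcases mul_eq_zero.1 z2 with h' | h'
      · exact (mul_eq_zero.1 h').resolve_right h
      · linarith
    · rcases mul_eq_zero.1 z1 with h' | h'
      · rcases mul_eq_zero.1 h' with h'' | h''
        · exact absurd h'' h
        · linarith
      · linarith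

/-! ### Reflection -/

lemma reflectBelief_apply (ν : Belief) (θ : State) : reflectBelief ν θ = ν (-θ) := by
  change (stdSimplex.map (fun θ : State => -θ) ν : State → ℝ) θ = _
  rw [stdSimplex.map_coe, FunOnFinite.linearMap_apply_apply]
  rw [Finset.sum_eq_single (-θ)]
  · rintro b hb hne
    simp only [Finset.mem_filter, Finset.mem_univ, true_and] at hb
    exact absurd (by rw [← hb, neg_neg]) hne
  · intro h
    simp at h

lemma reflectBelief_zero (ν : Belief) : reflectBelief ν 0 = ν 0 := by
  rw [reflectBelief_apply, neg_zero]

lemma meanState_reflectBelief (ν : Belief) : meanState (reflectBelief ν) = -meanState ν := by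
  rw [meanState_eq, meanState_eq, reflectBelief_apply, reflectBelief_apply, neg_neg]
  ring

lemma reflectBelief_reflectBelief (ν : Belief) : reflectBelief (reflectBelief ν) = ν :=
  belief_ext (by rw [meanState_reflectBelief, meanState_reflectBelief, neg_neg])
    (by rw [reflectBelief_zero, reflectBelief_zero])

lemma continuous_reflectBelief : Continuous reflectBelief := by
  refine Continuous.subtype_mk (f := fun ν : Belief => (reflectBelief ν).1) ?_ _
  refine continuous_pi fun θ => ?_
  exact (continuous_coord (-θ)).congr fun ν => (reflectBelief_apply ν θ).symm

lemma reflect_reflect (q : Measure Belief) : reflect (reflect q) = q := by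
  have hm := continuous_reflectBelief.measurable
  rw [reflect, reflect, Measure.map_map hm hm]
  conv_rhs => rw [← Measure.map_id (μ := q)]
  congr 1
  funext ν
  exact reflectBelief_reflectBelief ν

lemma integral_reflect (q : Measure Belief) {f : Belief → ℝ} (hf : Continuous f) :
    ∫ ν, f ν ∂(reflect q) = ∫ ν, f (reflectBelief ν) ∂q :=
  integral_map continuous_reflectBelief.measurable.aemeasurable hf.aestronglyMeasurable

lemma integral_sq_reflect (q : Measure Belief) :
    ∫ ν, meanState ν ^ 2 ∂(reflect q) = ∫ ν, meanState ν ^ 2 ∂q := by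
  rw [integral_reflect q (by fun_prop)]
  simp only [meanState_reflectBelief, neg_sq]

lemma reflect_mem_policies {μ : Belief} {q : Measure Belief} (hq : q ∈ policies μ) :
    reflect q ∈ policies (reflectBelief μ) := by
  have := hq.1
  refine ⟨Measure.isProbabilityMeasure_map continuous_reflectBelief.measurable.aemeasurable,
    fun θ => ?_⟩
  rw [integral_reflect q (continuous_coord θ)]
  simp only [reflectBelief_apply]
  exact hq.2 (-θ)

lemma mem_support_reflect {q : Measure Belief} {x : Belief} :
    x ∈ (reflect q).support ↔ reflectBelief x ∈ q.support := by
  have key : ∀ (q : Measure Belief) (x : Belief),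
      reflectBelief x ∈ q.support → x ∈ (reflect q).support := by
    intro q x hx
    rw [Measure.mem_support_iff_forall] at hx ⊢
    intro U hU
    rw [mem_nhds_iff] at hU
    obtain ⟨V, hVU, hV, hxV⟩ := hU
    refine lt_of_lt_of_le ?_ (measure_mono hVU)
    rw [reflect, Measure.map_apply continuous_reflectBelief.measurable hV.measurableSet]
    refine hx _ ((hV.preimage continuous_reflectBelief).mem_nhds ?_)
    rwa [Set.mem_preimage, reflectBelief_reflectBelief]
  refine ⟨fun h => ?_, key q x⟩
  rw [← reflect_reflect q]
  apply key
  rwa [reflectBelief_reflectBelief]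

lemma beliefDist_reflectBelief (x y : Belief) :
    beliefDist (reflectBelief x) (reflectBelief y) = beliefDist x y := by
  rw [← sq_eq_sq₀ (beliefDist_nonneg _ _) (beliefDist_nonneg _ _), beliefDist_sq, beliefDist_sq,
    meanState_reflectBelief, meanState_reflectBelief, reflectBelief_zero, reflectBelief_zero]
  ring

lemma Discernible.reflect {κ : ℝ} {q : Measure Belief} (h : Discernible κ q.support) :
    Discernible κ (reflect q).support := by
  intro x hx y hy
  have := h _ (mem_support_reflect.1 hx) _ (mem_support_reflect.1 hy)
  rw [beliefDist_reflectBelief, meanState_reflectBelief, meanState_reflectBelief] at this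
  linarith

lemma IsOptimalOutcome.reflect {μ : Belief} {κ : ℝ} {q : Measure Belief}
    (h : IsOptimalOutcome μ κ q) :
    IsOptimalOutcome (reflectBelief μ) κ (reflect q) := by
  rw [isOptimalOutcome_iff] at h ⊢
  refine ⟨⟨reflect_mem_policies h.1.1, h.1.2.reflect⟩, fun q' hq' hd => ?_⟩
  have := h.2 _ (by simpa [reflectBelief_reflectBelief] using reflect_mem_policies hq') hd.reflect
  rwa [integral_sq_reflect] at this ⊢

lemma slope_reflect {q : Measure Belief} {s : ℝ}
    (hs : ∀ x ∈ q.support, ∀ y ∈ q.support, |x 0 - y 0| ≤ s * |meanState x - meanState y|) :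
    ∀ x ∈ (reflect q).support, ∀ y ∈ (reflect q).support,
      |x 0 - y 0| ≤ s * |meanState x - meanState y| := by
  intro x hx y hy
  have h := hs _ (mem_support_reflect.1 hx) _ (mem_support_reflect.1 hy)
  rwa [reflectBelief_zero, reflectBelief_zero, meanState_reflectBelief, meanState_reflectBelief,
    neg_sub_neg, abs_sub_comm (meanState y)] at h

/-! ### Separating exaggeration -/

/-- Bound attained by separating exaggeration, for priors leaning to state `1`. -/
lemma exaggerate_bound_right {μ : Belief} (hμ : ∀ θ, 0 < μ θ) {q : Measure Belief} {s : ℝ}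
    (hq : q ∈ policies μ)
    (hs : ∀ x ∈ q.support, ∀ y ∈ q.support, |x 0 - y 0| ≤ s * |meanState x - meanState y|)
    (ha : 0 ≤ meanState μ) (hB : 2 * s * (1 - meanState μ) ≤ 1 - meanState μ + μ 0) :
    (1 - meanState μ + μ 0) * (∫ w, meanState w ^ 2 ∂q)
      ≤ (1 - meanState μ + μ 0) - 2 * μ 0 * (1 - meanState μ) := by
  obtain ⟨x, hx, y, hy, l, r, -, -, hl0, hr0, -, -, hV, -, hV', -⟩ := exists_variance_bounds hq hs
  have hzB : μ 0 < 1 - meanState μ := by have := hμ (-1); rw [belief_neg_eq] at this; linarith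
  have hAB : 1 - meanState μ ≤ 1 + meanState μ := by linarith
  have h := (exaggerate_arith hAB hzB (hμ 0) hl0 hr0 hB hV hV').1
  have n1 : 0 ≤ r * μ 0 * (1 + meanState μ - (1 - meanState μ)) := by
    have := sub_nonneg.2 hAB; have := hμ 0; positivity
  have n2 : 0 ≤ l * r * (1 - meanState μ - μ 0) := by
    have := sub_nonneg.2 hzB.le; positivity
  nlinarith

/-- The support consists of one belief that rules out state `1` and one that rules out `-1`. -/
structure EdgePair (q : Measure Belief) (x y : Belief) : Prop where
  support_eq : q.support = {x, y}
  left : x 0 = 1 + meanState x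
  right : y 0 = 1 - meanState y

lemma EdgePair.reflect {q : Measure Belief} {x y : Belief} (h : EdgePair q x y) :
    EdgePair (reflect q) (reflectBelief y) (reflectBelief x) := by
  refine ⟨?_, ?_, ?_⟩
  · ext w
    rw [mem_support_reflect, h.support_eq, Set.mem_insert_iff, Set.mem_insert_iff,
      Set.mem_singleton_iff, Set.mem_singleton_iff, or_comm]
    have key : ∀ v, reflectBelief w = v ↔ w = reflectBelief v := fun v =>
      ⟨fun e => by rw [← e, reflectBelief_reflectBelief],
        fun e => by rw [e, reflectBelief_reflectBelief]⟩
    rw [key, key]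
  · rw [reflectBelief_zero, meanState_reflectBelief, h.right]; ring
  · rw [reflectBelief_zero, meanState_reflectBelief, h.left]; ring

/-- By the first equality every action is extreme, and the slope bound admits only one belief per
action. The second equality, at the extremes, gives `x 0 = l` and `y 0 = r`, which are the two
edges. -/
lemma edgePair_of_tight {q : Measure Belief} {s l r : ℝ} {x y : Belief}
    (hs : ∀ x ∈ q.support, ∀ y ∈ q.support, |x 0 - y 0| ≤ s * |meanState x - meanState y|)
    (hx : x ∈ q.support) (hy : y ∈ q.support) (hl : l = 1 + meanState x) (hr : r = 1 - meanState y)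
    (hlr : 0 < 2 - l - r)
    (h1 : ∀ w ∈ q.support, (meanState w - meanState x) * (meanState y - meanState w) = 0)
    (h2 : ∀ w ∈ q.support, w 0 * (2 - l - r) = l * (meanState y - meanState w)
          + r * (meanState w - meanState x)
          + 2 * s * ((meanState w - meanState x) * (meanState y - meanState w))) :
    EdgePair q x y := by
  refine ⟨?_, ?_, ?_⟩
  · apply Set.Subset.antisymm
    · intro w hw
      have close : ∀ v ∈ q.support, meanState w = meanState v → w = v := by
        intro v hv h
        have := hs w hw v hv
        rw [h, sub_self, abs_zero, mul_zero] at this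
        exact belief_ext h (by linarith [abs_nonpos_iff.1 this])
      rcases mul_eq_zero.1 (h1 w hw) with h | h
      · exact Or.inl (close x hx (by linarith))
      · exact Or.inr (close y hy (by linarith))
    · rintro w (rfl | rfl)
      · exact hx
      · exact hy
  · have h := h2 x hx
    have : (x 0 - (1 + meanState x)) * (2 - l - r) = 0 := by subst hl hr; linarith
    rcases mul_eq_zero.1 this with h | h <;> linarith
  · have h := h2 y hy
    have : (y 0 - (1 - meanState y)) * (2 - l - r) = 0 := by subst hl hr; linarith
    rcases mul_eq_zero.1 this with h | h <;> linarith

/-- Equality in the combined bound makes the first variance bound tight and one of `l`, `r` zero.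
The value of the dispersion then determines the other distance, and with it the second bound is
tight too. -/
lemma exaggerate_bound_right_eq {μ : Belief} (hμ : ∀ θ, 0 < μ θ) {q : Measure Belief} {s : ℝ}
    (hq : q ∈ policies μ)
    (hs : ∀ x ∈ q.support, ∀ y ∈ q.support, |x 0 - y 0| ≤ s * |meanState x - meanState y|)
    (ha : 0 ≤ meanState μ) (hB : 2 * s * (1 - meanState μ) < 1 - meanState μ + μ 0)
    (he : (1 - meanState μ + μ 0) * (∫ w, meanState w ^ 2 ∂q)
      = (1 - meanState μ + μ 0) - 2 * μ 0 * (1 - meanState μ)) :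
    ∃ x y, EdgePair q x y ∧ (meanState x = -1 ∨ meanState y = 1) := by
  obtain ⟨x, hx, y, hy, l, r, hl, hr, hl0, hr0, hlA, hrB, hV, hVe, hV', hVe'⟩ :=
    exists_variance_bounds hq hs
  have hz := hμ 0
  have hzB : μ 0 < 1 - meanState μ := by have := hμ (-1); rw [belief_neg_eq] at this; linarith
  have hAB : 1 - meanState μ ≤ 1 + meanState μ := by linarith
  obtain ⟨hVeq, hcase⟩ := (exaggerate_arith hAB hzB (hμ 0) hl0 hr0 hB.le hV hV').2
    (by linear_combination he) hB
  have hT : 2 * s * ((∫ w, meanState w ^ 2 ∂q) - meanState μ ^ 2)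
      = 2 * s * ((1 + meanState μ - l) * (1 - meanState μ - r)) + l * (1 - meanState μ - r)
        + r * (1 + meanState μ - l) - (2 - l - r) * μ 0 := by
    rw [hVeq]
    rcases hcase with rfl | ⟨rfl, hAB'⟩
    · have hl' : l * (1 - meanState μ + μ 0) = 2 * μ 0 := by
        have hne : (1 - meanState μ) ≠ 0 := by linarith
        apply mul_left_cancel₀ hne
        have e := hVeq
        have : (1 - meanState μ + μ 0) * ((∫ w, meanState w ^ 2 ∂q) - meanState μ ^ 2)
          = (1 - meanState μ + μ 0) * ((1 + meanState μ - l) * (1 - meanState μ - 0)) := by rw [e]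
        linear_combination this - he
      linear_combination -hl'
    · have hB1 : meanState μ = 0 := by linarith
      rw [hB1] at he hVeq ⊢
      have hr' : r * (1 + μ 0) = 2 * μ 0 := by
        have : (1 + μ 0) * (∫ w, meanState w ^ 2 ∂q) = (1 + μ 0) * (1 - r) := by
          congr 1; linear_combination hVeq
        linear_combination this - he
      linear_combination -hr'
  have hlr : 0 < 2 - l - r := by
    rcases hcase with rfl | ⟨rfl, hAB'⟩
    · have : l ≠ 2 := by
        rintro rfl
        linarith
      have : l ≤ 2 := by linarith
      exact lt_of_le_of_ne (by linarith) fun h => by apply ‹l ≠ 2›; linarith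
    · linarith
  refine ⟨x, y, edgePair_of_tight hs hx hy hl hr hlr (hVe hVeq) (hVe' hT), ?_⟩
  rcases hcase with h | ⟨h, -⟩
  · right; linarith
  · left; linarith

/-! ### Priors leaning to state `-1`, by reflection -/

lemma exaggerate_bound_left {μ : Belief} (hμ : ∀ θ, 0 < μ θ) {q : Measure Belief} {s : ℝ}
    (hq : q ∈ policies μ)
    (hs : ∀ x ∈ q.support, ∀ y ∈ q.support, |x 0 - y 0| ≤ s * |meanState x - meanState y|)
    (ha : meanState μ ≤ 0) (hA : 2 * s * (1 + meanState μ) ≤ 1 + meanState μ + μ 0) :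
    (1 + meanState μ + μ 0) * (∫ w, meanState w ^ 2 ∂q)
      ≤ (1 + meanState μ + μ 0) - 2 * μ 0 * (1 + meanState μ) := by
  have h := exaggerate_bound_right (fun θ => by rw [reflectBelief_apply]; exact hμ _)
    (reflect_mem_policies hq) (slope_reflect hs) (by rw [meanState_reflectBelief]; linarith)
    (by rw [meanState_reflectBelief, reflectBelief_zero]; linarith)
  rw [integral_sq_reflect, meanState_reflectBelief, reflectBelief_zero] at h
  linarith

lemma exaggerate_bound_left_eq {μ : Belief} (hμ : ∀ θ, 0 < μ θ) {q : Measure Belief} {s : ℝ}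
    (hq : q ∈ policies μ)
    (hs : ∀ x ∈ q.support, ∀ y ∈ q.support, |x 0 - y 0| ≤ s * |meanState x - meanState y|)
    (ha : meanState μ ≤ 0) (hA : 2 * s * (1 + meanState μ) < 1 + meanState μ + μ 0)
    (he : (1 + meanState μ + μ 0) * (∫ w, meanState w ^ 2 ∂q)
      = (1 + meanState μ + μ 0) - 2 * μ 0 * (1 + meanState μ)) :
    ∃ x y, EdgePair q x y ∧ (meanState x = -1 ∨ meanState y = 1) := by
  obtain ⟨x, y, hxy, h⟩ := exaggerate_bound_right_eq
    (fun θ => by rw [reflectBelief_apply]; exact hμ _)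
    (reflect_mem_policies hq) (slope_reflect hs) (by rw [meanState_reflectBelief]; linarith)
    (by rw [meanState_reflectBelief, reflectBelief_zero]; linarith)
    (by rw [integral_sq_reflect, meanState_reflectBelief, reflectBelief_zero]
        linear_combination he)
  refine ⟨reflectBelief y, reflectBelief x, ?_, ?_⟩
  · have := hxy.reflect
    rwa [reflect_reflect] at this
  · rw [meanState_reflectBelief, meanState_reflectBelief]
    rcases h with h | h
    · right; linarith
    · left; linarith

/-! ### The bound attained by binding exaggeration -/

/-- The nonnegative pairwise slack has double integral zero, so it vanishes at every pair of the
support: `eq_zero_on_support` is applied once for each variable. -/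
lemma Discernible.variance_eq {κ : ℝ} {y : Belief} {ρ : Measure Belief}
    (h : Discernible κ ρ.support) (hρ : ρ ∈ policies y)
    (he : 3 * κ * ((∫ x, x 0 ^ 2 ∂ρ) - y 0 ^ 2)
      = (2 - κ) * ((∫ x, meanState x ^ 2 ∂ρ) - meanState y ^ 2)) :
    ∀ x ∈ ρ.support, ∀ w ∈ ρ.support,
      3 * κ * (w 0 - x 0) ^ 2 = (2 - κ) * (meanState w - meanState x) ^ 2 := by
  obtain ⟨hp, ha, hz⟩ := mem_policies_iff.1 hρ
  have iF : ∀ x : Belief, ∫ w : Belief, ((2 - κ) * (meanState w - meanState x) ^ 2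
      - 3 * κ * (w 0 - x 0) ^ 2) ∂ρ
      = (2 - κ) * ((∫ w, meanState w ^ 2 ∂ρ) - 2 * meanState x * meanState y + meanState x ^ 2)
        - 3 * κ * ((∫ w, w 0 ^ 2 ∂ρ) - 2 * x 0 * y 0 + x 0 ^ 2) := by
    intro x
    have h1 := integral_quadratic ρ (2 - κ) (-(3 * κ)) 0 (-(2 * (2 - κ) * meanState x))
      (6 * κ * x 0) ((2 - κ) * meanState x ^ 2 - 3 * κ * x 0 ^ 2)
    rw [ha, hz] at h1
    refine (integral_congr_ae (Filter.Eventually.of_forall fun w => ?_)).trans (h1.trans ?_)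
    · ring
    · ring
  have hF : ∀ x ∈ ρ.support, ∀ w ∈ ρ.support, 0 ≤ (2 - κ) * (meanState w - meanState x) ^ 2
      - 3 * κ * (w 0 - x 0) ^ 2 := fun x hx w hw => sub_nonneg.2 (h.two_mul hw hx)
  have hG : ∀ x ∈ ρ.support, 0 ≤ (2 - κ) * ((∫ w, meanState w ^ 2 ∂ρ)
      - 2 * meanState x * meanState y + meanState x ^ 2)
        - 3 * κ * ((∫ w, w 0 ^ 2 ∂ρ) - 2 * x 0 * y 0 + x 0 ^ 2) := by
    intro x hx
    rw [← iF x]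
    exact integral_nonneg_of_support (hF x hx)
  have iG : ∫ x : Belief, ((2 - κ) * ((∫ w, meanState w ^ 2 ∂ρ)
      - 2 * meanState x * meanState y + meanState x ^ 2)
        - 3 * κ * ((∫ w, w 0 ^ 2 ∂ρ) - 2 * x 0 * y 0 + x 0 ^ 2)) ∂ρ = 0 := by
    have h1 := integral_quadratic ρ (2 - κ) (-(3 * κ)) 0 (-(2 * (2 - κ) * meanState y))
      (6 * κ * y 0) ((2 - κ) * (∫ w, meanState w ^ 2 ∂ρ) - 3 * κ * ∫ w, w 0 ^ 2 ∂ρ)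
    rw [ha, hz] at h1
    refine (integral_congr_ae (Filter.Eventually.of_forall fun w => ?_)).trans (h1.trans ?_)
    · ring
    · linear_combination (-2) * he
  intro x hx w hw
  have h1 := eq_zero_on_support (by fun_prop) hG iG x hx
  have h2 := eq_zero_on_support (by fun_prop) (hF x hx) ((iF x).trans h1) w hw
  linarith

/-- The bound attained by binding exaggeration. -/
lemma binding_bound {μ : Belief} {κ : ℝ} {q : Measure Belief} (h0 : 0 < κ)
    (hq : q ∈ policies μ) (hd : Discernible κ q.support) :
    (4 * κ - 2) * ((∫ w, meanState w ^ 2 ∂q) - meanState μ ^ 2)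
      ≤ 3 * κ * ((1 - μ 0) ^ 2 - meanState μ ^ 2) ∧
    ((4 * κ - 2) * ((∫ w, meanState w ^ 2 ∂q) - meanState μ ^ 2)
      = 3 * κ * ((1 - μ 0) ^ 2 - meanState μ ^ 2) →
      (∀ x ∈ q.support, (1 - x 0) ^ 2 = meanState x ^ 2) ∧
      ∀ x ∈ q.support, ∀ w ∈ q.support,
        3 * κ * (w 0 - x 0) ^ 2 = (2 - κ) * (meanState w - meanState x) ^ 2) := by
  obtain ⟨hp, ha, hz⟩ := mem_policies_iff.1 hq
  have hv := hd.variance_le hq Measure.support_mem_ae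
  have i1 : ∫ w : Belief, ((1 - w 0) ^ 2 - meanState w ^ 2) ∂q
      = 1 - 2 * μ 0 + (∫ w, w 0 ^ 2 ∂q) - ∫ w, meanState w ^ 2 ∂q := by
    have h1 := integral_quadratic q (-1) 1 0 0 (-2) 1
    rw [ha, hz] at h1
    refine (integral_congr_ae (Filter.Eventually.of_forall fun w => ?_)).trans (h1.trans ?_)
    · ring
    · ring
  -- `|a| ≤ 1 - z` on the triangle. Adding `3κ` times the integral to the variance inequality
  -- eliminates the second moment of `z`.
  have hnn : ∀ w : Belief, 0 ≤ (1 - w 0) ^ 2 - meanState w ^ 2 := by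
    intro w
    have h1 := meanState_le w
    have h2 := neg_meanState_le w
    nlinarith
  have hn := integral_nonneg_of_support (q := q) fun w _ => hnn w
  rw [i1] at hn
  have hn' := mul_nonneg (by linarith : 0 ≤ 3 * κ) hn
  refine ⟨by linarith, fun he => ⟨?_, ?_⟩⟩
  · intro x hx
    have h1 : 3 * κ * (1 - 2 * μ 0 + (∫ w, w 0 ^ 2 ∂q) - ∫ w, meanState w ^ 2 ∂q) = 0 := by
      linarith
    have h2 := (mul_eq_zero.1 h1).resolve_left (by linarith)
    have := eq_zero_on_support (q := q) (by fun_prop) (fun w _ => hnn w) (i1.trans h2) x hx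
    linarith
  · exact hd.variance_eq hq (by linarith)

/-! ### Finitely supported policies -/

lemma restrict_finset_eq_sum (q : Measure Belief) (S : Finset Belief) :
    q.restrict (S : Set Belief) = ∑ y ∈ S, q {y} • Measure.dirac y := by
  classical
  induction S using Finset.induction_on with
  | empty => simp
  | insert y S hy ih =>
    rw [Finset.coe_insert, Set.insert_eq, Measure.restrict_union (by simpa using hy)
      S.measurableSet, ih, Measure.restrict_singleton, Finset.sum_insert hy]

lemma eq_sum_of_support_subset {q : Measure Belief} {S : Finset Belief}
    (h : q.support ⊆ (S : Set Belief)) : q = ∑ y ∈ S, q {y} • Measure.dirac y := by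
  rw [← restrict_finset_eq_sum, Measure.restrict_eq_self_of_ae_mem]
  filter_upwards [Measure.support_mem_ae (μ := q)] with x hx using h hx

lemma integral_eq_sum_of_support_subset {q : Measure Belief} [IsFiniteMeasure q]
    {S : Finset Belief} (h : q.support ⊆ (S : Set Belief)) {f : Belief → ℝ} (hf : Continuous f) :
    ∫ x, f x ∂q = ∑ y ∈ S, q.real {y} * f y := by
  conv_lhs => rw [eq_sum_of_support_subset h]
  rw [integral_finsetSum_measure]
  · refine Finset.sum_congr rfl fun y _ => ?_
    rw [integral_smul_measure, integral_dirac, smul_eq_mul, Measure.real]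
  · intro y _
    have : IsFiniteMeasure (q {y} • Measure.dirac y) := Measure.smul_finite _ (measure_ne_top _ _)
    exact integrable_of_continuous hf _

lemma integral_affine {μ : Belief} {q : Measure Belief} (hq : q ∈ policies μ) (α β γ : ℝ) :
    ∫ x : Belief, (α * meanState x + β * x 0 + γ) ∂q = α * meanState μ + β * μ 0 + γ := by
  obtain ⟨hp, ha, hz⟩ := mem_policies_iff.1 hq
  have h := integral_quadratic q 0 0 0 α β γ
  rw [ha, hz] at h
  refine (integral_congr_ae (Filter.Eventually.of_forall fun w => ?_)).trans (h.trans ?_)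
  · ring
  · ring

/-- The probability of an atom that an affine function separates from the other ones. -/
lemma atom_mul_eq {μ : Belief} {q : Measure Belief} (hq : q ∈ policies μ) {S : Finset Belief}
    (h : q.support ⊆ (S : Set Belief)) {y : Belief} (hy : y ∈ S) {α β γ : ℝ}
    (h0 : ∀ w ∈ S, w ≠ y → α * meanState w + β * w 0 + γ = 0) :
    q.real {y} * (α * meanState y + β * y 0 + γ) = α * meanState μ + β * μ 0 + γ := by
  have := hq.1
  rw [← integral_affine hq, integral_eq_sum_of_support_subset h (by fun_prop),
    Finset.sum_eq_single_of_mem y hy]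
  intro w hw hne
  rw [h0 w hw hne, mul_zero]

/-- A policy supported on affinely independent beliefs is determined by its mean. -/
lemma policy_ext {μ : Belief} {q q' : Measure Belief} (hq : q ∈ policies μ) (hq' : q' ∈ policies μ)
    {S : Finset Belief} (h : q.support ⊆ (S : Set Belief)) (h' : q'.support ⊆ (S : Set Belief))
    (hS : ∀ y ∈ S, ∃ α β γ : ℝ, α * meanState y + β * y 0 + γ ≠ 0 ∧
      ∀ w ∈ S, w ≠ y → α * meanState w + β * w 0 + γ = 0) : q = q' := by
  have := hq.1
  have := hq'.1
  rw [eq_sum_of_support_subset h, eq_sum_of_support_subset h']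
  refine Finset.sum_congr rfl fun y hy => ?_
  obtain ⟨α, β, γ, hne, h0⟩ := hS y hy
  have e := (atom_mul_eq hq h hy h0).trans (atom_mul_eq hq' h' hy h0).symm
  have e' := mul_right_cancel₀ hne e
  rw [Measure.real, Measure.real, ENNReal.toReal_eq_toReal_iff' (measure_ne_top _ _)
    (measure_ne_top _ _)] at e'
  rw [e']

/-- The policy that yields belief `x m` with probability `w m`. -/
def atomic (w : State → ℝ) (x : State → Belief) : Measure Belief :=
  ∑ m, ENNReal.ofReal (w m) • Measure.dirac (x m)

lemma integral_atomic {w : State → ℝ} (hw : ∀ m, 0 ≤ w m) (x : State → Belief) {f : Belief → ℝ}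
    (hf : Continuous f) : ∫ ν, f ν ∂(atomic w x) = ∑ m, w m * f (x m) := by
  rw [atomic, integral_finsetSum_measure]
  · refine Finset.sum_congr rfl fun m _ => ?_
    rw [integral_smul_measure, integral_dirac, smul_eq_mul, ENNReal.toReal_ofReal (hw m)]
  · intro m _
    have : IsFiniteMeasure (ENNReal.ofReal (w m) • Measure.dirac (x m)) :=
      Measure.smul_finite _ ENNReal.ofReal_ne_top
    exact integrable_of_continuous hf _

lemma atomic_mem_policies {μ : Belief} {w : State → ℝ} (hw : ∀ m, 0 ≤ w m) {x : State → Belief}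
    (h : ∀ θ, ∑ m, w m * x m θ = μ θ) : atomic w x ∈ policies μ := by
  refine ⟨⟨?_⟩, fun θ => ?_⟩
  · simp only [atomic, Measure.finsetSum_apply, Measure.smul_apply, measure_univ, smul_eq_mul,
      mul_one]
    rw [← ENNReal.ofReal_sum_of_nonneg fun m _ => hw m, ← ENNReal.ofReal_one]
    congr 1
    -- That the weights sum to one need not be assumed: it follows by summing the mean condition
    -- over the states.
    calc ∑ m, w m = ∑ m, ∑ θ, w m * x m θ := by
          refine Finset.sum_congr rfl fun m _ => ?_
          rw [← Finset.mul_sum, stdSimplex.sum_eq_one, mul_one]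
      _ = ∑ θ, μ θ := by rw [Finset.sum_comm]; exact Finset.sum_congr rfl fun θ _ => h θ
      _ = 1 := stdSimplex.sum_eq_one μ
  · rw [integral_atomic hw x (continuous_coord θ)]
    exact h θ

lemma atomic_apply (w : State → ℝ) (x : State → Belief) {s : Set Belief} (hs : MeasurableSet s) :
    atomic w x s = ∑ m, ENNReal.ofReal (w m) * s.indicator 1 (x m) := by
  simp only [atomic, Measure.finsetSum_apply, Measure.smul_apply, smul_eq_mul,
    Measure.dirac_apply' _ hs]

/-- The set is finite, hence closed, and carries the measure; conversely, each positive weight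
charges all neighbourhoods of its belief. Messages of weight zero have to be left out. -/
lemma support_atomic (w : State → ℝ) (x : State → Belief) :
    (atomic w x).support = {y | ∃ m, 0 < w m ∧ x m = y} := by
  apply Set.Subset.antisymm
  · refine Measure.support_subset_of_isClosed ?_ ?_
    · refine Set.Finite.isClosed (Set.Finite.subset (Set.finite_range x) ?_)
      rintro _ ⟨m, -, rfl⟩
      exact ⟨m, rfl⟩
    · have hfin : Set.Finite {y | ∃ m, 0 < w m ∧ x m = y} := by
        refine Set.Finite.subset (Set.finite_range x) ?_
        rintro _ ⟨m, -, rfl⟩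
        exact ⟨m, rfl⟩
      rw [mem_ae_iff, atomic_apply w x hfin.measurableSet.compl]
      refine Finset.sum_eq_zero fun m _ => ?_
      by_cases hm : 0 < w m
      · rw [Set.indicator_of_notMem, mul_zero]
        exact fun h => h ⟨m, hm, rfl⟩
      · rw [ENNReal.ofReal_of_nonpos (not_lt.1 hm), zero_mul]
  · rintro _ ⟨m, hm, rfl⟩
    rw [Measure.mem_support_iff_forall]
    intro U hU
    rw [mem_nhds_iff] at hU
    obtain ⟨V, hVU, hV, hxV⟩ := hU
    refine lt_of_lt_of_le ?_ (measure_mono hVU)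
    rw [atomic_apply w x hV.measurableSet]
    refine lt_of_lt_of_le ?_ (Finset.single_le_sum (fun _ _ => zero_le) (Finset.mem_univ m))
    rw [Set.indicator_of_mem hxV]
    simpa using hm

/-! ### Signals -/

lemma point_apply (m θ : State) : point m θ = if θ = m then 1 else 0 := by
  change (Pi.single m (1 : ℝ) : State → ℝ) θ = _
  rw [Pi.single_apply]

lemma lottery_apply (t : unitInterval) (m m' θ : State) :
    lottery t m m' θ = t * (if θ = m then 1 else 0) + (1 - t) * (if θ = m' then 1 else 0) := by
  rw [← point_apply, ← point_apply]
  rfl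

lemma induced_eq_atomic (μ : Belief) (σ : State → Belief) :
    induced μ σ = atomic (msgProb μ σ) (posterior μ σ) := rfl

lemma msgProb_nonneg (μ : Belief) (σ : State → Belief) (m : State) : 0 ≤ msgProb μ σ m :=
  Finset.sum_nonneg fun θ _ => mul_nonneg (belief_nonneg μ θ) (belief_nonneg (σ θ) m)

lemma msgProb_eq (μ : Belief) (σ : State → Belief) (m : State) :
    msgProb μ σ m = μ 0 * σ 0 m + μ (-1) * σ (-1) m + μ 1 * σ 1 m := sum_state _

lemma posterior_apply {μ : Belief} {σ : State → Belief} {m : State} (h : msgProb μ σ m ≠ 0)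
    (θ : State) : posterior μ σ m θ = μ θ * σ θ m / msgProb μ σ m := by
  rw [posterior, dif_neg h]
  rfl

/-- Bayes' rule without division. It also covers messages of probability zero, for which every term
of the sum vanishes. -/
lemma msgProb_mul_posterior (μ : Belief) (σ : State → Belief) (m θ : State) :
    msgProb μ σ m * posterior μ σ m θ = μ θ * σ θ m := by
  by_cases h : msgProb μ σ m = 0
  · rw [h, zero_mul]
    have := (Finset.sum_eq_zero_iff_of_nonneg fun θ _ =>
      mul_nonneg (belief_nonneg μ θ) (belief_nonneg (σ θ) m)).1 h θ (Finset.mem_univ θ)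
    exact this.symm
  · rw [posterior_apply h, mul_div_cancel₀ _ h]

lemma induced_mem_policies (μ : Belief) (σ : State → Belief) : induced μ σ ∈ policies μ := by
  refine atomic_mem_policies (msgProb_nonneg μ σ) fun θ => ?_
  simp only [msgProb_mul_posterior]
  rw [← Finset.mul_sum, stdSimplex.sum_eq_one, mul_one]

lemma support_induced (μ : Belief) (σ : State → Belief) :
    (induced μ σ).support = {y | ∃ m, 0 < msgProb μ σ m ∧ posterior μ σ m = y} :=
  support_atomic _ _

lemma meanState_posterior {μ : Belief} {σ : State → Belief} {m : State} (h : msgProb μ σ m ≠ 0) :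
    meanState (posterior μ σ m) = (μ 1 * σ 1 m - μ (-1) * σ (-1) m) / msgProb μ σ m := by
  rw [meanState_eq, posterior_apply h, posterior_apply h, sub_div]

lemma integral_sq_induced (μ : Belief) (σ : State → Belief) :
    ∫ ν, meanState ν ^ 2 ∂(induced μ σ)
      = ∑ m, (μ 1 * σ 1 m - μ (-1) * σ (-1) m) ^ 2 / msgProb μ σ m := by
  rw [induced_eq_atomic, integral_atomic (msgProb_nonneg μ σ) _ (by fun_prop)]
  refine Finset.sum_congr rfl fun m _ => ?_
  by_cases h : msgProb μ σ m = 0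
  -- An unsent message contributes nothing on either side, since division by zero gives zero.
  · rw [h, zero_mul, div_zero]
  · rw [meanState_posterior h]
    field_simp

/-- The signal that induces a given policy with at most one belief for each message. -/
lemma atomic_eq_induced {μ : Belief} {w : State → ℝ} {x : State → Belief} (σ : State → Belief)
    (hσ : ∀ θ m, μ θ * σ θ m = w m * x m θ) : atomic w x = induced μ σ := by
  have hm : ∀ m, msgProb μ σ m = w m := by
    intro m
    simp only [msgProb, hσ]
    rw [← Finset.mul_sum, stdSimplex.sum_eq_one, mul_one]
  rw [induced_eq_atomic, atomic, atomic]
  refine Finset.sum_congr rfl fun m _ => ?_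
  by_cases h0 : w m = 0
  · rw [hm, h0, ENNReal.ofReal_zero, zero_smul, zero_smul]
  · rw [hm]
    congr 2
    apply stdSimplex.ext
    funext θ
    change x m θ = posterior μ σ m θ
    rw [posterior_apply (by rw [hm]; exact h0), hm, hσ, mul_div_cancel_left₀ _ h0]

/-- `w / m` as a probability. -/
def ratio (w m : ℝ) (hw : 0 ≤ w) (hm : 0 < m) (h : w ≤ m) : unitInterval :=
  ⟨w / m, div_nonneg hw hm.le, (div_le_one hm).2 h⟩

lemma mul_ratio {w m : ℝ} (hw : 0 ≤ w) (hm : 0 < m) (h : w ≤ m) :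
    m * (ratio w m hw hm h : ℝ) = w := by
  change m * (w / m) = w
  field_simp

lemma mean_atomic_of_policy {μ : Belief} {w : State → ℝ} (hw : ∀ m, 0 ≤ w m) {x : State → Belief}
    (h : atomic w x ∈ policies μ) (θ : State) : ∑ m, w m * x m θ = μ θ := by
  rw [← integral_atomic hw x (continuous_coord θ)]
  exact h.2 θ

/-- Policies that only pool into message `0` are downplaying policies. -/
lemma atomic_eq_downplay {μ : Belief} (hμ : ∀ θ, 0 < μ θ) {w : State → ℝ} (hw : ∀ m, 0 ≤ w m)
    {x : State → Belief} (h : atomic w x ∈ policies μ) (hm : x (-1) = point (-1))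
    (hp : x 1 = point 1) : ∃ πm πp, atomic w x = downplay μ πm πp := by
  have hmean := mean_atomic_of_policy hw h
  have e0 := hmean 0
  have em := hmean (-1)
  have ep := hmean 1
  rw [sum_state, hm, hp] at e0 em ep
  simp [point_apply] at e0 em ep
  have n0 := mul_nonneg (hw 0) (belief_nonneg (x 0) (-1))
  have n1 := mul_nonneg (hw 0) (belief_nonneg (x 0) 1)
  have rm := mul_ratio n0 (hμ (-1)) (by have := hw (-1); linarith)
  have rp := mul_ratio n1 (hμ 1) (by have := hw 1; linarith)
  refine ⟨ratio _ _ n0 (hμ (-1)) (by have := hw (-1); linarith),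
    ratio _ _ n1 (hμ 1) (by have := hw 1; linarith), atomic_eq_induced _ ?_⟩
  rintro (_ | _ | _) m <;> rcases SignType.trichotomy m with rfl | rfl | rfl <;>
    simp [point_apply, lottery_apply, hm, hp] <;> linarith

/-- Policies with one belief that rules out state `1` and one that rules out `-1` are
exaggerations. -/
lemma atomic_eq_exaggerate {μ : Belief} (hμ : ∀ θ, 0 < μ θ) {w : State → ℝ} (hw : ∀ m, 0 ≤ w m)
    {x : State → Belief} (h : atomic w x ∈ policies μ) (hw0 : w 0 = 0) (hm : x (-1) 1 = 0)
    (hp : x 1 (-1) = 0) : ∃ π : unitInterval, atomic w x = exaggerate μ π ∧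
      μ 0 * π = w (-1) * x (-1) 0 := by
  have hmean := mean_atomic_of_policy hw h
  have e0 := hmean 0
  have em := hmean (-1)
  have ep := hmean 1
  rw [sum_state, hw0] at e0 em ep
  rw [hp] at em
  rw [hm] at ep
  have n0 := mul_nonneg (hw (-1)) (belief_nonneg (x (-1)) 0)
  have n1 := mul_nonneg (hw 1) (belief_nonneg (x 1) 0)
  have r := mul_ratio n0 (hμ 0) (by linarith)
  refine ⟨ratio _ _ n0 (hμ 0) (by linarith), atomic_eq_induced _ ?_, r⟩
  rintro (_ | _ | _) m <;> rcases SignType.trichotomy m with rfl | rfl | rfl <;>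
    simp [point_apply, lottery_apply, hw0, hm, hp] <;> linarith

/-! ### Reflected signals -/

/-- Negating states and messages together carries the signal to its mirror image; the sum over
messages is reindexed by negation. -/
lemma reflect_induced (μ : Belief) (σ τ : State → Belief) (h : ∀ θ m, τ θ m = σ (-θ) (-m)) :
    reflect (induced μ σ) = induced (reflectBelief μ) τ := by
  have h1 : reflect (induced μ σ) = atomic (fun m => msgProb μ σ (-m))
      (fun m => reflectBelief (posterior μ σ (-m))) := by
    ext s hs
    have hm := continuous_reflectBelief.measurable
    rw [reflect, Measure.map_apply hm hs, induced_eq_atomic, atomic_apply _ _ (hm hs),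
      atomic_apply _ _ hs, ← Equiv.sum_comp (Equiv.neg State)]
    rfl
  rw [h1]
  refine atomic_eq_induced _ fun θ m => ?_
  rw [reflectBelief_apply, reflectBelief_apply, msgProb_mul_posterior, h]

lemma reflect_exaggerate (μ : Belief) (π : unitInterval) :
    reflect (exaggerate μ π) = exaggerate (reflectBelief μ) (unitInterval.symm π) := by
  refine reflect_induced _ _ _ ?_
  rintro (_ | _ | _) m <;> rcases SignType.trichotomy m with rfl | rfl | rfl <;>
    simp [point_apply, lottery_apply]

lemma reflect_mixedPolicy (μ : Belief) (e : State) (ρ πm πp : unitInterval) :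
    reflect (mixedPolicy μ e ρ πm πp) = mixedPolicy (reflectBelief μ) (-e) ρ πp πm := by
  refine reflect_induced _ _ _ ?_
  rintro (_ | _ | _) m <;> rcases SignType.trichotomy m with rfl | rfl | rfl <;>
    rcases SignType.trichotomy e with rfl | rfl | rfl <;>
    simp [lottery_apply]

/-! ### Thresholds -/

/-- The map `T ↦ 2 / (3T² + 1)` inverts `critSlope`. As `kappa1`, `kappa2`, `kappa3` and `kappaTwo`
all have this form, cost regimes become comparisons of the critical slope with a number `T`. -/
lemma le_threshold_iff {κ T : ℝ} (h0 : 0 < κ) (hT : 0 < T) :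
    κ ≤ 2 / (3 * T ^ 2 + 1) ↔ T ≤ critSlope κ := by
  rw [critSlope, Real.le_sqrt' hT, le_div_iff₀ (by positivity), le_div_iff₀ (by positivity)]
  constructor <;> intro h <;> linarith

lemma lt_threshold_iff {κ T : ℝ} (h0 : 0 < κ) (hT : 0 < T) :
    κ < 2 / (3 * T ^ 2 + 1) ↔ T < critSlope κ := by
  rw [critSlope, Real.lt_sqrt hT.le, lt_div_iff₀ (by positivity), lt_div_iff₀ (by positivity)]
  constructor <;> intro h <;> linarith

lemma threshold_lt {T T' : ℝ} (hT : 0 < T) (h : T < T') :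
    2 / (3 * T' ^ 2 + 1) < 2 / (3 * T ^ 2 + 1) := by
  gcongr

lemma kappa1_eq : kappa1 = 2 / (3 * (1 : ℝ) ^ 2 + 1) := by norm_num [kappa1]

lemma kappa2_eq (μ : Belief) : kappa2 μ =
    2 / (3 * ((1 - |meanState μ| + μ 0) / (2 * (1 - |meanState μ|))) ^ 2 + 1) := by
  rw [kappa2]
  rw [mul_comm 2 (1 - |meanState μ|), ← div_div]
  congr 2
  ring

/-! ### Binding order-IC -/

lemma binds_iff {κ : ℝ} (h0 : 0 < κ) (x y : Belief) :
    |meanState x - meanState y| = Real.sqrt κ * beliefDist x y ↔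
      3 * κ * (x 0 - y 0) ^ 2 = (2 - κ) * (meanState x - meanState y) ^ 2 := by
  rw [← sq_eq_sq₀ (abs_nonneg _) (mul_nonneg (Real.sqrt_nonneg _) (beliefDist_nonneg _ _)),
    sq_abs, mul_pow, Real.sq_sqrt h0.le, beliefDist_sq]
  constructor <;> intro h <;> linarith

lemma OrderICBinds.exists_ne {κ : ℝ} {p : Measure Belief} (h : OrderICBinds κ p) :
    ∃ x ∈ p.support, ∃ y ∈ p.support, x ≠ y := by
  obtain ⟨N, ν, hN, hinj, hr, -⟩ := h
  refine ⟨ν 0, hr ▸ ⟨0, rfl⟩, ν (Fin.last N), hr ▸ ⟨_, rfl⟩, fun he => ?_⟩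
  have := congrArg Fin.val (hinj he)
  simp at this
  omega

/-- Order-IC binds between neighbours. -/
lemma OrderICBinds.binds {κ : ℝ} {p : Measure Belief} (h0 : 0 < κ) (h : OrderICBinds κ p)
    {x y : Belief} (hx : x ∈ p.support) (hy : y ∈ p.support) (hxy : meanState x < meanState y)
    (hgap : ∀ w ∈ p.support, w = x ∨ w = y ∨ meanState w < meanState x ∨
      meanState y < meanState w) :
    3 * κ * (x 0 - y 0) ^ 2 = (2 - κ) * (meanState x - meanState y) ^ 2 := by
  obtain ⟨N, ν, hN, hinj, hr, hmono, hb⟩ := h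
  rw [← hr] at hx hy
  obtain ⟨i, rfl⟩ := hx
  obtain ⟨j, rfl⟩ := hy
  have hij : i < j := by
    by_contra hc
    exact absurd (hmono (not_lt.1 hc)) (not_le.2 hxy)
  obtain ⟨k, rfl⟩ : ∃ k : Fin N, i = k.castSucc :=
    ⟨i.castLT (by have := j.2; have : i.val < j.val := hij; omega), rfl⟩
  have hkj : k.succ ≤ j := hij
  have h1 := hmono (Fin.castSucc_lt_succ (i := k)).le
  have h2 := hmono hkj
  -- The belief listed right after `x` has an action between those of `x` and `y`, so the gap
  -- hypothesis identifies it with `y`.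
  have hj : k.succ = j := by
    rcases hgap (ν k.succ) (hr ▸ ⟨_, rfl⟩) with h | h | h | h
    · exact absurd (hinj h) (Fin.castSucc_lt_succ (i := k)).ne'
    · exact hinj h
    · exact absurd h1 (not_le.2 h)
    · exact absurd h2 (not_le.2 h)
  have := (binds_iff h0 _ _).1 (hb k)
  rw [hj] at this
  linarith

lemma orderICBinds_pair {κ : ℝ} (h0 : 0 < κ) {p : Measure Belief} {x y : Belief}
    (hs : p.support = {x, y}) (hxy : meanState x < meanState y)
    (hb : 3 * κ * (x 0 - y 0) ^ 2 = (2 - κ) * (meanState x - meanState y) ^ 2) :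
    OrderICBinds κ p := by
  have hne : x ≠ y := fun h => by rw [h] at hxy; exact lt_irrefl _ hxy
  refine ⟨1, ![x, y], le_rfl, ?_, ?_, ?_, ?_⟩
  · intro i j hij
    fin_cases i <;> fin_cases j <;> simp_all
  · rw [hs]
    simp [Matrix.range_cons, Set.pair_comm]
  · intro i j hij
    fin_cases i <;> fin_cases j <;> simp_all [hxy.le]
  · intro n
    fin_cases n
    exact (binds_iff h0 y x).2 (by linarith)

lemma orderICBinds_triple {κ : ℝ} (h0 : 0 < κ) {p : Measure Belief} {x y z : Belief}
    (hs : p.support = {x, y, z}) (hxy : meanState x < meanState y) (hyz : meanState y < meanState z)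
    (hb : 3 * κ * (x 0 - y 0) ^ 2 = (2 - κ) * (meanState x - meanState y) ^ 2)
    (hb' : 3 * κ * (y 0 - z 0) ^ 2 = (2 - κ) * (meanState y - meanState z) ^ 2) :
    OrderICBinds κ p := by
  have hstr : StrictMono fun n : Fin 3 => meanState ((![x, y, z] : Fin 3 → Belief) n) := by
    rw [Fin.strictMono_iff_lt_succ]
    intro i
    fin_cases i
    · exact hxy
    · exact hyz
  refine ⟨2, ![x, y, z], by norm_num, ?_, ?_, hstr.monotone, ?_⟩
  · intro i j hij
    exact hstr.injective (congrArg meanState hij)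
  · rw [hs]
    ext w
    simp only [Set.mem_range, Fin.exists_fin_succ, Set.mem_insert_iff, Set.mem_singleton_iff]
    simp [eq_comm]
  · intro n
    fin_cases n
    · exact (binds_iff h0 y x).2 (by linarith)
    · exact (binds_iff h0 z y).2 (by linarith)

/-! ### Downplaying -/

/-- Only extreme states and one belief with mean state `0` and probability `s` of state `0` are
induced. -/
def Peaked (s : ℝ) (q : Measure Belief) : Prop :=
  ∀ w ∈ q.support, (meanState w = -1 ∨ meanState w = 0 ∨ meanState w = 1) ∧
    w 0 = s * (1 - meanState w ^ 2)

lemma meanState_point (m : State) : meanState (point m) = m := by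
  rw [meanState_eq, point_apply, point_apply]
  rcases SignType.trichotomy m with rfl | rfl | rfl <;> simp

lemma point_zero_of_ne {m : State} (h : m ≠ 0) : point m 0 = 0 := by
  rw [point_apply, if_neg h.symm]

/-- On the support `s a² = s - z`, so the mean of `z` alone determines the dispersion; the weights
are not needed. -/
lemma Peaked.integral_sq {μ : Belief} {s : ℝ} {q : Measure Belief} (h : Peaked s q)
    (hq : q ∈ policies μ) : s * ∫ w, meanState w ^ 2 ∂q = s - μ 0 := by
  obtain ⟨hp, ha, hz⟩ := mem_policies_iff.1 hq
  have h1 := integral_quadratic q s 0 0 0 1 (-s)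
  rw [ha, hz] at h1
  have h2 : ∫ w : Belief, (s * meanState w ^ 2 + 0 * w 0 ^ 2 + 0 * (meanState w * w 0)
      + 0 * meanState w + 1 * w 0 + (-s)) ∂q = 0 := by
    apply integral_eq_zero_of_ae
    filter_upwards [Measure.support_mem_ae (μ := q)] with w hw
    have := (h w hw).2
    simp only [Pi.zero_apply]
    linarith
  linarith

lemma Peaked.slope {s : ℝ} (hs : 0 ≤ s) {q : Measure Belief} (h : Peaked s q) :
    ∀ x ∈ q.support, ∀ y ∈ q.support, |x 0 - y 0| ≤ s * |meanState x - meanState y| := by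
  intro x hx y hy
  obtain ⟨hxa, hxz⟩ := h x hx
  obtain ⟨hya, hyz⟩ := h y hy
  rw [hxz, hyz]
  rcases hxa with e | e | e <;> rcases hya with e' | e' | e' <;> rw [e, e'] <;>
    norm_num [abs_of_nonneg hs]
  all_goals exact hs

/-- The belief with mean state `0` and probability `s` of state `0`. -/
def peak (s : ℝ) (h0 : 0 ≤ s) (h1 : s ≤ 1) : Belief :=
  ofCoords 0 s h0 (by linarith) (by linarith)

lemma meanState_peak {s : ℝ} (h0 : 0 ≤ s) (h1 : s ≤ 1) : meanState (peak s h0 h1) = 0 :=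
  meanState_ofCoords _ _ _

lemma peak_zero {s : ℝ} (h0 : 0 ≤ s) (h1 : s ≤ 1) : peak s h0 h1 0 = s := rfl

lemma Peaked.support_subset {s : ℝ} (h0 : 0 ≤ s) (h1 : s ≤ 1) {q : Measure Belief}
    (h : Peaked s q) :
    q.support ⊆ (({point (-1), peak s h0 h1, point 1} : Finset Belief) : Set Belief) := by
  intro w hw
  obtain ⟨ha, hz⟩ := h w hw
  simp only [Finset.coe_insert, Finset.coe_singleton, Set.mem_insert_iff, Set.mem_singleton_iff]
  rcases ha with e | e | e
  · refine Or.inl (belief_ext ?_ ?_)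
    · rw [e, meanState_point]; simp
    · rw [hz, e, point_zero_of_ne (by decide)]; ring
  · refine Or.inr (Or.inl (belief_ext ?_ ?_))
    · rw [e, meanState_peak]
    · rw [hz, e, peak_zero]; ring
  · refine Or.inr (Or.inr (belief_ext ?_ ?_))
    · rw [e, meanState_point]; simp
    · rw [hz, e, point_zero_of_ne (by decide)]; ring

/-- For each of the three beliefs, an affine function that vanishes at the other two: the affine
independence required by `policy_ext`. -/
lemma peaked_separation {s : ℝ} (h0 : 0 < s) (h1 : s ≤ 1) :
    (∀ w ∈ ({point (-1), peak s h0.le h1, point 1} : Finset Belief), w ≠ point (-1) →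
      (-s) * meanState w + (-1) * w 0 + s = 0) ∧
    (∀ w ∈ ({point (-1), peak s h0.le h1, point 1} : Finset Belief), w ≠ peak s h0.le h1 →
      0 * meanState w + 1 * w 0 + 0 = 0) ∧
    (∀ w ∈ ({point (-1), peak s h0.le h1, point 1} : Finset Belief), w ≠ point 1 →
      s * meanState w + (-1) * w 0 + s = 0) := by
  have em : meanState (point (-1)) = -1 := by rw [meanState_point]; simp
  have ep : meanState (point 1) = 1 := by rw [meanState_point]; simp
  have zm : point (-1) 0 = 0 := point_zero_of_ne (by decide)
  have zp : point 1 0 = 0 := point_zero_of_ne (by decide)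
  have e0 := meanState_peak h0.le h1
  have z0 := peak_zero h0.le h1
  refine ⟨?_, ?_, ?_⟩ <;> intro w hw hne <;>
    simp only [Finset.mem_insert, Finset.mem_singleton] at hw <;>
    rcases hw with rfl | rfl | rfl <;> first
      | exact absurd rfl hne
      | (rw [em, zm]; ring)
      | (rw [ep, zp]; ring)
      | (rw [e0, z0]; ring)

lemma Peaked.eq {μ : Belief} {s : ℝ} (h0 : 0 < s) (h1 : s ≤ 1) {q q' : Measure Belief}
    (h : Peaked s q) (hq : q ∈ policies μ) (h' : Peaked s q') (hq' : q' ∈ policies μ) :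
    q = q' := by
  obtain ⟨c1, c2, c3⟩ := peaked_separation h0 h1
  refine policy_ext hq hq' (h.support_subset h0.le h1) (h'.support_subset h0.le h1) ?_
  intro y hy
  simp only [Finset.mem_insert, Finset.mem_singleton] at hy
  rcases hy with rfl | rfl | rfl
  · refine ⟨_, _, _, ?_, c1⟩
    rw [meanState_point, point_zero_of_ne (by decide)]
    simpa using h0.ne'
  · refine ⟨_, _, _, ?_, c2⟩
    rw [meanState_peak, peak_zero]
    simpa using h0.ne'
  · refine ⟨_, _, _, ?_, c3⟩
    rw [meanState_point, point_zero_of_ne (by decide)]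
    simpa using h0.ne'

/-- The probabilities of the three posteriors of a binding downplaying policy. -/
def peakedWeight (μ : Belief) (s : ℝ) : State → ℝ
  | .zero => μ 0 / s
  | .neg => (1 - meanState μ - μ 0 / s) / 2
  | .pos => (1 + meanState μ - μ 0 / s) / 2

/-- The posteriors of a binding downplaying policy. -/
def peakedBelief (s : ℝ) (h0 : 0 ≤ s) (h1 : s ≤ 1) : State → Belief
  | .zero => peak s h0 h1
  | .neg => point (-1)
  | .pos => point 1

lemma peakedWeight_pos {μ : Belief} (hμ : ∀ θ, 0 < μ θ) {s : ℝ} (h0 : 0 < s)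
    (hA : μ 0 < s * (1 + meanState μ)) (hB : μ 0 < s * (1 - meanState μ)) (m : State) :
    0 < peakedWeight μ s m := by
  have h1 : μ 0 / s < 1 + meanState μ := by rw [div_lt_iff₀ h0]; linarith
  have h2 : μ 0 / s < 1 - meanState μ := by rw [div_lt_iff₀ h0]; linarith
  have h3 : 0 < μ 0 / s := div_pos (hμ 0) h0
  cases m <;> simp only [peakedWeight] <;> linarith

lemma peaked_atomic_mem_policies {μ : Belief} (hμ : ∀ θ, 0 < μ θ) {s : ℝ} (h0 : 0 < s) (h1 : s ≤ 1)
    (hA : μ 0 < s * (1 + meanState μ)) (hB : μ 0 < s * (1 - meanState μ)) :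
    atomic (peakedWeight μ s) (peakedBelief s h0.le h1) ∈ policies μ := by
  refine atomic_mem_policies (fun m => (peakedWeight_pos hμ h0 hA hB m).le) fun θ => ?_
  rw [sum_state]
  change μ 0 / s * peak s h0.le h1 θ + (1 - meanState μ - μ 0 / s) / 2 * point (-1) θ
    + (1 + meanState μ - μ 0 / s) / 2 * point 1 θ = μ θ
  rcases SignType.trichotomy θ with rfl | rfl | rfl
  · rw [belief_neg_eq μ, belief_neg_eq (peak s h0.le h1), meanState_peak, peak_zero]
    simp [point_apply]
    field_simp
    ring
  · rw [peak_zero]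
    simp [point_apply, h0.ne']
  · rw [belief_pos_eq μ, belief_pos_eq (peak s h0.le h1), meanState_peak, peak_zero]
    simp [point_apply]
    field_simp
    ring

lemma peaked_atomic {μ : Belief} {s : ℝ} (h0 : 0 ≤ s) (h1 : s ≤ 1) :
    Peaked s (atomic (peakedWeight μ s) (peakedBelief s h0 h1)) := by
  intro w hw
  rw [support_atomic] at hw
  obtain ⟨m, -, rfl⟩ := hw
  cases m
  · change (meanState (peak s h0 h1) = -1 ∨ _) ∧ peak s h0 h1 0
      = s * (1 - meanState (peak s h0 h1) ^ 2)
    refine ⟨Or.inr (Or.inl (meanState_peak h0 h1)), ?_⟩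
    rw [meanState_peak, peak_zero]; ring
  · change (meanState (point (-1)) = -1 ∨ _) ∧ point (-1) 0
      = s * (1 - meanState (point (-1)) ^ 2)
    rw [meanState_point, point_zero_of_ne (by decide)]
    simp
  · change (meanState (point 1) = -1 ∨ _ ∨ meanState (point 1) = 1) ∧ point 1 0
      = s * (1 - meanState (point 1) ^ 2)
    rw [meanState_point, point_zero_of_ne (by decide)]
    simp

/-- A policy of the downplaying shape is a downplaying policy that makes order-IC bind. -/
lemma Peaked.eq_downplay {μ : Belief} (hμ : ∀ θ, 0 < μ θ) {κ : ℝ} (hκ : 0 < κ) (hκ2 : κ ≤ 2)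
    (h0 : 0 < critSlope κ) (h1 : critSlope κ ≤ 1) (hA : μ 0 < critSlope κ * (1 + meanState μ))
    (hB : μ 0 < critSlope κ * (1 - meanState μ)) {q : Measure Belief} (h : Peaked (critSlope κ) q)
    (hq : q ∈ policies μ) : (∃ πm πp, q = downplay μ πm πp) ∧ OrderICBinds κ q := by
  have hpol := peaked_atomic_mem_policies hμ h0 h1 hA hB
  have hpos := peakedWeight_pos hμ h0 hA hB
  have hss := critSlope_sq hκ hκ2
  obtain rfl := h.eq h0 h1 hq (peaked_atomic (μ := μ) h0.le h1) hpol
  refine ⟨atomic_eq_downplay hμ (fun m => (hpos m).le) hpol rfl rfl, ?_⟩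
  refine orderICBinds_triple hκ (x := point (-1)) (y := peak _ h0.le h1) (z := point 1) ?_ ?_ ?_ ?_ ?_
  · rw [support_atomic]
    ext w
    simp only [Set.mem_ofPred_eq, Set.mem_insert_iff, Set.mem_singleton_iff]
    constructor
    · rintro ⟨m, -, rfl⟩
      cases m
      · exact Or.inr (Or.inl rfl)
      · exact Or.inl rfl
      · exact Or.inr (Or.inr rfl)
    · rintro (rfl | rfl | rfl)
      · exact ⟨.neg, hpos _, rfl⟩
      · exact ⟨.zero, hpos _, rfl⟩
      · exact ⟨.pos, hpos _, rfl⟩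
  · rw [meanState_point, meanState_peak]; simp
  · rw [meanState_point, meanState_peak]; simp
  · rw [meanState_point, meanState_peak, peak_zero, point_zero_of_ne (by decide)]
    simp
    linarith
  · rw [meanState_point, meanState_peak, peak_zero, point_zero_of_ne (by decide)]
    simp
    linarith

lemma exists_peaked {μ : Belief} (hμ : ∀ θ, 0 < μ θ) {s : ℝ} (h0 : 0 < s) (h1 : s ≤ 1)
    (hA : μ 0 < s * (1 + meanState μ)) (hB : μ 0 < s * (1 - meanState μ)) :
    ∃ q ∈ policies μ, Peaked s q :=
  ⟨_, peaked_atomic_mem_policies hμ h0 h1 hA hB, peaked_atomic h0.le h1⟩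

lemma downplay_mem_policies (μ : Belief) (πm πp : unitInterval) :
    downplay μ πm πp ∈ policies μ := induced_mem_policies _ _

lemma belief_eq_point_neg {w : Belief} (h0 : w 0 = 0) (h1 : w 1 = 0) : w = point (-1) := by
  have h := belief_sum w
  apply belief_ext
  · rw [meanState_point, meanState_eq]; simp; linarith
  · rw [h0, point_zero_of_ne (by decide)]

lemma belief_eq_point_pos {w : Belief} (h0 : w 0 = 0) (h1 : w (-1) = 0) : w = point 1 := by
  have h := belief_sum w
  apply belief_ext
  · rw [meanState_point, meanState_eq]; simp; linarith
  · rw [h0, point_zero_of_ne (by decide)]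

/-- The support of a downplaying policy. -/
lemma exists_support_downplay {μ : Belief} (hμ : ∀ θ, 0 < μ θ) (πm πp : unitInterval) :
    ∃ y ∈ (downplay μ πm πp).support, 0 < y 0 ∧
      ∀ w ∈ (downplay μ πm πp).support, w = point (-1) ∨ w = y ∨ w = point 1 := by
  set σ : State → Belief := fun
    | .zero => point 0
    | .neg => lottery πm 0 (-1)
    | .pos => lottery πp 0 1 with hσ
  have e0 : ∀ m, σ 0 m = if m = 0 then 1 else 0 := fun m => point_apply 0 m
  have em : ∀ m, σ (-1) m = πm * (if m = 0 then 1 else 0) + (1 - πm) * (if m = -1 then 1 else 0) :=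
    fun m => lottery_apply πm 0 (-1) m
  have ep : ∀ m, σ 1 m = πp * (if m = 0 then 1 else 0) + (1 - πp) * (if m = 1 then 1 else 0) :=
    fun m => lottery_apply πp 0 1 m
  have hsup : (downplay μ πm πp).support = _ := support_induced μ σ
  have hpos : 0 < msgProb μ σ 0 := by
    rw [msgProb_eq, e0, if_pos rfl, mul_one]
    have h1 := mul_nonneg (hμ (-1)).le (belief_nonneg (σ (-1)) 0)
    have h2 := mul_nonneg (hμ 1).le (belief_nonneg (σ 1) 0)
    linarith [hμ 0]
  refine ⟨posterior μ σ 0, hsup ▸ ⟨0, hpos, rfl⟩, ?_, ?_⟩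
  · rw [posterior_apply hpos.ne', e0, if_pos rfl, mul_one]
    exact div_pos (hμ 0) hpos
  · rw [hsup]
    rintro w ⟨m, hm, rfl⟩
    rcases SignType.trichotomy m with rfl | rfl | rfl
    · refine Or.inl (belief_eq_point_neg ?_ ?_)
      · rw [posterior_apply hm.ne', e0]; simp
      · rw [posterior_apply hm.ne', ep]; simp
    · exact Or.inr (Or.inl rfl)
    · refine Or.inr (Or.inr (belief_eq_point_pos ?_ ?_))
      · rw [posterior_apply hm.ne', e0]; simp
      · rw [posterior_apply hm.ne', em]; simp

lemma eq_critSlope_mul {κ u v : ℝ} (hκ : 0 < κ) (hκ2 : κ ≤ 2) (hu : 0 ≤ u) (hv : 0 ≤ v)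
    (h : 3 * κ * u ^ 2 = (2 - κ) * v ^ 2) : u = critSlope κ * v := by
  have h' : u ^ 2 = (critSlope κ * v) ^ 2 := by
    refine mul_left_cancel₀ (by linarith : 3 * κ ≠ 0) ?_
    rw [h, ← critSlope_sq hκ hκ2]
    ring
  exact (sq_eq_sq₀ hu (mul_nonneg (critSlope_nonneg κ) hv)).1 h'

/-- The mean of a policy lies on every line that carries its support. Supports on a line that misses
the prior are excluded in this way. -/
lemma support_line {μ : Belief} {q : Measure Belief} (hq : q ∈ policies μ) {α β γ : ℝ}
    (h : ∀ w ∈ q.support, α * meanState w + β * w 0 + γ = 0) :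
    α * meanState μ + β * μ 0 + γ = 0 := by
  rw [← integral_affine hq]
  apply integral_eq_zero_of_ae
  filter_upwards [Measure.support_mem_ae (μ := q)] with w hw using h w hw

/-- A downplaying policy that makes order-IC bind has the downplaying shape. -/
lemma peaked_of_orderICBinds {μ : Belief} (hμ : ∀ θ, 0 < μ θ) {κ : ℝ} (hκ : 0 < κ) (hκ2 : κ ≤ 2)
    (h0 : 0 < critSlope κ) (hA : μ 0 < critSlope κ * (1 + meanState μ))
    (hB : μ 0 < critSlope κ * (1 - meanState μ)) {πm πp : unitInterval}
    (h : OrderICBinds κ (downplay μ πm πp)) : Peaked (critSlope κ) (downplay μ πm πp) := by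
  obtain ⟨y, hy, hy0, hsub⟩ := exists_support_downplay hμ πm πp
  have hq := downplay_mem_policies μ πm πp
  set q := downplay μ πm πp
  have am : meanState (point (-1)) = -1 := by rw [meanState_point]; simp
  have ap : meanState (point 1) = 1 := by rw [meanState_point]; simp
  have zm : point (-1) 0 = 0 := point_zero_of_ne (by decide)
  have zp : point 1 0 = 0 := point_zero_of_ne (by decide)
  have b1 := meanState_le y
  have b2 := neg_meanState_le y
  have hm : point (-1) ∈ q.support → y 0 = critSlope κ * (1 + meanState y) := by
    intro hmem
    have hb := h.binds hκ hmem hy (by rw [am]; linarith) (fun w hw => by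
      rcases hsub w hw with e | e | e
      · exact Or.inl e
      · exact Or.inr (Or.inl e)
      · refine Or.inr (Or.inr (Or.inr ?_)); rw [e, ap]; linarith)
    rw [am, zm] at hb
    exact eq_critSlope_mul hκ hκ2 hy0.le (by linarith) (by linarith)
  have hp : point 1 ∈ q.support → y 0 = critSlope κ * (1 - meanState y) := by
    intro hmem
    have hb := h.binds hκ hy hmem (by rw [ap]; linarith) (fun w hw => by
      rcases hsub w hw with e | e | e
      · refine Or.inr (Or.inr (Or.inl ?_)); rw [e, am]; linarith
      · exact Or.inl e
      · exact Or.inr (Or.inl e))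
    rw [ap, zp] at hb
    exact eq_critSlope_mul hκ hκ2 hy0.le (by linarith) (by linarith)
  -- With only one corner present, the support would lie on the line of critical slope through that
  -- corner, whereas the prior lies strictly below it. With neither, the support would be a single
  -- belief, which `OrderICBinds` excludes.
  have hmp : point (-1) ∈ q.support ∧ point 1 ∈ q.support := by
    by_cases cm : point (-1) ∈ q.support <;> by_cases cp : point 1 ∈ q.support
    · exact ⟨cm, cp⟩
    · exfalso
      have := support_line hq (α := -critSlope κ) (β := 1) (γ := -critSlope κ) (fun w hw => by
        rcases hsub w hw with rfl | rfl | rfl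
        · rw [am, zm]; ring
        · rw [hm cm]; ring
        · exact absurd hw cp)
      linarith
    · exfalso
      have := support_line hq (α := critSlope κ) (β := 1) (γ := -critSlope κ) (fun w hw => by
        rcases hsub w hw with rfl | rfl | rfl
        · exact absurd hw cm
        · rw [hp cp]; ring
        · rw [ap, zp]; ring)
      linarith
    · exfalso
      obtain ⟨u, hu, v, hv, huv⟩ := h.exists_ne
      have only : ∀ w ∈ q.support, w = y := fun w hw => by
        rcases hsub w hw with rfl | rfl | rfl
        · exact absurd hw cm
        · rfl
        · exact absurd hw cp
      exact huv ((only u hu).trans (only v hv).symm)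
  have e1 := hm hmp.1
  have e2 := hp hmp.2
  have ey : meanState y = 0 := by
    have : critSlope κ * (2 * meanState y) = 0 := by linarith
    rcases mul_eq_zero.1 this with h | h <;> linarith
  intro w hw
  rcases hsub w hw with rfl | rfl | rfl
  · rw [am, zm]; simp
  · rw [ey, e1, ey]; simp
  · rw [ap, zp]; simp

/-! ### Exaggeration -/

lemma exaggerate_mem_policies (μ : Belief) (π : unitInterval) :
    exaggerate μ π ∈ policies μ := induced_mem_policies _ _

/-- A belief with mean state `0` on an edge is the apex, which lies on both edges. The whole
support, and with it the prior, would then lie on one edge, against full support. -/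
lemma EdgePair.sign {μ : Belief} (hμ : ∀ θ, 0 < μ θ) {q : Measure Belief} {x y : Belief}
    (h : EdgePair q x y) (hq : q ∈ policies μ) : meanState x < 0 ∧ 0 < meanState y := by
  have h1 := meanState_le x
  have h2 := neg_meanState_le y
  have hx := h.left
  have hy := h.right
  have hm := hμ (-1)
  have hp := hμ 1
  rw [belief_neg_eq] at hm
  rw [belief_pos_eq] at hp
  constructor
  · refine lt_of_le_of_ne (by linarith) fun h0 => ?_
    have := support_line hq (α := 1) (β := 1) (γ := -1) (fun w hw => by
      rw [h.support_eq] at hw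
      rcases hw with rfl | rfl <;> linarith)
    linarith
  · refine lt_of_le_of_ne (by linarith) fun h0 => ?_
    have := support_line hq (α := -1) (β := 1) (γ := -1) (fun w hw => by
      rw [h.support_eq] at hw
      rcases hw with rfl | rfl <;> linarith)
    linarith

/-- A policy with one belief on either edge is an exaggeration. -/
lemma EdgePair.eq_exaggerate {μ : Belief} (hμ : ∀ θ, 0 < μ θ) {q : Measure Belief} {x y : Belief}
    (h : EdgePair q x y) (hq : q ∈ policies μ) : ∃ π : unitInterval, q = exaggerate μ π ∧
      μ 0 * π = q.real {x} * x 0 ∧ μ 0 * (1 - π) = q.real {y} * y 0 := by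
  classical
  obtain ⟨hx, hy⟩ := h.sign hμ hq
  have hne : x ≠ y := fun e => by rw [e] at hx; linarith
  have := hq.1
  have hsum := eq_sum_of_support_subset (q := q) (S := {x, y}) (by rw [h.support_eq]; simp)
  rw [Finset.sum_pair hne] at hsum
  set w : State → ℝ := fun | .zero => 0 | .neg => q.real {x} | .pos => q.real {y} with hw
  -- The belief after message `0` is arbitrary, as that message has weight zero.
  set b : State → Belief := fun | .zero => x | .neg => x | .pos => y with hb
  have hat : atomic w b = q := by
    rw [atomic]
    have hu : (Finset.univ : Finset State) = {0, -1, 1} := by decide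
    rw [hu, Finset.sum_insert (by decide), Finset.sum_insert (by decide), Finset.sum_singleton]
    change ENNReal.ofReal 0 • Measure.dirac x + (ENNReal.ofReal (q.real {x}) • Measure.dirac x
      + ENNReal.ofReal (q.real {y}) • Measure.dirac y) = q
    rw [ofReal_measureReal, ofReal_measureReal, ← hsum, ENNReal.ofReal_zero, zero_smul, zero_add]
  have hw0 : ∀ m, 0 ≤ w m := by
    rintro (_ | _ | _)
    · exact le_rfl
    · exact measureReal_nonneg
    · exact measureReal_nonneg
  have hpol : atomic w b ∈ policies μ := by rwa [hat]
  obtain ⟨π, hπ, e⟩ := atomic_eq_exaggerate hμ hw0 hpol rfl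
    (by change x 1 = 0; rw [belief_pos_eq, h.left]; ring)
    (by change y (-1) = 0; rw [belief_neg_eq, h.right]; ring)
  have hm := mean_atomic_of_policy hw0 hpol 0
  rw [sum_state] at hm
  change 0 * x 0 + q.real {x} * x 0 + q.real {y} * y 0 = μ 0 at hm
  change μ 0 * (π : ℝ) = q.real {x} * x 0 at e
  exact ⟨π, by rw [← hπ, hat], e, by linarith⟩

lemma EdgePair.eq_exaggerate_zero {μ : Belief} (hμ : ∀ θ, 0 < μ θ) {q : Measure Belief}
    {x y : Belief} (h : EdgePair q x y) (hq : q ∈ policies μ) (hx : meanState x = -1) :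
    q = exaggerate μ 0 := by
  obtain ⟨π, rfl, e, -⟩ := h.eq_exaggerate hμ hq
  congr 1
  rw [h.left, hx] at e
  apply Subtype.ext
  change (π : ℝ) = 0
  have : μ 0 * (π : ℝ) = 0 := by linarith
  exact (mul_eq_zero.1 this).resolve_left (hμ 0).ne'

lemma EdgePair.eq_exaggerate_one {μ : Belief} (hμ : ∀ θ, 0 < μ θ) {q : Measure Belief}
    {x y : Belief} (h : EdgePair q x y) (hq : q ∈ policies μ) (hy : meanState y = 1) :
    q = exaggerate μ 1 := by
  obtain ⟨π, rfl, -, e⟩ := h.eq_exaggerate hμ hq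
  congr 1
  rw [h.right, hy] at e
  apply Subtype.ext
  change (π : ℝ) = 1
  have : μ 0 * (1 - (π : ℝ)) = 0 := by linarith
  have := (mul_eq_zero.1 this).resolve_left (hμ 0).ne'
  linarith

/-- The support of an exaggeration. -/
lemma exists_edgePair_exaggerate {μ : Belief} (hμ : ∀ θ, 0 < μ θ) (π : unitInterval) :
    ∃ x y, EdgePair (exaggerate μ π) x y ∧
      (μ (-1) + μ 0 * π) * meanState x = -μ (-1) ∧
      (μ 1 + μ 0 * (1 - π)) * meanState y = μ 1 := by
  set σ : State → Belief := fun
    | .zero => lottery π (-1) 1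
    | .neg => point (-1)
    | .pos => point 1 with hσ
  have e0 : ∀ m, σ 0 m = π * (if m = -1 then 1 else 0) + (1 - π) * (if m = 1 then 1 else 0) :=
    fun m => lottery_apply π (-1) 1 m
  have em : ∀ m, σ (-1) m = if m = -1 then 1 else 0 := fun m => point_apply (-1) m
  have ep : ∀ m, σ 1 m = if m = 1 then 1 else 0 := fun m => point_apply 1 m
  have h0 := π.2.1
  have h1 := π.2.2
  have m0 : msgProb μ σ 0 = 0 := by rw [msgProb_eq, e0, em, ep]; simp
  have mm : msgProb μ σ (-1) = μ (-1) + μ 0 * π := by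
    rw [msgProb_eq, e0, em, ep]; simp; ring
  have mp : msgProb μ σ 1 = μ 1 + μ 0 * (1 - π) := by
    rw [msgProb_eq, e0, em, ep]; simp; ring
  have pm : 0 < msgProb μ σ (-1) := by
    rw [mm]; have := mul_nonneg (hμ 0).le h0; linarith [hμ (-1)]
  have pp : 0 < msgProb μ σ 1 := by
    rw [mp]; have := mul_nonneg (hμ 0).le (sub_nonneg.2 h1); linarith [hμ 1]
  have hsup : (exaggerate μ π).support = _ := support_induced μ σ
  refine ⟨posterior μ σ (-1), posterior μ σ 1, ⟨?_, ?_, ?_⟩, ?_, ?_⟩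
  · rw [hsup]
    ext w
    simp only [Set.mem_ofPred_eq, Set.mem_insert_iff, Set.mem_singleton_iff]
    constructor
    · rintro ⟨m, hm, rfl⟩
      rcases SignType.trichotomy m with rfl | rfl | rfl
      · exact Or.inl rfl
      · rw [m0] at hm; exact absurd hm (lt_irrefl _)
      · exact Or.inr rfl
    · rintro (rfl | rfl)
      · exact ⟨_, pm, rfl⟩
      · exact ⟨_, pp, rfl⟩
  · have h : posterior μ σ (-1) 1 = 0 := by
      rw [posterior_apply pm.ne', ep]; simp
    rw [belief_pos_eq] at h
    linarith
  · have h : posterior μ σ 1 (-1) = 0 := by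
      rw [posterior_apply pp.ne', em]; simp
    rw [belief_neg_eq] at h
    linarith
  · rw [← mm, meanState_posterior pm.ne', em, ep, mul_div_cancel₀ _ pm.ne']; simp
  · rw [← mp, meanState_posterior pp.ne', em, ep, mul_div_cancel₀ _ pp.ne']; simp

lemma integral_sq_exaggerate (μ : Belief) (π : unitInterval) :
    ∫ ν, meanState ν ^ 2 ∂(exaggerate μ π)
      = μ (-1) ^ 2 / (μ (-1) + μ 0 * π) + μ 1 ^ 2 / (μ 1 + μ 0 * (1 - π)) := by
  rw [exaggerate, integral_sq_induced, sum_state, msgProb_eq, msgProb_eq, msgProb_eq]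
  have e0 : ∀ m, lottery π (-1) 1 m
      = π * (if m = -1 then 1 else 0) + (1 - π) * (if m = 1 then 1 else 0) :=
    fun m => lottery_apply π (-1) 1 m
  change (μ 1 * point 1 0 - μ (-1) * point (-1) 0) ^ 2 / (μ 0 * lottery π (-1) 1 0
    + μ (-1) * point (-1) 0 + μ 1 * point 1 0) + (μ 1 * point 1 (-1) - μ (-1) * point (-1) (-1)) ^ 2
    / (μ 0 * lottery π (-1) 1 (-1) + μ (-1) * point (-1) (-1) + μ 1 * point 1 (-1))
    + (μ 1 * point 1 1 - μ (-1) * point (-1) 1) ^ 2 / (μ 0 * lottery π (-1) 1 1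
    + μ (-1) * point (-1) 1 + μ 1 * point 1 1) = _
  simp only [e0, point_apply]
  simp [add_comm]

lemma integral_sq_exaggerate_one {μ : Belief} (hμ : ∀ θ, 0 < μ θ) :
    (1 - meanState μ + μ 0) * ∫ ν, meanState ν ^ 2 ∂(exaggerate μ 1)
      = (1 - meanState μ + μ 0) - 2 * μ 0 * (1 - meanState μ) := by
  rw [integral_sq_exaggerate]
  have h1 := hμ 1
  have h2 := hμ (-1)
  have h3 := hμ 0
  have e1 : (1 - meanState μ + μ 0) = 2 * (μ (-1) + μ 0) := by rw [belief_neg_eq]; ring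
  have e2 : 1 - meanState μ = 2 * μ (-1) + μ 0 := by linarith
  have e3 := belief_sum μ
  rw [e1, e2]
  simp
  rw [show μ 1 ^ 2 / μ 1 = μ 1 by field_simp, show μ 1 = 1 - μ 0 - μ (-1) by linarith]
  field_simp
  ring

lemma slope_of_edgePair {q : Measure Belief} {x y : Belief} {s : ℝ}
    (h : EdgePair q x y) (hxy : |y 0 - x 0| ≤ s * |meanState y - meanState x|) :
    ∀ u ∈ q.support, ∀ v ∈ q.support, |u 0 - v 0| ≤ s * |meanState u - meanState v| := by
  intro u hu v hv
  rw [h.support_eq] at hu hv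
  rcases hu with rfl | rfl <;> rcases hv with rfl | rfl
  · simp
  · rw [abs_sub_comm, abs_sub_comm (meanState u)]; exact hxy
  · exact hxy
  · simp

/-- Separating exaggeration is optimal for intermediate costs. -/
lemma isOptimalOutcome_exaggerate_one {μ : Belief} (hμ : ∀ θ, 0 < μ θ) {κ : ℝ} (hκ : 0 < κ)
    (hκ2 : κ ≤ 2) (ha : 0 ≤ meanState μ)
    (hB : 2 * critSlope κ * (1 - meanState μ) ≤ 1 - meanState μ + μ 0)
    (ht : μ 0 ≤ critSlope κ * (1 - meanState μ)) : IsOptimalOutcome μ κ (exaggerate μ 1) := by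
  have hpol := exaggerate_mem_policies μ 1
  have hzB : μ 0 < 1 - meanState μ := by have := hμ (-1); rw [belief_neg_eq] at this; linarith
  rw [isOptimalOutcome_iff]
  refine ⟨⟨hpol, ?_⟩, fun q' hq' hd => ?_⟩
  · obtain ⟨x, y, hxy, hx, hy⟩ := exists_edgePair_exaggerate hμ 1
    rw [discernible_iff hκ hκ2]
    refine slope_of_edgePair hxy ?_
    have h1 := hμ 1
    have hy1 : meanState y = 1 := by
      simp at hy
      exact mul_left_cancel₀ h1.ne' (by linarith)
    have hx1 : (1 - meanState μ + μ 0) * meanState x = -(1 - meanState μ - μ 0) := by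
      rw [belief_neg_eq] at hx
      simp at hx
      linarith
    -- The slope between the left belief and state `1` has absolute value `μ 0 / (1 - a_μ)`, so `ht`
    -- is precisely what incentive compatibility requires.
    rw [hxy.left, hxy.right, hy1, abs_of_nonpos (by linarith [hxy.left, belief_nonneg x 0]),
      abs_of_nonneg (by linarith [meanState_le x, belief_nonneg x 0])]
    have hpos : 0 < 1 - meanState μ + μ 0 := by linarith [hμ 0]
    refine le_of_mul_le_mul_left ?_ hpos
    nlinarith
  · rw [discernible_iff hκ hκ2] at hd
    have hb := exaggerate_bound_right hμ hq' hd ha hB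
    have he := integral_sq_exaggerate_one hμ
    have hpos : 0 < 1 - meanState μ + μ 0 := by linarith [hμ 0]
    exact le_of_mul_le_mul_left (hb.trans he.ge) hpos

lemma reflect_pos {μ : Belief} (hμ : ∀ θ, 0 < μ θ) (θ : State) : 0 < reflectBelief μ θ := by
  rw [reflectBelief_apply]; exact hμ _

lemma isOptimalOutcome_exaggerate_zero {μ : Belief} (hμ : ∀ θ, 0 < μ θ) {κ : ℝ} (hκ : 0 < κ)
    (hκ2 : κ ≤ 2) (ha : meanState μ ≤ 0)
    (hA : 2 * critSlope κ * (1 + meanState μ) ≤ 1 + meanState μ + μ 0)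
    (ht : μ 0 ≤ critSlope κ * (1 + meanState μ)) : IsOptimalOutcome μ κ (exaggerate μ 0) := by
  have h := (isOptimalOutcome_exaggerate_one (reflect_pos hμ) hκ hκ2
    (by rw [meanState_reflectBelief]; linarith)
    (by rw [meanState_reflectBelief, reflectBelief_zero]; linarith)
    (by rw [meanState_reflectBelief, reflectBelief_zero]; linarith)).reflect
  rwa [reflect_exaggerate, reflectBelief_reflectBelief, unitInterval.symm_one] at h

lemma integral_sq_exaggerate_zero {μ : Belief} (hμ : ∀ θ, 0 < μ θ) :
    (1 + meanState μ + μ 0) * ∫ ν, meanState ν ^ 2 ∂(exaggerate μ 0)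
      = (1 + meanState μ + μ 0) - 2 * μ 0 * (1 + meanState μ) := by
  have h := integral_sq_exaggerate_one (reflect_pos hμ)
  rw [← integral_sq_reflect, reflect_exaggerate, reflectBelief_reflectBelief,
    unitInterval.symm_one, meanState_reflectBelief, reflectBelief_zero] at h
  linear_combination h

/-- The exaggeration towards the more likely extreme state generates less dispersion. -/
lemma nonneg_of_isOptimalOutcome_exaggerate_one {μ : Belief} (hμ : ∀ θ, 0 < μ θ) {κ : ℝ}
    (h : IsOptimalOutcome μ κ (exaggerate μ 1))
    (h0 : meanState μ ≤ 0 → IsOptimalOutcome μ κ (exaggerate μ 0)) : 0 ≤ meanState μ := by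
  by_contra hneg
  push Not at hneg
  have h1 := (isOptimalOutcome_iff.1 (h0 hneg.le)).1
  have h2 := (isOptimalOutcome_iff.1 h).2 _ h1.1 h1.2
  have e0 := integral_sq_exaggerate_zero hμ
  have e1 := integral_sq_exaggerate_one hμ
  have hz := hμ 0
  have hzA : μ 0 < 1 + meanState μ := by have := hμ 1; rw [belief_pos_eq] at this; linarith
  set M0 := ∫ ν, meanState ν ^ 2 ∂(exaggerate μ 0)
  set M1 := ∫ ν, meanState ν ^ 2 ∂(exaggerate μ 1)
  have c0 : (1 + meanState μ + μ 0) * (1 - meanState μ + μ 0) * M0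
      = (1 - meanState μ + μ 0) * ((1 + meanState μ + μ 0) - 2 * μ 0 * (1 + meanState μ)) := by
    rw [← e0]; ring
  have c1 : (1 + meanState μ + μ 0) * (1 - meanState μ + μ 0) * M1
      = (1 + meanState μ + μ 0) * ((1 - meanState μ + μ 0) - 2 * μ 0 * (1 - meanState μ)) := by
    rw [← e1]; ring
  have hp : 0 < (1 + meanState μ + μ 0) * (1 - meanState μ + μ 0) :=
    mul_pos (by linarith) (by linarith)
  have c2 := mul_le_mul_of_nonneg_left h2 hp.le
  -- Multiplied by both denominators, `M0 - M1` equals `4 (μ 0)² (-a_μ)`.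
  have c3 : 0 < μ 0 * μ 0 * (-meanState μ) := mul_pos (mul_pos hz hz) (by linarith)
  nlinarith

lemma nonpos_of_isOptimalOutcome_exaggerate_zero {μ : Belief} (hμ : ∀ θ, 0 < μ θ) {κ : ℝ}
    (h : IsOptimalOutcome μ κ (exaggerate μ 0))
    (h0 : 0 ≤ meanState μ → IsOptimalOutcome μ κ (exaggerate μ 1)) : meanState μ ≤ 0 := by
  have h' := nonneg_of_isOptimalOutcome_exaggerate_one (reflect_pos hμ) (κ := κ)
    (by have := h.reflect; rwa [reflect_exaggerate, unitInterval.symm_zero] at this)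
    (fun hm => by
      rw [meanState_reflectBelief] at hm
      have := (h0 (by linarith)).reflect
      rwa [reflect_exaggerate, unitInterval.symm_one] at this)
  rw [meanState_reflectBelief] at h'
  linarith

/-! ### Binding exaggeration -/

/-- The support lies on the line of slope `σ` through the prior, and on the edges where one of the
extreme states is ruled out. -/
def OnLine (μ : Belief) (σ : ℝ) (q : Measure Belief) : Prop :=
  ∀ w ∈ q.support, w 0 - μ 0 = σ * (meanState w - meanState μ) ∧ (1 - w 0) ^ 2 = meanState w ^ 2

/-- A policy on the edges whose slopes differ from those of the edges. -/
lemma exists_edgePair {μ : Belief} (hμ : ∀ θ, 0 < μ θ) {κ : ℝ} (hκ : 1 / 2 < κ)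
    {q : Measure Belief} (hq : q ∈ policies μ)
    (he : ∀ x ∈ q.support, (1 - x 0) ^ 2 = meanState x ^ 2)
    (hs : ∀ x ∈ q.support, ∀ w ∈ q.support,
      3 * κ * (w 0 - x 0) ^ 2 = (2 - κ) * (meanState w - meanState x) ^ 2) :
    ∃ x y, EdgePair q x y := by
  have hedge : ∀ w ∈ q.support, w 0 = 1 + meanState w ∨ w 0 = 1 - meanState w := by
    intro w hw
    rcases sq_eq_sq_iff_eq_or_eq_neg.1 (he w hw) with h | h
    · right; linarith
    · left; linarith
  have hm := hμ (-1)
  have hp := hμ 1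
  rw [belief_neg_eq] at hm
  rw [belief_pos_eq] at hp
  obtain ⟨x, hx, hxl⟩ : ∃ x ∈ q.support, x 0 = 1 + meanState x := by
    by_contra hc
    push Not at hc
    have := support_line hq (α := 1) (β := 1) (γ := -1) (fun w hw => by
      rcases hedge w hw with h | h
      · exact absurd h (hc w hw)
      · linarith)
    linarith
  obtain ⟨y, hy, hyr⟩ : ∃ y ∈ q.support, y 0 = 1 - meanState y := by
    by_contra hc
    push Not at hc
    have := support_line hq (α := -1) (β := 1) (γ := -1) (fun w hw => by
      rcases hedge w hw with h | h
      · linarith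
      · exact absurd h (hc w hw))
    linarith
  -- The edges have slope `± 1`, while `κ > 1/2` makes the slopes within the support strictly
  -- flatter. Hence each edge carries only one belief.
  have same : ∀ u ∈ q.support, ∀ v ∈ q.support,
      (u 0 - v 0) ^ 2 = (meanState u - meanState v) ^ 2 → u = v := by
    intro u hu v hv h
    have h1 := hs v hv u hu
    rw [h] at h1
    have h2 : (4 * κ - 2) * (meanState u - meanState v) ^ 2 = 0 := by linarith
    have h3 := (mul_eq_zero.1 h2).resolve_left (by linarith)
    have h4 := pow_eq_zero_iff (two_ne_zero) |>.1 h3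
    rw [h4] at h
    have h5 := pow_eq_zero_iff (two_ne_zero) |>.1 (h.trans (zero_pow two_ne_zero))
    exact belief_ext (by linarith) (by linarith)
  refine ⟨x, y, ?_, hxl, hyr⟩
  apply Set.Subset.antisymm
  · intro w hw
    rcases hedge w hw with h | h
    · exact Or.inl (same w hw x hx (by rw [h, hxl]; ring))
    · exact Or.inr (same w hw y hy (by rw [h, hyr]; ring))
  · rintro w (rfl | rfl)
    · exact hx
    · exact hy

lemma EdgePair.onLine {μ : Belief} {q : Measure Belief} (hq : q ∈ policies μ) {x y : Belief}
    (h : EdgePair q x y) {σ : ℝ} (hσ : y 0 - x 0 = σ * (meanState y - meanState x)) :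
    OnLine μ σ q := by
  have hline : ∀ w ∈ q.support, (-σ) * meanState w + 1 * w 0 + (σ * meanState x - x 0) = 0 := by
    intro w hw
    rw [h.support_eq] at hw
    rcases hw with rfl | rfl
    · ring
    · linarith
  have hmean := support_line hq hline
  intro w hw
  refine ⟨by linarith [hline w hw], ?_⟩
  rw [h.support_eq] at hw
  rcases hw with rfl | rfl
  · rw [h.left]; ring
  · rw [h.right]; ring

lemma onLine_or_of_sq {μ : Belief} {κ : ℝ} (hκ : 0 < κ) (hκ2 : κ ≤ 2) {q : Measure Belief}
    (hq : q ∈ policies μ) {x y : Belief} (h : EdgePair q x y)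
    (hs : 3 * κ * (y 0 - x 0) ^ 2 = (2 - κ) * (meanState y - meanState x) ^ 2) :
    OnLine μ (critSlope κ) q ∨ OnLine μ (-critSlope κ) q := by
  have h1 : (y 0 - x 0) ^ 2 = (critSlope κ * (meanState y - meanState x)) ^ 2 := by
    refine mul_left_cancel₀ (by linarith : 3 * κ ≠ 0) ?_
    rw [hs, ← critSlope_sq hκ hκ2]
    ring
  rcases sq_eq_sq_iff_eq_or_eq_neg.1 h1 with h2 | h2
  · exact Or.inl (h.onLine hq h2)
  · exact Or.inr (h.onLine hq (by rw [h2]; ring))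

section OnLine

variable {μ : Belief} {σ κ : ℝ} {q : Measure Belief}

lemma OnLine.pairwise (h : OnLine μ σ q) (hσ : 3 * κ * σ ^ 2 = 2 - κ) :
    ∀ x ∈ q.support, ∀ w ∈ q.support,
      3 * κ * (w 0 - x 0) ^ 2 = (2 - κ) * (meanState w - meanState x) ^ 2 := by
  intro x hx w hw
  have h1 : w 0 - x 0 = σ * (meanState w - meanState x) := by
    linarith [(h x hx).1, (h w hw).1]
  rw [h1, ← hσ]
  ring

lemma OnLine.discernible (h : OnLine μ σ q) (hσ : 3 * κ * σ ^ 2 = 2 - κ) :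
    Discernible κ q.support := by
  intro x hx y hy
  have := h.pairwise hσ y hy x hx
  rw [beliefDist_sq]
  linarith

/-- Equality in `binding_bound`: the squared equation of the line and that of the edges hold on the
support, and integrating both eliminates the second moment of `z`. -/
lemma OnLine.integral_sq (h : OnLine μ σ q) (hσ : 3 * κ * σ ^ 2 = 2 - κ) (hq : q ∈ policies μ) :
    (4 * κ - 2) * ((∫ w, meanState w ^ 2 ∂q) - meanState μ ^ 2)
      = 3 * κ * ((1 - μ 0) ^ 2 - meanState μ ^ 2) := by
  obtain ⟨hp, ha, hz⟩ := mem_policies_iff.1 hq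
  have h1 := integral_quadratic q (-1) 1 0 0 (-2) 1
  have h2 := integral_quadratic q (-(σ ^ 2)) 1 0 (2 * σ ^ 2 * meanState μ) (-2 * μ 0)
    (μ 0 ^ 2 - σ ^ 2 * meanState μ ^ 2)
  rw [ha, hz, integral_eq_zero_of_ae] at h1 h2
  · linear_combination 3 * κ * h1 - 3 * κ * h2
      + ((∫ w, meanState w ^ 2 ∂q) - meanState μ ^ 2) * hσ
  · filter_upwards [Measure.support_mem_ae (μ := q)] with w hw
    have := (h w hw).1
    have h3 : (w 0 - μ 0) ^ 2 = (σ * (meanState w - meanState μ)) ^ 2 := by rw [this]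
    simp only [Pi.zero_apply]
    linear_combination h3
  · filter_upwards [Measure.support_mem_ae (μ := q)] with w hw
    have := (h w hw).2
    simp only [Pi.zero_apply]
    linear_combination this

lemma OnLine.exists_edgePair (hμ : ∀ θ, 0 < μ θ) (hκ : 1 / 2 < κ) (h : OnLine μ σ q)
    (hσ : 3 * κ * σ ^ 2 = 2 - κ) (hq : q ∈ policies μ) : ∃ x y, EdgePair q x y :=
  AttentionManagement.exists_edgePair hμ hκ hq (fun x hx => (h x hx).2) (h.pairwise hσ)

/-- A policy on a line is a binding exaggeration. -/
lemma OnLine.eq_exaggerate (hμ : ∀ θ, 0 < μ θ) (hκ : 1 / 2 < κ) (h : OnLine μ σ q)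
    (hσ : 3 * κ * σ ^ 2 = 2 - κ) (hq : q ∈ policies μ) :
    (∃ π, q = exaggerate μ π) ∧ OrderICBinds κ q := by
  obtain ⟨x, y, hxy⟩ := h.exists_edgePair hμ hκ hσ hq
  obtain ⟨hx, hy⟩ := hxy.sign hμ hq
  obtain ⟨π, hπ, -⟩ := hxy.eq_exaggerate hμ hq
  refine ⟨⟨π, hπ⟩, orderICBinds_pair (by linarith) hxy.support_eq (by linarith) ?_⟩
  exact h.pairwise hσ y (by rw [hxy.support_eq]; simp) x (by rw [hxy.support_eq]; simp)

/-- A line flatter than the edges crosses each of them once, which pins down the two beliefs of a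
binding exaggeration. -/
lemma sq_lt_one_of_cost (hκ : 1 / 2 < κ) (hσ : 3 * κ * σ ^ 2 = 2 - κ) : -1 < σ ∧ σ < 1 := by
  rw [← abs_lt, ← sq_lt_one_iff_abs_lt_one]
  by_contra hc
  push Not at hc
  nlinarith

/-- There is at most one policy on a given line. -/
lemma OnLine.eq (hμ : ∀ θ, 0 < μ θ) (hκ : 1 / 2 < κ) {q' : Measure Belief} (h : OnLine μ σ q)
    (hσ : 3 * κ * σ ^ 2 = 2 - κ) (hq : q ∈ policies μ) (h' : OnLine μ σ q')
    (hq' : q' ∈ policies μ) : q = q' := by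
  classical
  obtain ⟨hσ1, hσ2⟩ := sq_lt_one_of_cost hκ hσ
  obtain ⟨x, y, hxy⟩ := h.exists_edgePair hμ hκ hσ hq
  obtain ⟨x', y', hxy'⟩ := h'.exists_edgePair hμ hκ hσ hq'
  obtain ⟨hx, hy⟩ := hxy.sign hμ hq
  have ex : x = x' := by
    have h1 := (h x (by rw [hxy.support_eq]; simp)).1
    have h2 := (h' x' (by rw [hxy'.support_eq]; simp)).1
    have h3 := hxy.left
    have h4 := hxy'.left
    have h5 : (1 - σ) * (meanState x - meanState x') = 0 := by linarith
    have h6 := (mul_eq_zero.1 h5).resolve_left (by linarith)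
    exact belief_ext (by linarith) (by linarith)
  have ey : y = y' := by
    have h1 := (h y (by rw [hxy.support_eq]; simp)).1
    have h2 := (h' y' (by rw [hxy'.support_eq]; simp)).1
    have h3 := hxy.right
    have h4 := hxy'.right
    have h5 : (1 + σ) * (meanState y - meanState y') = 0 := by linarith
    have h6 := (mul_eq_zero.1 h5).resolve_left (by linarith)
    exact belief_ext (by linarith) (by linarith)
  subst ex ey
  refine policy_ext hq hq' (S := {x, y}) (by rw [hxy.support_eq]; simp)
    (by rw [hxy'.support_eq]; simp) ?_
  intro v hv
  simp only [Finset.mem_insert, Finset.mem_singleton] at hv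
  rcases hv with rfl | rfl
  · refine ⟨1, 0, -meanState y, by linarith, fun w hw hne => ?_⟩
    simp only [Finset.mem_insert, Finset.mem_singleton] at hw
    rcases hw with rfl | rfl
    · exact absurd rfl hne
    · ring
  · refine ⟨1, 0, -meanState x, by linarith, fun w hw hne => ?_⟩
    simp only [Finset.mem_insert, Finset.mem_singleton] at hw
    rcases hw with rfl | rfl
    · ring
    · exact absurd rfl hne

/-- A line that carries a policy leaves the triangle of beliefs through the edges. -/
lemma OnLine.feasible (hμ : ∀ θ, 0 < μ θ) (hκ : 1 / 2 < κ) (h : OnLine μ σ q)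
    (hσ : 3 * κ * σ ^ 2 = 2 - κ) (hq : q ∈ policies μ) :
    σ * (1 + meanState μ) ≤ μ 0 ∧ -σ * (1 - meanState μ) ≤ μ 0 := by
  obtain ⟨hσ1, hσ2⟩ := sq_lt_one_of_cost hκ hσ
  obtain ⟨x, y, hxy⟩ := h.exists_edgePair hμ hκ hσ hq
  have h1 := (h x (by rw [hxy.support_eq]; simp)).1
  have h2 := (h y (by rw [hxy.support_eq]; simp)).1
  have h3 := hxy.left
  have h4 := hxy.right
  have n1 := mul_nonneg (belief_nonneg x 0) (by linarith : 0 ≤ 1 - σ)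
  have n2 := mul_nonneg (belief_nonneg y 0) (by linarith : 0 ≤ 1 + σ)
  constructor
  · rw [h3] at h1 n1; linarith
  · rw [h4] at h2 n2; linarith

lemma exists_onLine (hμ : ∀ θ, 0 < μ θ) (hκ : 1 / 2 < κ) (hσ : 3 * κ * σ ^ 2 = 2 - κ)
    (hA : σ * (1 + meanState μ) ≤ μ 0) (hB : -σ * (1 - meanState μ) ≤ μ 0) :
    ∃ q ∈ policies μ, OnLine μ σ q := by
  obtain ⟨hσ1, hσ2⟩ := sq_lt_one_of_cost hκ hσ
  have hm := hμ (-1)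
  have hp := hμ 1
  have h0 := hμ 0
  rw [belief_neg_eq] at hm
  rw [belief_pos_eq] at hp
  set a := meanState μ with ha
  set z := μ 0 with hz
  have hd : 0 < 1 - z + σ * a := by nlinarith
  have hs1 : 0 < 1 + σ := by linarith
  have hs2 : 0 < 1 - σ := by linarith
  -- At action `0` the line runs `d` below the apex. It meets the edges at the actions `-d / (1 -
  -- σ)` and `d / (1 + σ)`, which `hA` and `hB` keep within `[-1, 1]`.
  set d := 1 - z + σ * a with hd'
  have f1 : d / (1 + σ) ≤ 1 := by rw [div_le_one hs1]; linarith
  have f2 : d / (1 - σ) ≤ 1 := by rw [div_le_one hs2]; linarith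
  have g1 : 0 < d / (1 + σ) := div_pos hd hs1
  have g2 : 0 < d / (1 - σ) := div_pos hd hs2
  set x : Belief := ofCoords (-(d / (1 - σ))) (1 - d / (1 - σ)) (by linarith) (by linarith)
    (by linarith) with hx
  set y : Belief := ofCoords (d / (1 + σ)) (1 - d / (1 + σ)) (by linarith) (by linarith)
    (by linarith) with hy
  have xa : meanState x = -(d / (1 - σ)) := meanState_ofCoords _ _ _
  have ya : meanState y = d / (1 + σ) := meanState_ofCoords _ _ _
  have xz : x 0 = 1 - d / (1 - σ) := rfl
  have yz : y 0 = 1 - d / (1 + σ) := rfl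
  set w : State → ℝ := fun
    | .zero => 0
    | .neg => (1 - z - a) * (1 - σ) / (2 * d)
    | .pos => (1 - z + a) * (1 + σ) / (2 * d) with hw
  set b : State → Belief := fun | .zero => x | .neg => x | .pos => y with hb
  have hw0 : ∀ m, 0 ≤ w m := by
    rintro (_ | _ | _)
    · exact le_rfl
    · exact div_nonneg (mul_nonneg (by linarith) hs2.le) (by linarith)
    · exact div_nonneg (mul_nonneg (by linarith) hs1.le) (by linarith)
  refine ⟨atomic w b, atomic_mem_policies hw0 fun θ => ?_, ?_⟩
  · rw [sum_state]
    change 0 * x θ + (1 - z - a) * (1 - σ) / (2 * d) * x θ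
      + (1 - z + a) * (1 + σ) / (2 * d) * y θ = μ θ
    rcases SignType.trichotomy θ with rfl | rfl | rfl
    · rw [belief_neg_eq μ, belief_neg_eq x, belief_neg_eq y, xa, ya, xz, yz, ← ha, ← hz]
      field_simp
      ring
    · rw [xz, yz, ← hz]
      field_simp
      rw [hd']
      ring
    · rw [belief_pos_eq μ, belief_pos_eq x, belief_pos_eq y, xa, ya, xz, yz, ← ha, ← hz]
      field_simp
      ring
  · intro v hv
    rw [support_atomic] at hv
    obtain ⟨m, -, rfl⟩ := hv
    have px : x 0 - z = σ * (meanState x - a) ∧ (1 - x 0) ^ 2 = meanState x ^ 2 := by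
      rw [xa, xz]
      constructor
      · field_simp
        rw [hd']
        ring
      · ring
    have py : y 0 - z = σ * (meanState y - a) ∧ (1 - y 0) ^ 2 = meanState y ^ 2 := by
      rw [ya, yz]
      constructor
      · field_simp
        rw [hd']
        ring
      · ring
    cases m
    · exact px
    · exact px
    · exact py

/-- Where binding exaggeration is feasible, it characterises the optimal attention outcomes. -/
theorem isOptimalOutcome_iff_onLine (hμ : ∀ θ, 0 < μ θ) (hκ : 1 / 2 < κ) (hκ2 : κ ≤ 2)
    (hex : ∃ q ∈ policies μ, OnLine μ (critSlope κ) q ∨ OnLine μ (-critSlope κ) q) :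
    IsOptimalOutcome μ κ q ↔
      q ∈ policies μ ∧ (OnLine μ (critSlope κ) q ∨ OnLine μ (-critSlope κ) q) := by
  have hκ0 : 0 < κ := by linarith
  have hs := critSlope_sq hκ0 hκ2
  have hs' : 3 * κ * (-critSlope κ) ^ 2 = 2 - κ := by rw [neg_sq]; exact hs
  have disc : ∀ q, OnLine μ (critSlope κ) q ∨ OnLine μ (-critSlope κ) q →
      Discernible κ q.support := by
    rintro q (h | h)
    · exact h.discernible hs
    · exact h.discernible hs'
  have val : ∀ q ∈ policies μ, OnLine μ (critSlope κ) q ∨ OnLine μ (-critSlope κ) q →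
      (4 * κ - 2) * ((∫ w, meanState w ^ 2 ∂q) - meanState μ ^ 2)
      = 3 * κ * ((1 - μ 0) ^ 2 - meanState μ ^ 2) := by
    rintro q hq (h | h)
    · exact h.integral_sq hs hq
    · exact h.integral_sq hs' hq
  have hpos : 0 < 4 * κ - 2 := by linarith
  rw [isOptimalOutcome_iff]
  constructor
  · rintro ⟨⟨hq, hd⟩, hopt⟩
    refine ⟨hq, ?_⟩
    obtain ⟨q₀, hq₀, hl₀⟩ := hex
    have h1 := hopt q₀ hq₀ (disc q₀ hl₀)
    have h2 := val q₀ hq₀ hl₀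
    obtain ⟨hle, heq⟩ := binding_bound hκ0 hq hd
    have h3 : (4 * κ - 2) * ((∫ w, meanState w ^ 2 ∂q) - meanState μ ^ 2)
      = 3 * κ * ((1 - μ 0) ^ 2 - meanState μ ^ 2) := by
      refine le_antisymm hle ?_
      rw [← h2]
      exact mul_le_mul_of_nonneg_left (by linarith) hpos.le
    obtain ⟨he, hsl⟩ := heq h3
    obtain ⟨x, y, hxy⟩ := exists_edgePair hμ hκ hq he hsl
    exact onLine_or_of_sq hκ0 hκ2 hq hxy
      (hsl x (by rw [hxy.support_eq]; simp) y (by rw [hxy.support_eq]; simp))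
  · rintro ⟨hq, hl⟩
    refine ⟨⟨hq, disc q hl⟩, fun q' hq' hd' => ?_⟩
    have h1 := (binding_bound hκ0 hq' hd').1
    rw [← val q hq hl] at h1
    linarith [le_of_mul_le_mul_left h1 hpos]

end OnLine

/-- An exaggeration that makes order-IC bind lies on a line with critical slope. -/
lemma onLine_of_orderICBinds {μ : Belief} (hμ : ∀ θ, 0 < μ θ) {κ : ℝ} (hκ : 0 < κ) (hκ2 : κ ≤ 2)
    {π : unitInterval} (h : OrderICBinds κ (exaggerate μ π)) :
    OnLine μ (critSlope κ) (exaggerate μ π) ∨ OnLine μ (-critSlope κ) (exaggerate μ π) := by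
  obtain ⟨x, y, hxy, -⟩ := exists_edgePair_exaggerate hμ π
  have hq := exaggerate_mem_policies μ π
  obtain ⟨hx, hy⟩ := hxy.sign hμ hq
  refine onLine_or_of_sq hκ hκ2 hq hxy ?_
  have := h.binds hκ (x := x) (y := y) (by rw [hxy.support_eq]; simp)
    (by rw [hxy.support_eq]; simp) (by linarith) (fun w hw => by
      rw [hxy.support_eq] at hw
      rcases hw with rfl | rfl
      · exact Or.inl rfl
      · exact Or.inr (Or.inl rfl))
  linarith

/-! ### Mixing downplaying with exaggeration -/

/-- The support consists of a belief at distance `l` from state `-1` on the left edge, a belief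
that is linked to it and to state `1` by lines of critical slope, and state `1`. -/
def Kinked (s l : ℝ) (q : Measure Belief) : Prop :=
  (∃ w ∈ q.support, meanState w = -1 + l) ∧
    ∀ w ∈ q.support, (meanState w = -1 + l ∧ w 0 = l) ∨
      (w 0 = s * (1 - meanState w) ∧ w 0 = l + s * (meanState w + 1 - l)) ∨
      (meanState w = 1 ∧ w 0 = 0)

section Kinked

variable {s l : ℝ} {q : Measure Belief} {μ : Belief}

/-- All pairs lie on lines of slope `± s`, except for the two ends, whose slope has absolute value
`l / (2 - l)`; this is where `hls` enters. -/
lemma Kinked.slope (h : Kinked s l q) (hs : 0 ≤ s) (hl : 0 ≤ l) (hls : l ≤ s * (2 - l))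
    (hl2 : l ≤ 2) :
    ∀ x ∈ q.support, ∀ y ∈ q.support, |x 0 - y 0| ≤ s * |meanState x - meanState y| := by
  have abs_of : ∀ u v : ℝ, u = s * v ∨ u = -(s * v) → |u| ≤ s * |v| := by
    rintro u v (e | e)
    · rw [e, abs_mul, abs_of_nonneg hs]
    · rw [e, abs_neg, abs_mul, abs_of_nonneg hs]
  have ends : |l - 0| ≤ s * |-1 + l - 1| := by
    rw [abs_of_nonneg (by linarith), abs_of_nonpos (by linarith)]
    linarith
  intro x hx y hy
  rcases h.2 x hx with ⟨e1, e2⟩ | ⟨e1, e2⟩ | ⟨e1, e2⟩ <;>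
    rcases h.2 y hy with ⟨f1, f2⟩ | ⟨f1, f2⟩ | ⟨f1, f2⟩
  · exact abs_of _ _ (Or.inl (by rw [e1, e2, f1, f2]; ring))
  · exact abs_of _ _ (Or.inl (by rw [e1, e2, f2]; ring))
  · rw [e1, e2, f1, f2]; exact ends
  · exact abs_of _ _ (Or.inl (by rw [f1, f2, e2]; ring))
  · exact abs_of _ _ (Or.inr (by rw [e1, f1]; ring))
  · exact abs_of _ _ (Or.inr (by rw [e1, f1, f2]; ring))
  · rw [e1, e2, f1, f2, abs_sub_comm, abs_sub_comm (1 : ℝ)]; exact ends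
  · exact abs_of _ _ (Or.inr (by rw [e1, e2, f1]; ring))
  · exact abs_of _ _ (Or.inl (by rw [e1, e2, f1, f2]; ring))

/-- Weighting the two line equations of the kink by the distances to the ends gives equality in the
second variance bound with `r = 0`. By `hB` its terms in `l` cancel, so the dispersion is the same
for every `l`. -/
lemma Kinked.integral_sq (h : Kinked s l q) (hq : q ∈ policies μ)
    (hB : 2 * s * (1 - meanState μ) = 1 - meanState μ + μ 0) :
    s * ∫ w, meanState w ^ 2 ∂q = s - μ 0 := by
  obtain ⟨hp, ha, hz⟩ := mem_policies_iff.1 hq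
  have h1 := integral_quadratic q (2 * s) 0 0 (l - 2 * s * l) (2 - l)
    (-l - 2 * s * (1 - l))
  rw [ha, hz, integral_eq_zero_of_ae] at h1
  · linear_combination (-1 / 2) * h1 - l / 2 * hB
  · filter_upwards [Measure.support_mem_ae (μ := q)] with w hw
    simp only [Pi.zero_apply]
    rcases h.2 w hw with ⟨e1, e2⟩ | ⟨e1, e2⟩ | ⟨e1, e2⟩
    · rw [e1, e2]; ring
    · linear_combination (1 - meanState w) * e2 + (meanState w + 1 - l) * e1
    · rw [e1, e2]; ring

lemma Kinked.peaked (h : Kinked s 0 q) (hs : 0 < s) : Peaked s q := by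
  intro w hw
  rcases h.2 w hw with ⟨e1, e2⟩ | ⟨e1, e2⟩ | ⟨e1, e2⟩
  · refine ⟨Or.inl (by linarith), ?_⟩
    rw [e1, e2]; ring
  · have h1 : s * (2 * meanState w) = 0 := by linarith
    have h2 : meanState w = 0 := by
      rcases mul_eq_zero.1 h1 with h | h <;> linarith
    refine ⟨Or.inr (Or.inl h2), ?_⟩
    rw [e1, h2]; ring
  · refine ⟨Or.inr (Or.inr e1), ?_⟩
    rw [e1, e2]; ring

lemma Kinked.le_meanState (h : Kinked s l q) (hs : 0 < s) (hls : l ≤ s * (2 - l)) (hl2 : l ≤ 2) :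
    ∀ w ∈ q.support, -1 + l ≤ meanState w := by
  intro w hw
  rcases h.2 w hw with ⟨e1, -⟩ | ⟨e1, e2⟩ | ⟨e1, -⟩
  · rw [e1]
  · have h1 : s * (2 * (meanState w + 1 - l)) = s * (2 - l) - l := by linarith
    by_contra hc
    push Not at hc
    have := mul_neg_of_pos_of_neg hs (by linarith : 2 * (meanState w + 1 - l) < 0)
    linarith
  · rw [e1]; linarith

/-- The leftmost action of the support is `-1 + l`, so the policy determines `l`. This tells the
members of the continuum apart. -/
lemma Kinked.eq {l' : ℝ} (h : Kinked s l q) (h' : Kinked s l' q) (hs : 0 < s)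
    (hls : l ≤ s * (2 - l)) (hl2 : l ≤ 2) (hls' : l' ≤ s * (2 - l')) (hl2' : l' ≤ 2) : l = l' := by
  obtain ⟨w, hw, e⟩ := h.1
  obtain ⟨w', hw', e'⟩ := h'.1
  have h1 := h.le_meanState hs hls hl2 w' hw'
  have h2 := h'.le_meanState hs hls' hl2' w hw
  linarith

end Kinked

/-- Probability that state `-1` reports `0` in the mixture with weight `ρ` on exaggeration. -/
lemma mixture_neg_mem {u z ρ : ℝ} (hu : 0 < u) (hz : 0 < z) (h0 : 0 ≤ ρ) (h1 : ρ ≤ 1) :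
    (1 - ρ) * z / (2 * (z + u)) ∈ unitInterval := by
  constructor
  · exact div_nonneg (mul_nonneg (by linarith) hz.le) (by linarith)
  · rw [div_le_one (by linarith)]
    nlinarith

/-- Probability that state `1` reports `0` in the mixture with weight `ρ` on exaggeration. -/
lemma mixture_pos_mem {u z v ρ : ℝ} (hu : 0 < u) (hz : 0 < z) (huv : u ≤ v) (h0 : 0 ≤ ρ)
    (h1 : ρ ≤ 1) :
    u ^ 2 * z * (1 - ρ) / (2 * (z + u) * (2 * ρ * z + u)) / v ∈ unitInterval := by
  have hv : 0 < v := by linarith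
  have hρz : 0 ≤ ρ * z := mul_nonneg h0 hz.le
  have hd : 0 < 2 * (z + u) * (2 * ρ * z + u) := mul_pos (by linarith) (by linarith)
  constructor
  · exact div_nonneg (div_nonneg (mul_nonneg (by positivity) (by linarith)) hd.le) hv.le
  · rw [div_le_one hv, div_le_iff₀ hd]
    have e1 : u ^ 2 * z * (1 - ρ) ≤ u ^ 2 * z := by
      have : 0 ≤ u ^ 2 * z := by positivity
      nlinarith
    have e2 : u * (2 * (z + u) * u) ≤ v * (2 * (z + u) * (2 * ρ * z + u)) := by
      gcongr
      nlinarith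
    nlinarith [pow_pos hu 3, mul_pos (pow_pos hu 2) hz]

/-- The mixture of downplaying and of exaggeration towards `-1` with weight `ρ`. -/
def mixture (μ : Belief) (hμ : ∀ θ, 0 < μ θ) (huv : μ (-1) ≤ μ 1) (ρ : unitInterval) :
    Measure Belief :=
  mixedPolicy μ (-1) ρ ⟨_, mixture_neg_mem (hμ (-1)) (hμ 0) ρ.2.1 ρ.2.2⟩
    ⟨_, mixture_pos_mem (hμ (-1)) (hμ 0) huv ρ.2.1 ρ.2.2⟩

/-- Distance of the leftmost belief of the mixture from state `-1`. -/
def mixtureDist (μ : Belief) (ρ : ℝ) : ℝ :=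
  μ 0 * ρ / (μ 0 * ρ + μ (-1) * (1 - (1 - ρ) * μ 0 / (2 * (μ 0 + μ (-1)))))

lemma mixture_left_pos {u z ρ : ℝ} (hu : 0 < u) (hz : 0 < z) (h0 : 0 ≤ ρ) :
    0 < 1 - (1 - ρ) * z / (2 * (z + u)) := by
  have h : (1 - ρ) * z / (2 * (z + u)) < 1 := by
    rw [div_lt_one (by linarith)]
    nlinarith
  linarith

/-- The reporting probabilities come from placing the posterior of message `0` on two critical
lines. The line to state `1` determines that of state `-1`, and the line to the left belief then
determines that of state `1`. By `hB`, `s` equals `(μ 0 + μ (-1)) / (μ 0 + 2 μ (-1))`. -/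
lemma kinked_mixture {μ : Belief} (hμ : ∀ θ, 0 < μ θ) (huv : μ (-1) ≤ μ 1) (ρ : unitInterval)
    {s : ℝ} (hB : 2 * s * (1 - meanState μ) = 1 - meanState μ + μ 0) :
    Kinked s (mixtureDist μ ρ) (mixture μ hμ huv ρ) := by
  have hu := hμ (-1)
  have hz := hμ 0
  have hv := hμ 1
  have h0 := ρ.2.1
  have h1 := ρ.2.2
  have hsum := belief_sum μ
  have hs : s = (μ 0 + μ (-1)) / (μ 0 + 2 * μ (-1)) := by
    rw [eq_div_iff (by linarith)]
    rw [meanState_eq] at hB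
    have : μ 1 = 1 - μ 0 - μ (-1) := by linarith
    rw [this] at hB
    linarith
  have hlp := mixture_left_pos hu hz h0
  set πm : unitInterval := ⟨_, mixture_neg_mem hu hz ρ.2.1 ρ.2.2⟩ with hπm
  set πp : unitInterval := ⟨_, mixture_pos_mem hu hz huv ρ.2.1 ρ.2.2⟩ with hπp
  have vm : (πm : ℝ) = (1 - ρ) * μ 0 / (2 * (μ 0 + μ (-1))) := rfl
  have vp : μ 1 * (πp : ℝ)
      = μ (-1) ^ 2 * μ 0 * (1 - ρ) / (2 * (μ 0 + μ (-1)) * (2 * ρ * μ 0 + μ (-1))) := by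
    change μ 1 * (_ / μ 1) = _
    rw [mul_div_cancel₀ _ hv.ne']
  set σ : State → Belief := fun
    | .zero => lottery ρ (-1) 0
    | .neg => lottery πm 0 (-1)
    | .pos => lottery πp 0 1 with hσ
  have e0 : ∀ m, σ 0 m = ρ * (if m = -1 then 1 else 0) + (1 - ρ) * (if m = 0 then 1 else 0) :=
    fun m => lottery_apply ρ (-1) 0 m
  have em : ∀ m, σ (-1) m = πm * (if m = 0 then 1 else 0) + (1 - πm) * (if m = -1 then 1 else 0) :=
    fun m => lottery_apply πm 0 (-1) m
  have ep : ∀ m, σ 1 m = πp * (if m = 0 then 1 else 0) + (1 - πp) * (if m = 1 then 1 else 0) :=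
    fun m => lottery_apply πp 0 1 m
  have hsup : (mixture μ hμ huv ρ).support = _ := support_induced μ σ
  have wm : msgProb μ σ (-1) = μ 0 * ρ + μ (-1) * (1 - πm) := by
    rw [msgProb_eq, e0, em, ep]; simp
  have w0 : msgProb μ σ 0 = μ 0 * (1 - ρ) + μ (-1) * πm + μ 1 * πp := by
    rw [msgProb_eq, e0, em, ep]; simp
  have pm : 0 < msgProb μ σ (-1) := by
    rw [wm, vm]
    have := mul_pos hu hlp
    have := mul_nonneg hz.le h0
    linarith
  have hl : mixtureDist μ ρ = μ 0 * ρ / msgProb μ σ (-1) := by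
    rw [wm, vm, mixtureDist]
  have la : meanState (posterior μ σ (-1)) = -1 + mixtureDist μ ρ := by
    rw [meanState_posterior pm.ne', hl, em, ep]
    field_simp
    rw [wm]
    simp
  have lz : posterior μ σ (-1) 0 = mixtureDist μ ρ := by
    rw [posterior_apply pm.ne', hl, e0]
    simp
  refine ⟨⟨_, hsup ▸ ⟨-1, pm, rfl⟩, la⟩, ?_⟩
  rw [hsup]
  rintro w ⟨m, hm, rfl⟩
  rcases SignType.trichotomy m with rfl | rfl | rfl
  · exact Or.inl ⟨la, lz⟩
  · have ma : meanState (posterior μ σ 0) = (μ 1 * πp - μ (-1) * πm) / msgProb μ σ 0 := by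
      rw [meanState_posterior hm.ne', em, ep]; simp
    have mz : posterior μ σ 0 0 = μ 0 * (1 - ρ) / msgProb μ σ 0 := by
      rw [posterior_apply hm.ne', e0]; simp
    have hE : 0 < 2 * (ρ : ℝ) * μ 0 + μ (-1) := by
      have := mul_nonneg h0 hz.le
      linarith
    have hD : 0 < μ 0 + μ (-1) := by linarith
    have hF : 0 < μ 0 + 2 * μ (-1) := by linarith
    refine Or.inr (Or.inl ⟨?_, ?_⟩)
    · rw [ma, mz]
      have key : μ 0 * (1 - ρ) = s * (msgProb μ σ 0 - (μ 1 * πp - μ (-1) * πm)) := by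
        rw [w0, hs, vm]
        field_simp
        ring
      rw [key]
      field_simp
    · rw [ma, mz, hl]
      have key : μ 0 * (1 - ρ) * msgProb μ σ (-1) = μ 0 * ρ * msgProb μ σ 0
          + s * ((μ 1 * πp - μ (-1) * πm) * msgProb μ σ (-1)
            + msgProb μ σ 0 * (msgProb μ σ (-1) - μ 0 * ρ)) := by
        rw [w0, wm, vp, vm, hs]
        field_simp
        ring
      have := hm.ne'
      have := pm.ne'
      field_simp
      linear_combination key
  · right; right
    have : posterior μ σ 1 = point 1 := by
      refine belief_eq_point_pos ?_ ?_
      · rw [posterior_apply hm.ne', e0]; simp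
      · rw [posterior_apply hm.ne', em]; simp
    rw [this, meanState_point, point_zero_of_ne (by decide)]
    simp

lemma mixture_one {μ : Belief} (hμ : ∀ θ, 0 < μ θ) (huv : μ (-1) ≤ μ 1) :
    mixture μ hμ huv 1 = exaggerate μ 1 := by
  rw [mixture, mixedPolicy, exaggerate]
  congr 1
  funext θ
  apply stdSimplex.ext
  funext m
  cases θ
  · change lottery 1 (-1) 0 m = lottery 1 (-1) 1 m
    rw [lottery_apply, lottery_apply]; simp
  · change lottery _ 0 (-1) m = point (-1) m
    rw [lottery_apply, point_apply]; simp
  · change lottery _ 0 1 m = point 1 m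
    rw [lottery_apply, point_apply]; simp

/-! ### Bounds and injectivity for the mixture family -/

section Family

variable {μ : Belief} {s : ℝ}

lemma mixtureDist_bounds (hμ : ∀ θ, 0 < μ θ)
    (hB : 2 * s * (1 - meanState μ) = 1 - meanState μ + μ 0) (ρ : unitInterval) :
    0 ≤ mixtureDist μ ρ ∧ mixtureDist μ ρ ≤ s * (2 - mixtureDist μ ρ) ∧ mixtureDist μ ρ ≤ 2 := by
  have hu := hμ (-1)
  have hz := hμ 0
  have h0 := ρ.2.1
  have h1 := ρ.2.2
  have hs : s * (μ 0 + 2 * μ (-1)) = μ 0 + μ (-1) := by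
    have hsum := belief_sum μ
    rw [meanState_eq] at hB
    have : μ 1 = 1 - μ 0 - μ (-1) := by linarith
    rw [this] at hB
    linarith
  have hlp := mul_pos hu (mixture_left_pos hu hz h0)
  have hn := mul_nonneg hz.le h0
  have e1 : 2 * (μ 0 + μ (-1)) * (μ (-1) * (1 - (1 - ρ) * μ 0 / (2 * (μ 0 + μ (-1)))))
      = μ (-1) * (2 * (μ 0 + μ (-1)) - (1 - ρ) * μ 0) := by
    have : μ 0 + μ (-1) ≠ 0 := by linarith
    field_simp
  rw [mixtureDist]
  set n := μ (-1) * (1 - (1 - (ρ : ℝ)) * μ 0 / (2 * (μ 0 + μ (-1))))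
  have hW : 0 < μ 0 * ρ + n := by linarith
  have hle : μ 0 * ρ / (μ 0 * ρ + n) ≤ 1 := by rw [div_le_one hW]; linarith
  refine ⟨div_nonneg hn hW.le, ?_, by linarith⟩
  rw [show 2 - μ 0 * (ρ : ℝ) / (μ 0 * ρ + n) = (μ 0 * ρ + 2 * n) / (μ 0 * ρ + n) by
    field_simp; ring, ← mul_div_assoc, div_le_div_iff_of_pos_right hW]
  refine le_of_mul_le_mul_left ?_ (by linarith : 0 < μ 0 + 2 * μ (-1))
  have e2 : (μ 0 + 2 * μ (-1)) * (s * (μ 0 * ρ + 2 * n))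
      = (μ 0 + μ (-1)) * (μ 0 * ρ) + 2 * (μ 0 + μ (-1)) * n := by
    rw [← hs]; ring
  rw [e2, e1]
  nlinarith [mul_pos hu hu, mul_pos hu hz]

lemma mixtureDist_zero : mixtureDist μ (0 : unitInterval) = 0 := by
  simp [mixtureDist]

/-- The distance is a fractional linear function of `ρ` with determinant `μ 0 * μ (-1) * (1 - g)`,
which is nonzero because `g < 1`. -/
lemma mixtureDist_injective (hμ : ∀ θ, 0 < μ θ) {ρ ρ' : unitInterval}
    (h : mixtureDist μ ρ = mixtureDist μ ρ') : ρ = ρ' := by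
  have hu := hμ (-1)
  have hz := hμ 0
  have hlp := mul_pos hu (mixture_left_pos hu hz ρ.2.1)
  have hn := mul_nonneg hz.le ρ.2.1
  have hlp' := mul_pos hu (mixture_left_pos hu hz ρ'.2.1)
  have hn' := mul_nonneg hz.le ρ'.2.1
  have hg : μ 0 / (2 * (μ 0 + μ (-1))) < 1 := by rw [div_lt_one (by linarith)]; linarith
  have e : ∀ r : ℝ, (1 - r) * μ 0 / (2 * (μ 0 + μ (-1)))
      = (1 - r) * (μ 0 / (2 * (μ 0 + μ (-1)))) := fun r => mul_div_assoc _ _ _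
  rw [e] at hlp hlp'
  simp only [mixtureDist, e] at h
  set g := μ 0 / (2 * (μ 0 + μ (-1)))
  rw [div_eq_div_iff (by linarith) (by linarith)] at h
  have h1 : μ 0 * μ (-1) * (1 - g) * ((ρ : ℝ) - ρ') = 0 := by linear_combination h
  have h2 : μ 0 * μ (-1) * (1 - g) ≠ 0 := (mul_pos (mul_pos hz hu) (by linarith)).ne'
  exact Subtype.ext (by linarith [(mul_eq_zero.1 h1).resolve_left h2])

end Family

/-! ### Downplaying: optimality -/

section Optimality

variable {μ : Belief} {κ : ℝ} {q : Measure Belief}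

/-- Stated by slope and value alone, so that it serves both binding downplaying and the mixtures at
the second threshold. -/
lemma isOptimalOutcome_of_slope (hκ : 0 < κ) (hκ2 : κ ≤ 2)
    (hs0 : 0 < critSlope κ) (hs1 : critSlope κ < 1)
    (hA : 1 + meanState μ + μ 0 ≤ 2 * critSlope κ * (1 + meanState μ))
    (hB : 1 - meanState μ + μ 0 ≤ 2 * critSlope κ * (1 - meanState μ)) (hq : q ∈ policies μ)
    (hsl : ∀ x ∈ q.support, ∀ y ∈ q.support,
      |x 0 - y 0| ≤ critSlope κ * |meanState x - meanState y|)
    (hval : critSlope κ * ∫ w, meanState w ^ 2 ∂q = critSlope κ - μ 0) :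
    IsOptimalOutcome μ κ q := by
  rw [isOptimalOutcome_iff]
  refine ⟨⟨hq, (discernible_iff hκ hκ2).2 hsl⟩, fun q' hq' hd => ?_⟩
  have h := downplay_bound hq' ((discernible_iff hκ hκ2).1 hd) hs1 hA hB
  rw [← hval] at h
  exact le_of_mul_le_mul_left h hs0

lemma peaked_of_isOptimalOutcome (hκ : 0 < κ) (hκ2 : κ ≤ 2) (hs0 : 0 < critSlope κ)
    (hs1 : critSlope κ < 1)
    (hA : 1 + meanState μ + μ 0 < 2 * critSlope κ * (1 + meanState μ))
    (hB : 1 - meanState μ + μ 0 < 2 * critSlope κ * (1 - meanState μ))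
    (hex : ∃ q ∈ policies μ, Peaked (critSlope κ) q) (h : IsOptimalOutcome μ κ q) :
    Peaked (critSlope κ) q := by
  obtain ⟨⟨hq, hd⟩, hopt⟩ := isOptimalOutcome_iff.1 h
  obtain ⟨q₀, hq₀, hp₀⟩ := hex
  have hsl := (discernible_iff hκ hκ2).1 hd
  have h1 := hopt q₀ hq₀ ((discernible_iff hκ hκ2).2 (hp₀.slope hs0.le))
  have h2 := hp₀.integral_sq hq₀
  have h3 := downplay_bound hq hsl hs1 hA.le hB.le
  have h4 := mul_le_mul_of_nonneg_left h1 hs0.le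
  intro w hw
  obtain ⟨e1, e2⟩ := downplay_bound_eq hq hsl hs1 hA hB (by linarith) w hw
  refine ⟨?_, e1⟩
  have b1 := meanState_le w
  have b2 := neg_meanState_le w
  have b3 := belief_nonneg w 0
  -- The parabola `s (1 - a²)` has to stay below the tent `s (1 - |a|)`; on `[-1, 1]` it does so
  -- only at `-1`, `0` and `1`.
  have h5 : |meanState w| ≤ meanState w ^ 2 := by
    rw [e1] at e2
    linarith [le_of_mul_le_mul_left e2 hs0]
  rw [← sq_abs] at h5
  have h6 : |meanState w| ≤ 1 := abs_le.2 ⟨by linarith, by linarith⟩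
  have h7 : |meanState w| * (1 - |meanState w|) = 0 := by
    have := abs_nonneg (meanState w)
    nlinarith
  rcases mul_eq_zero.1 h7 with h | h
  · exact Or.inr (Or.inl (abs_eq_zero.1 h))
  · rcases eq_or_eq_neg_of_abs_eq (by linarith : |meanState w| = 1) with h | h
    · exact Or.inr (Or.inr h)
    · exact Or.inl h

/-! ### Full revelation and no information -/

lemma posterior_point (hμ : ∀ θ, 0 < μ θ) (m : State) : posterior μ point m = point m := by
  have hp : msgProb μ point m = μ m := by
    rw [msgProb]
    rw [Finset.sum_eq_single m]
    · rw [point_apply, if_pos rfl, mul_one]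
    · intro θ _ hne
      rw [point_apply, if_neg hne.symm, mul_zero]
    · intro h; exact absurd (Finset.mem_univ m) h
  apply stdSimplex.ext
  funext θ
  change posterior μ point m θ = point m θ
  rw [posterior_apply (by rw [hp]; exact (hμ m).ne'), hp, point_apply, point_apply]
  by_cases h : θ = m
  · subst h
    rw [if_pos rfl, mul_one, div_self (hμ θ).ne']
  · rw [if_neg h, if_neg (Ne.symm h), mul_zero, zero_div]

lemma peaked_fullInfo (hμ : ∀ θ, 0 < μ θ) : Peaked 1 (fullInfo μ) := by
  intro w hw
  rw [fullInfo, support_induced] at hw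
  obtain ⟨m, -, rfl⟩ := hw
  rw [posterior_point hμ, meanState_point, point_apply]
  rcases SignType.trichotomy m with rfl | rfl | rfl <;> simp

/-- Full revelation is optimal if and only if attention is cheap. -/
lemma isOptimalOutcome_iff_fullInfo (hμ : ∀ θ, 0 < μ θ) (hκ : 0 < κ) (hκ2 : κ ≤ 2)
    (hs : 1 ≤ critSlope κ) : IsOptimalOutcome μ κ q ↔ q = fullInfo μ := by
  have hf : fullInfo μ ∈ policies μ := induced_mem_policies _ _
  have hpk := peaked_fullInfo hμ
  have hval : ∫ w, meanState w ^ 2 ∂(fullInfo μ) = 1 - μ 0 := by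
    have := hpk.integral_sq hf
    linarith
  have hdisc : Discernible κ (fullInfo μ).support := by
    rw [discernible_iff hκ hκ2]
    intro x hx y hy
    refine (hpk.slope zero_le_one x hx y hy).trans ?_
    gcongr
  constructor
  · intro h
    obtain ⟨⟨hq, hd⟩, hopt⟩ := isOptimalOutcome_iff.1 h
    obtain ⟨hle, heq⟩ := sq_integral_le hq
    have h1 := hopt _ hf hdisc
    have h2 := heq (by linarith)
    refine Peaked.eq one_pos le_rfl (fun w hw => ?_) hq hpk hf
    have e := h2 w hw
    have b1 := meanState_le w
    have b2 := neg_meanState_le w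
    have b3 := belief_nonneg w 0
    refine ⟨?_, by linarith⟩
    have hz : w 0 * (1 - w 0) = 0 := by nlinarith
    rcases mul_eq_zero.1 hz with h | h
    · rw [h] at e
      have e' : (meanState w - 1) * (meanState w + 1) = 0 := by linarith
      rcases mul_eq_zero.1 e' with h | h
      · right; right; linarith
      · left; linarith
    · right; left
      have : meanState w ^ 2 = 0 := by linarith
      exact pow_eq_zero_iff two_ne_zero |>.1 this
  · rintro rfl
    rw [isOptimalOutcome_iff]
    refine ⟨⟨hf, hdisc⟩, fun q' hq' _ => ?_⟩
    rw [hval]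
    exact (sq_integral_le hq').1

lemma noInfo_mem_policies : noInfo μ ∈ policies μ :=
  ⟨by rw [noInfo]; infer_instance, fun θ => by rw [noInfo, integral_dirac]⟩

/-- With very costly attention, only the absence of information is incentive compatible. -/
lemma isOptimalOutcome_iff_noInfo (hκ : 2 < κ) : IsOptimalOutcome μ κ q ↔ q = noInfo μ := by
  have hsupp : (noInfo μ).support ⊆ {μ} := by
    refine Measure.support_subset_of_isClosed isClosed_singleton ?_
    rw [noInfo, mem_ae_iff, Measure.dirac_apply' _ (measurableSet_singleton μ).compl]
    simp
  have hdisc : Discernible κ (noInfo μ).support := by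
    intro x hx y hy
    rw [hsupp hx, hsupp hy, beliefDist_sq]
    simp
  -- For `κ > 2` the inequality `3κ (Δz)² ≤ (2 - κ) (Δa)²` makes both differences vanish, so the
  -- support is a single belief, which must be the mean.
  have key : ∀ q, q ∈ policies μ → Discernible κ q.support → q = noInfo μ := by
    intro q hq hd
    have hsing : ∀ x ∈ q.support, ∀ y ∈ q.support, x = y := by
      intro x hx y hy
      have h := hd.two_mul hx hy
      have h1 := mul_nonneg (by linarith : 0 ≤ 3 * κ) (sq_nonneg (x 0 - y 0))
      have h2 := mul_nonneg (by linarith : 0 ≤ κ - 2) (sq_nonneg (meanState x - meanState y))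
      have h3 : 3 * κ * (x 0 - y 0) ^ 2 = 0 := by linarith
      have h4 : (κ - 2) * (meanState x - meanState y) ^ 2 = 0 := by linarith
      have h5 := pow_eq_zero_iff two_ne_zero |>.1 ((mul_eq_zero.1 h3).resolve_left (by linarith))
      have h6 := pow_eq_zero_iff two_ne_zero |>.1 ((mul_eq_zero.1 h4).resolve_left (by linarith))
      exact belief_ext (by linarith) (by linarith)
    have := hq.1
    obtain ⟨x, hx⟩ := Measure.nonempty_support (IsProbabilityMeasure.ne_zero q)
    have h1 := support_line hq (α := 1) (β := 0) (γ := -meanState x) (fun w hw => by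
      rw [hsing w hw x hx]; ring)
    have h2 := support_line hq (α := 0) (β := 1) (γ := -x 0) (fun w hw => by
      rw [hsing w hw x hx]; ring)
    have hxμ : x = μ := belief_ext (by linarith) (by linarith)
    refine policy_ext hq noInfo_mem_policies (S := {μ}) ?_ (by simpa using hsupp) ?_
    · intro w hw
      rw [hsing w hw x hx, hxμ]; simp
    · intro y hy
      refine ⟨0, 0, 1, by norm_num, fun w hw hne => ?_⟩
      rw [Finset.mem_singleton] at hy hw
      exact absurd (hw.trans hy.symm) hne
  rw [isOptimalOutcome_iff]
  constructor
  · rintro ⟨⟨hq, hd⟩, -⟩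
    exact key q hq hd
  · rintro rfl
    refine ⟨⟨noInfo_mem_policies, hdisc⟩, fun q' hq' hd => ?_⟩
    rw [key q' hq' hd]

end Optimality

/-! ### Cost regimes -/

section Regimes

variable {μ : Belief} {κ : ℝ}

lemma zero_lt_one_sub_abs (hμ : ∀ θ, 0 < μ θ) : μ 0 < 1 - |meanState μ| := by
  have hm := hμ (-1)
  have hp := hμ 1
  rw [belief_neg_eq] at hm
  rw [belief_pos_eq] at hp
  have : |meanState μ| < 1 - μ 0 := abs_lt.2 ⟨by linarith, by linarith⟩
  linarith

lemma kappa1_lt_kappa2 (hμ : ∀ θ, 0 < μ θ) : kappa1 < kappa2 μ := by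
  have h := zero_lt_one_sub_abs hμ
  have hz := hμ 0
  rw [kappa1_eq, kappa2_eq]
  refine threshold_lt (div_pos (by linarith) (by linarith)) ?_
  rw [div_lt_one (by linarith)]
  linarith

lemma kappa2_lt_kappa3 (hμ : ∀ θ, 0 < μ θ) : kappa2 μ < kappa3 μ := by
  have h := zero_lt_one_sub_abs hμ
  have hz := hμ 0
  rw [kappa2_eq, kappa3]
  refine threshold_lt (div_pos hz (by linarith)) ?_
  rw [div_lt_div_iff₀ (by linarith) (by linarith)]
  nlinarith

lemma threshold_lt_two {T : ℝ} (hT : 0 < T) : 2 / (3 * T ^ 2 + 1) < 2 := by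
  rw [div_lt_iff₀ (by positivity)]
  nlinarith [pow_pos hT 2]

lemma kappa3_lt_kappa4 (hμ : ∀ θ, 0 < μ θ) : kappa3 μ < kappa4 := by
  have h := zero_lt_one_sub_abs hμ
  exact threshold_lt_two (div_pos (hμ 0) (by linarith [hμ 0]))

lemma le_kappa1_iff (hκ : 0 < κ) : κ ≤ kappa1 ↔ 1 ≤ critSlope κ := by
  rw [kappa1_eq, le_threshold_iff hκ one_pos]

lemma le_kappa2_iff (hμ : ∀ θ, 0 < μ θ) (hκ : 0 < κ) : κ ≤ kappa2 μ ↔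
    1 - |meanState μ| + μ 0 ≤ 2 * critSlope κ * (1 - |meanState μ|) := by
  have h := zero_lt_one_sub_abs hμ
  have hz := hμ 0
  rw [kappa2_eq, le_threshold_iff hκ (div_pos (by linarith) (by linarith)),
    div_le_iff₀ (by linarith)]
  constructor <;> intro h <;> linarith

lemma lt_kappa2_iff (hμ : ∀ θ, 0 < μ θ) (hκ : 0 < κ) : κ < kappa2 μ ↔
    1 - |meanState μ| + μ 0 < 2 * critSlope κ * (1 - |meanState μ|) := by
  have h := zero_lt_one_sub_abs hμ
  have hz := hμ 0
  rw [kappa2_eq, lt_threshold_iff hκ (div_pos (by linarith) (by linarith)),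
    div_lt_iff₀ (by linarith)]
  constructor <;> intro h <;> linarith

lemma le_kappa3_iff (hμ : ∀ θ, 0 < μ θ) (hκ : 0 < κ) : κ ≤ kappa3 μ ↔
    μ 0 ≤ critSlope κ * (1 - |meanState μ|) := by
  have h := zero_lt_one_sub_abs hμ
  have hz := hμ 0
  rw [kappa3, le_threshold_iff hκ (div_pos (by linarith) (by linarith)), div_le_iff₀ (by linarith)]

lemma lt_kappaTwo_iff (hμ : ∀ θ, 0 < μ θ) (hκ : 0 < κ) : κ < kappaTwo μ ↔
    μ 0 < critSlope κ * (1 + |meanState μ|) := by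
  have hz := hμ 0
  have ha := abs_nonneg (meanState μ)
  rw [kappaTwo, lt_threshold_iff hκ (div_pos (by linarith) (by linarith)),
    div_lt_iff₀ (by linarith)]

lemma kappa3_lt_kappaTwo (hμ : ∀ θ, 0 < μ θ) (h0 : meanState μ ≠ 0) : kappa3 μ < kappaTwo μ := by
  have h := zero_lt_one_sub_abs hμ
  have hz := hμ 0
  have ha := abs_pos.2 h0
  refine threshold_lt (div_pos hz (by linarith)) ?_
  exact div_lt_div_of_pos_left hz (by linarith) (by linarith)

/-- The slope conditions under which downplaying is optimal. -/
lemma downplay_regime (hμ : ∀ θ, 0 < μ θ) (hκ : 0 < κ) (h1 : kappa1 < κ) (h2 : κ ≤ kappa2 μ) :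
    κ ≤ 2 ∧ 0 < critSlope κ ∧ critSlope κ < 1 ∧ μ 0 < critSlope κ * (1 + meanState μ) ∧
      μ 0 < critSlope κ * (1 - meanState μ) ∧
      1 + meanState μ + μ 0 ≤ 2 * critSlope κ * (1 + meanState μ) ∧
      1 - meanState μ + μ 0 ≤ 2 * critSlope κ * (1 - meanState μ) := by
  have hz := hμ 0
  have hm := zero_lt_one_sub_abs hμ
  have hκ2 : κ ≤ 2 :=
    h2.trans ((kappa2_lt_kappa3 hμ).trans (kappa3_lt_kappa4 hμ)).le
  have hs1 : critSlope κ < 1 := not_le.1 fun h => absurd ((le_kappa1_iff hκ).2 h) (not_le.2 h1)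
  have hc := (le_kappa2_iff hμ hκ).1 h2
  -- Since `2s > 1`, the quantity `2sA - A` increases in `A`, and the condition at `1 - |a_μ|`, the
  -- smaller of `1 ± a_μ`, implies it at both.
  have hs0 : 0 < 2 * critSlope κ - 1 := by
    by_contra hn
    push Not at hn
    nlinarith
  have key : ∀ A : ℝ, 1 - |meanState μ| ≤ A → A + μ 0 ≤ 2 * critSlope κ * A := by
    intro A hA
    nlinarith
  have eA : 1 - |meanState μ| ≤ 1 + meanState μ := by linarith [neg_abs_le (meanState μ)]
  have eB : 1 - |meanState μ| ≤ 1 - meanState μ := by linarith [le_abs_self (meanState μ)]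
  have kA := key _ eA
  have kB := key _ eB
  exact ⟨hκ2, by linarith, hs1, by linarith, by linarith, kA, kB⟩

lemma downplay_regime_strict (hμ : ∀ θ, 0 < μ θ) (hκ : 0 < κ) (h2 : κ < kappa2 μ) :
    1 + meanState μ + μ 0 < 2 * critSlope κ * (1 + meanState μ) ∧
      1 - meanState μ + μ 0 < 2 * critSlope κ * (1 - meanState μ) := by
  have hz := hμ 0
  have hm := zero_lt_one_sub_abs hμ
  have hc := (lt_kappa2_iff hμ hκ).1 h2
  have hs0 : 0 < 2 * critSlope κ - 1 := by
    by_contra hn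
    push Not at hn
    nlinarith
  have key : ∀ A : ℝ, 1 - |meanState μ| ≤ A → A + μ 0 < 2 * critSlope κ * A := by
    intro A hA
    nlinarith
  exact ⟨key _ (by linarith [neg_abs_le (meanState μ)]),
    key _ (by linarith [le_abs_self (meanState μ)])⟩

variable {q : Measure Belief}

lemma isOptimalOutcome_of_peaked (hμ : ∀ θ, 0 < μ θ) (hκ : 0 < κ) (h1 : kappa1 < κ)
    (h2 : κ ≤ kappa2 μ) (hq : q ∈ policies μ) (h : Peaked (critSlope κ) q) :
    IsOptimalOutcome μ κ q := by
  obtain ⟨hκ2, hs0, hs1, -, -, hA, hB⟩ := downplay_regime hμ hκ h1 h2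
  exact isOptimalOutcome_of_slope hκ hκ2 hs0 hs1 hA hB hq (h.slope hs0.le) (h.integral_sq hq)

lemma isOptimalOutcome_iff_peaked (hμ : ∀ θ, 0 < μ θ) (hκ : 0 < κ) (h1 : kappa1 < κ)
    (h2 : κ < kappa2 μ) : IsOptimalOutcome μ κ q ↔ q ∈ policies μ ∧ Peaked (critSlope κ) q := by
  obtain ⟨hκ2, hs0, hs1, hzA, hzB, -, -⟩ := downplay_regime hμ hκ h1 h2.le
  obtain ⟨hA, hB⟩ := downplay_regime_strict hμ hκ h2
  refine ⟨fun h => ⟨(isOptimalOutcome_iff.1 h).1.1, ?_⟩,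
    fun h => isOptimalOutcome_of_peaked hμ hκ h1 h2.le h.1 h.2⟩
  exact peaked_of_isOptimalOutcome hκ hκ2 hs0 hs1 hA hB
    (exists_peaked hμ hs0 hs1.le hzA hzB) h

lemma existsUnique_of_lt_kappa2 (hμ : ∀ θ, 0 < μ θ) (hκ : 0 < κ) (h2 : κ < kappa2 μ) :
    ∃! q, IsOptimalOutcome μ κ q := by
  have hκ2 : κ ≤ 2 :=
    (h2.trans ((kappa2_lt_kappa3 hμ).trans (kappa3_lt_kappa4 hμ))).le
  rcases le_or_gt κ kappa1 with h1 | h1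
  · have hiff := fun q => isOptimalOutcome_iff_fullInfo (q := q) hμ hκ hκ2 ((le_kappa1_iff hκ).1 h1)
    exact ⟨fullInfo μ, (hiff _).2 rfl, fun q hq => (hiff q).1 hq⟩
  · obtain ⟨-, hs0, hs1, hzA, hzB, -, -⟩ := downplay_regime hμ hκ h1 h2.le
    obtain ⟨q, hq, hp⟩ := exists_peaked hμ hs0 hs1.le hzA hzB
    refine ⟨q, (isOptimalOutcome_iff_peaked hμ hκ h1 h2).2 ⟨hq, hp⟩, fun q' hq' => ?_⟩
    obtain ⟨hq'μ, hp'⟩ := (isOptimalOutcome_iff_peaked hμ hκ h1 h2).1 hq'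
    exact hp'.eq hs0 hs1.le hq'μ hp hq

/-- The slope conditions under which separating exaggeration is optimal. -/
lemma separating_regime (hμ : ∀ θ, 0 < μ θ) (hκ : 0 < κ) (h2 : kappa2 μ ≤ κ) (h3 : κ ≤ kappa3 μ) :
    κ ≤ 2 ∧ 2 * critSlope κ * (1 - |meanState μ|) ≤ 1 - |meanState μ| + μ 0 ∧
      (κ ≠ kappa2 μ → 2 * critSlope κ * (1 - |meanState μ|) < 1 - |meanState μ| + μ 0) ∧
      μ 0 ≤ critSlope κ * (1 - |meanState μ|) := by
  refine ⟨h3.trans (kappa3_lt_kappa4 hμ).le, ?_, fun hne => ?_, (le_kappa3_iff hμ hκ).1 h3⟩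
  · by_contra hc
    exact absurd ((lt_kappa2_iff hμ hκ).2 (not_le.1 hc)) (not_lt.2 h2)
  · by_contra hc
    exact hne (le_antisymm ((le_kappa2_iff hμ hκ).2 (not_lt.1 hc)) h2)

lemma isOptimalOutcome_one_of_regime (hμ : ∀ θ, 0 < μ θ) (hκ : 0 < κ) (h2 : kappa2 μ ≤ κ)
    (h3 : κ ≤ kappa3 μ) (ha : 0 ≤ meanState μ) : IsOptimalOutcome μ κ (exaggerate μ 1) := by
  obtain ⟨hκ2, hB, -, ht⟩ := separating_regime hμ hκ h2 h3
  rw [abs_of_nonneg ha] at hB ht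
  exact isOptimalOutcome_exaggerate_one hμ hκ hκ2 ha hB ht

lemma isOptimalOutcome_zero_of_regime (hμ : ∀ θ, 0 < μ θ) (hκ : 0 < κ) (h2 : kappa2 μ ≤ κ)
    (h3 : κ ≤ kappa3 μ) (ha : meanState μ ≤ 0) : IsOptimalOutcome μ κ (exaggerate μ 0) := by
  obtain ⟨hκ2, hB, -, ht⟩ := separating_regime hμ hκ h2 h3
  rw [abs_of_nonpos ha, sub_neg_eq_add] at hB ht
  exact isOptimalOutcome_exaggerate_zero hμ hκ hκ2 ha hB ht

/-- Outside the second threshold, only separating exaggerations are optimal in this regime. -/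
lemma eq_exaggerate_of_regime (hμ : ∀ θ, 0 < μ θ) (hκ : 0 < κ) (h2 : kappa2 μ ≤ κ)
    (h3 : κ ≤ kappa3 μ) (hne : κ ≠ kappa2 μ) (h : IsOptimalOutcome μ κ q) :
    q = exaggerate μ 0 ∨ q = exaggerate μ 1 := by
  obtain ⟨hκ2, -, hlt, ht⟩ := separating_regime hμ hκ h2 h3
  have hlt := hlt hne
  obtain ⟨⟨hq, hd⟩, hopt⟩ := isOptimalOutcome_iff.1 h
  have hsl := (discernible_iff hκ hκ2).1 hd
  have finish : (∃ x y, EdgePair q x y ∧ (meanState x = -1 ∨ meanState y = 1)) →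
      q = exaggerate μ 0 ∨ q = exaggerate μ 1 := by
    rintro ⟨x, y, hxy, h | h⟩
    · exact Or.inl (hxy.eq_exaggerate_zero hμ hq h)
    · exact Or.inr (hxy.eq_exaggerate_one hμ hq h)
  have hz := hμ 0
  have hzm := zero_lt_one_sub_abs hμ
  apply finish
  rcases le_total 0 (meanState μ) with ha | ha
  · have h1 := (isOptimalOutcome_iff.1 (isOptimalOutcome_one_of_regime hμ hκ h2 h3 ha)).1
    have h4 := hopt _ h1.1 h1.2
    have h5 := integral_sq_exaggerate_one hμ
    rw [abs_of_nonneg ha] at hlt hzm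
    have h6 := exaggerate_bound_right hμ hq hsl ha hlt.le
    refine exaggerate_bound_right_eq hμ hq hsl ha hlt (le_antisymm h6 ?_)
    rw [← h5]
    exact mul_le_mul_of_nonneg_left h4 (by linarith)
  · have h1 := (isOptimalOutcome_iff.1 (isOptimalOutcome_zero_of_regime hμ hκ h2 h3 ha)).1
    have h4 := hopt _ h1.1 h1.2
    have h5 := integral_sq_exaggerate_zero hμ
    rw [abs_of_nonpos ha, sub_neg_eq_add] at hlt hzm
    have h6 := exaggerate_bound_left hμ hq hsl ha hlt.le
    refine exaggerate_bound_left_eq hμ hq hsl ha hlt (le_antisymm h6 ?_)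
    rw [← h5]
    exact mul_le_mul_of_nonneg_left h4 (by linarith)

lemma exaggerate_one_iff_of_regime (hμ : ∀ θ, 0 < μ θ) (hκ : 0 < κ) (h2 : kappa2 μ ≤ κ)
    (h3 : κ ≤ kappa3 μ) : IsOptimalOutcome μ κ (exaggerate μ 1) ↔ 0 ≤ meanState μ :=
  ⟨fun h => nonneg_of_isOptimalOutcome_exaggerate_one hμ h
    (isOptimalOutcome_zero_of_regime hμ hκ h2 h3), isOptimalOutcome_one_of_regime hμ hκ h2 h3⟩

lemma exaggerate_zero_iff_of_regime (hμ : ∀ θ, 0 < μ θ) (hκ : 0 < κ) (h2 : kappa2 μ ≤ κ)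
    (h3 : κ ≤ kappa3 μ) : IsOptimalOutcome μ κ (exaggerate μ 0) ↔ meanState μ ≤ 0 :=
  ⟨fun h => nonpos_of_isOptimalOutcome_exaggerate_zero hμ h
    (isOptimalOutcome_one_of_regime hμ hκ h2 h3), isOptimalOutcome_zero_of_regime hμ hκ h2 h3⟩

/-- The slope conditions under which exaggeration can make order-IC bind. -/
lemma binding_regime (hμ : ∀ θ, 0 < μ θ) (hκ : 0 < κ) (h3 : kappa3 μ < κ) :
    1 / 2 < κ ∧ critSlope κ * (1 - |meanState μ|) < μ 0 := by
  constructor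
  · exact ((kappa1_lt_kappa2 hμ).trans (kappa2_lt_kappa3 hμ)).trans h3
  · by_contra hc
    exact absurd ((le_kappa3_iff hμ hκ).2 (not_lt.1 hc)) (not_le.2 h3)

lemma neg_critSlope_sq (hκ : 0 < κ) (hκ2 : κ ≤ 2) : 3 * κ * (-critSlope κ) ^ 2 = 2 - κ := by
  rw [neg_sq]; exact critSlope_sq hκ hκ2

/-- The slope whose feasibility condition involves `1 - |a_μ|` is always available in this regime.
The opposite slope needs the condition with `1 + |a_μ|`, that is `kappaTwo μ ≤ κ`. -/
lemma exists_onLine_of_regime (hμ : ∀ θ, 0 < μ θ) (hκ : 0 < κ) (h3 : kappa3 μ < κ) (hκ2 : κ ≤ 2) :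
    (meanState μ ≤ 0 → ∃ q ∈ policies μ, OnLine μ (critSlope κ) q) ∧
      (0 ≤ meanState μ → ∃ q ∈ policies μ, OnLine μ (-critSlope κ) q) := by
  obtain ⟨hκ1, hs⟩ := binding_regime hμ hκ h3
  have hz := hμ 0
  have hzm := zero_lt_one_sub_abs hμ
  have hs0 := critSlope_nonneg κ
  constructor <;> intro ha
  · rw [abs_of_nonpos ha, sub_neg_eq_add] at hs hzm
    refine exists_onLine hμ hκ1 (critSlope_sq hκ hκ2) hs.le ?_
    have := mul_nonneg hs0 (by linarith : 0 ≤ 1 - meanState μ)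
    linarith
  · rw [abs_of_nonneg ha] at hs hzm
    refine exists_onLine hμ hκ1 (neg_critSlope_sq hκ hκ2) ?_ (by linarith)
    have := mul_nonneg hs0 (by linarith : 0 ≤ 1 + meanState μ)
    linarith

lemma exists_onLine_or_of_regime (hμ : ∀ θ, 0 < μ θ) (hκ : 0 < κ) (h3 : kappa3 μ < κ)
    (hκ2 : κ ≤ 2) :
    ∃ q ∈ policies μ, OnLine μ (critSlope κ) q ∨ OnLine μ (-critSlope κ) q := by
  obtain ⟨hn, hp⟩ := exists_onLine_of_regime hμ hκ h3 hκ2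
  rcases le_total (meanState μ) 0 with ha | ha
  · obtain ⟨q, hq, hl⟩ := hn ha
    exact ⟨q, hq, Or.inl hl⟩
  · obtain ⟨q, hq, hl⟩ := hp ha
    exact ⟨q, hq, Or.inr hl⟩

lemma isOptimalOutcome_iff_of_regime (hμ : ∀ θ, 0 < μ θ) (hκ : 0 < κ) (h3 : kappa3 μ < κ)
    (hκ2 : κ ≤ 2) : IsOptimalOutcome μ κ q ↔
      q ∈ policies μ ∧ (OnLine μ (critSlope κ) q ∨ OnLine μ (-critSlope κ) q) :=
  isOptimalOutcome_iff_onLine hμ (binding_regime hμ hκ h3).1 hκ2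
    (exists_onLine_or_of_regime hμ hκ h3 hκ2)

lemma eq_exaggerate_of_onLine_or (hμ : ∀ θ, 0 < μ θ) (hκ : 1 / 2 < κ) (hκ2 : κ ≤ 2)
    (hq : q ∈ policies μ) (h : OnLine μ (critSlope κ) q ∨ OnLine μ (-critSlope κ) q) :
    (∃ π, q = exaggerate μ π) ∧ OrderICBinds κ q := by
  have hκ0 : 0 < κ := by linarith
  rcases h with h | h
  · exact h.eq_exaggerate hμ hκ (critSlope_sq hκ0 hκ2) hq
  · exact h.eq_exaggerate hμ hκ (neg_critSlope_sq hκ0 hκ2) hq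

/-! ### Uniqueness -/

lemma reflectBelief_eq_self (h : meanState μ = 0) : reflectBelief μ = μ :=
  belief_ext (by rw [meanState_reflectBelief, h, neg_zero]) (reflectBelief_zero μ)

lemma OnLine.reflect {σ : ℝ} (h : OnLine μ σ q) :
    OnLine (reflectBelief μ) (-σ) (reflect q) := by
  intro w hw
  obtain ⟨h1, h2⟩ := h _ (mem_support_reflect.1 hw)
  rw [reflectBelief_zero, meanState_reflectBelief] at h1 h2
  rw [reflectBelief_zero, meanState_reflectBelief]
  exact ⟨by linarith, by linarith⟩

/-- If there is a unique optimal outcome for a symmetric prior, then it is symmetric. -/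
lemma symmetric_of_existsUnique (h0 : meanState μ = 0) (h : ∃! q, IsOptimalOutcome μ κ q) :
    ∃ q, ∀ q', IsOptimalOutcome μ κ q' ↔ q' = q ∨ q' = reflect q := by
  obtain ⟨q, hq, huniq⟩ := h
  have hr := hq.reflect
  rw [reflectBelief_eq_self h0] at hr
  have e := huniq _ hr
  refine ⟨q, fun q' => ⟨fun h => Or.inl (huniq q' h), ?_⟩⟩
  rintro (rfl | rfl)
  · exact hq
  · exact hr

lemma symmetric_optimum (hμ : ∀ θ, 0 < μ θ) (hκ : 0 < κ) (hne : κ ≠ kappa2 μ)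
    (h0 : meanState μ = 0) :
    ∃ q, ∀ q', IsOptimalOutcome μ κ q' ↔ q' = q ∨ q' = reflect q := by
  rcases lt_or_ge κ (kappa2 μ) with h2 | h2
  · exact symmetric_of_existsUnique h0 (existsUnique_of_lt_kappa2 hμ hκ h2)
  rcases le_or_gt κ (kappa3 μ) with h3 | h3
  · refine ⟨exaggerate μ 0, fun q' => ?_⟩
    rw [reflect_exaggerate, reflectBelief_eq_self h0, unitInterval.symm_zero]
    refine ⟨eq_exaggerate_of_regime hμ hκ h2 h3 hne, ?_⟩
    rintro (rfl | rfl)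
    · exact isOptimalOutcome_zero_of_regime hμ hκ h2 h3 h0.le
    · exact isOptimalOutcome_one_of_regime hμ hκ h2 h3 h0.ge
  rcases le_or_gt κ 2 with h4 | h4
  · obtain ⟨q, hq, hl⟩ := (exists_onLine_of_regime hμ hκ h3 h4).1 h0.le
    have hκ1 := (binding_regime hμ hκ h3).1
    have hr := reflect_mem_policies hq
    have hlr := hl.reflect
    rw [reflectBelief_eq_self h0] at hr hlr
    refine ⟨q, fun q' => ?_⟩
    rw [isOptimalOutcome_iff_of_regime hμ hκ h3 h4]
    constructor
    · rintro ⟨hq', h | h⟩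
      · exact Or.inl (h.eq hμ hκ1 (critSlope_sq hκ h4) hq' hl hq)
      · exact Or.inr (h.eq hμ hκ1 (neg_critSlope_sq hκ h4) hq' hlr hr)
    · rintro (rfl | rfl)
      · exact ⟨hq, Or.inl hl⟩
      · exact ⟨hr, Or.inr hlr⟩
  · have hiff := fun q => isOptimalOutcome_iff_noInfo (μ := μ) (q := q) h4
    exact symmetric_of_existsUnique h0 ⟨noInfo μ, (hiff _).2 rfl, fun q hq => (hiff q).1 hq⟩

lemma asymmetric_unique (hμ : ∀ θ, 0 < μ θ) (hκ : 0 < κ) (hne : κ ≠ kappa2 μ)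
    (h0 : meanState μ ≠ 0) (hreg : κ < kappaTwo μ ∨ 2 ≤ κ) : ∃! q, IsOptimalOutcome μ κ q := by
  rcases lt_or_ge κ (kappa2 μ) with h2 | h2
  · exact existsUnique_of_lt_kappa2 hμ hκ h2
  rcases le_or_gt κ (kappa3 μ) with h3 | h3
  · have i0 := exaggerate_zero_iff_of_regime hμ hκ h2 h3
    have i1 := exaggerate_one_iff_of_regime hμ hκ h2 h3
    rcases lt_or_gt_of_ne h0 with ha | ha
    · refine ⟨exaggerate μ 0, i0.2 ha.le, fun q hq => ?_⟩
      rcases eq_exaggerate_of_regime hμ hκ h2 h3 hne hq with h | h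
      · exact h
      · rw [h] at hq
        exact absurd (i1.1 hq) (not_le.2 ha)
    · refine ⟨exaggerate μ 1, i1.2 ha.le, fun q hq => ?_⟩
      rcases eq_exaggerate_of_regime hμ hκ h2 h3 hne hq with h | h
      · rw [h] at hq
        exact absurd (i0.1 hq) (not_le.2 ha)
      · exact h
  rcases le_or_gt κ 2 with h4 | h4
  · have hκ1 := (binding_regime hμ hκ h3).1
    have hs := critSlope_sq hκ h4
    have hs' := neg_critSlope_sq hκ h4
    have hiff := fun q => isOptimalOutcome_iff_of_regime (q := q) hμ hκ h3 h4
    have uniq : ∀ σ, 3 * κ * σ ^ 2 = 2 - κ → (∃ q ∈ policies μ, OnLine μ σ q) →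
        (∀ q ∈ policies μ, OnLine μ σ q → IsOptimalOutcome μ κ q) →
        (∀ q, IsOptimalOutcome μ κ q → OnLine μ σ q) → ∃! q, IsOptimalOutcome μ κ q := by
      rintro σ hσ ⟨q, hq, hl⟩ hopt honly
      exact ⟨q, hopt q hq hl, fun q' hq' =>
        (honly q' hq').eq hμ hκ1 hσ (isOptimalOutcome_iff.1 hq').1.1 hl hq⟩
    obtain ⟨en, ep⟩ := exists_onLine_of_regime hμ hκ h3 h4
    -- At `κ = 2` the two slopes are both zero and the two lines coincide.
    have hzero : 2 ≤ κ → critSlope κ = 0 := fun h => by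
      have : κ = 2 := le_antisymm h4 h
      rw [critSlope, this]; simp
    rcases lt_or_gt_of_ne h0 with ha | ha
    · refine uniq _ hs (en ha.le) (fun q hq hl => (hiff q).2 ⟨hq, Or.inl hl⟩) fun q hq => ?_
      obtain ⟨hqμ, h | h⟩ := (hiff q).1 hq
      · exact h
      · rcases hreg with hlt | hge
        · have h5 := (lt_kappaTwo_iff hμ hκ).1 hlt
          rw [abs_of_neg ha] at h5
          have := (h.feasible hμ hκ1 hs' hqμ).2
          linarith
        · rwa [hzero hge, neg_zero, ← hzero hge] at h
    · refine uniq _ hs' (ep ha.le) (fun q hq hl => (hiff q).2 ⟨hq, Or.inr hl⟩) fun q hq => ?_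
      obtain ⟨hqμ, h | h⟩ := (hiff q).1 hq
      · rcases hreg with hlt | hge
        · have h5 := (lt_kappaTwo_iff hμ hκ).1 hlt
          rw [abs_of_pos ha] at h5
          have := (h.feasible hμ hκ1 hs hqμ).1
          linarith
        · rwa [hzero hge, ← neg_zero, ← hzero hge] at h
      · exact h
  · have hiff := fun q => isOptimalOutcome_iff_noInfo (μ := μ) (q := q) h4
    exact ⟨noInfo μ, (hiff _).2 rfl, fun q hq => (hiff q).1 hq⟩

lemma asymmetric_two (hμ : ∀ θ, 0 < μ θ) (hκ : 0 < κ) (h0 : meanState μ ≠ 0)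
    (hreg : kappaTwo μ ≤ κ) (h4 : κ < 2) :
    ∃ q q', q ≠ q' ∧ (∀ q'', IsOptimalOutcome μ κ q'' ↔ q'' = q ∨ q'' = q') ∧
      (∀ ν ∈ q.support, ν 0 - μ 0 = critSlope κ * (meanState ν - meanState μ)) ∧
      (∀ ν ∈ q'.support, ν 0 - μ 0 = -critSlope κ * (meanState ν - meanState μ)) := by
  have h3 := (kappa3_lt_kappaTwo hμ h0).trans_le hreg
  have hκ1 := (binding_regime hμ hκ h3).1
  have hs := critSlope_sq hκ h4.le
  have hs' := neg_critSlope_sq hκ h4.le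
  have hs0 : 0 < critSlope κ := Real.sqrt_pos.2 (div_pos (by linarith) (by linarith))
  have hsl : critSlope κ * (1 + |meanState μ|) ≤ μ 0 := by
    by_contra hc
    exact absurd ((lt_kappaTwo_iff hμ hκ).2 (not_le.1 hc)) (not_lt.2 hreg)
  have hzm := zero_lt_one_sub_abs hμ
  have hz := hμ 0
  have b1 := le_abs_self (meanState μ)
  have b2 := neg_abs_le (meanState μ)
  have c1 : critSlope κ * (1 + meanState μ) ≤ μ 0 :=
    (mul_le_mul_of_nonneg_left (by linarith) hs0.le).trans hsl
  have c2 : critSlope κ * (1 - meanState μ) ≤ μ 0 :=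
    (mul_le_mul_of_nonneg_left (by linarith) hs0.le).trans hsl
  have d1 : 0 ≤ critSlope κ * (1 + meanState μ) := mul_nonneg hs0.le (by linarith)
  have d2 : 0 ≤ critSlope κ * (1 - meanState μ) := mul_nonneg hs0.le (by linarith)
  obtain ⟨q, hq, hl⟩ := exists_onLine hμ hκ1 hs c1 (by linarith)
  obtain ⟨q', hq', hl'⟩ := exists_onLine hμ hκ1 hs' (by linarith) (by linarith)
  refine ⟨q, q', ?_, fun q'' => ?_, fun ν hν => (hl ν hν).1, fun ν hν => (hl' ν hν).1⟩
  · rintro rfl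
    obtain ⟨x, y, hxy⟩ := hl.exists_edgePair hμ hκ1 hs hq
    obtain ⟨hx, hy⟩ := hxy.sign hμ hq
    have mx : x ∈ q.support := by rw [hxy.support_eq]; simp
    have my : y ∈ q.support := by rw [hxy.support_eq]; simp
    have e : critSlope κ * (meanState y - meanState x) = 0 := by
      linarith [(hl x mx).1, (hl y my).1, (hl' x mx).1, (hl' y my).1]
    exact absurd e (mul_pos hs0 (by linarith)).ne'
  · rw [isOptimalOutcome_iff_of_regime hμ hκ h3 h4.le]
    constructor
    · rintro ⟨hq'', h | h⟩
      · exact Or.inl (h.eq hμ hκ1 hs hq'' hl hq)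
      · exact Or.inr (h.eq hμ hκ1 hs' hq'' hl' hq')
    · rintro (rfl | rfl)
      · exact ⟨hq, Or.inl hl⟩
      · exact ⟨hq', Or.inr hl'⟩

/-! ### The second threshold -/

/-- At the threshold `hB` becomes an equality, so moving the left belief along its edge costs
nothing: every kinked policy of the family attains the downplaying bound, from `l = 0` at `ρ = 0` to
separating exaggeration at `ρ = 1`. -/
lemma exists_mixture_family (hμ : ∀ θ, 0 < μ θ) (hκ : 0 < κ) (h2 : κ = kappa2 μ)
    (ha : 0 ≤ meanState μ) :
    ∃ q : unitInterval → Measure Belief, Function.Injective q ∧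
      (∀ ρ, IsOptimalOutcome μ κ (q ρ) ∧ ∃ πm πp, q ρ = mixedPolicy μ (-1) ρ πm πp) ∧
      Peaked (critSlope κ) (q 0) ∧ q 1 = exaggerate μ 1 := by
  obtain ⟨hκ2, hs0, hs1, -, -, hA, hB⟩ :=
    downplay_regime hμ hκ (h2 ▸ kappa1_lt_kappa2 hμ) h2.le
  have huv : μ (-1) ≤ μ 1 := by rw [meanState_eq] at ha; linarith
  have hBeq : 2 * critSlope κ * (1 - meanState μ) = 1 - meanState μ + μ 0 := by
    refine le_antisymm ?_ hB
    have := (separating_regime hμ hκ h2.ge (h2 ▸ (kappa2_lt_kappa3 hμ).le)).2.1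
    rwa [abs_of_nonneg ha] at this
  have hk := fun ρ => kinked_mixture hμ huv ρ hBeq
  have hb := fun ρ => mixtureDist_bounds hμ hBeq ρ
  have hpol : ∀ ρ, mixture μ hμ huv ρ ∈ policies μ := fun ρ => induced_mem_policies _ _
  refine ⟨mixture μ hμ huv, fun ρ ρ' h => ?_, fun ρ => ⟨?_, _, _, rfl⟩, ?_, mixture_one hμ huv⟩
  · have h1 := hk ρ
    rw [h] at h1
    exact mixtureDist_injective hμ
      (h1.eq (hk ρ') hs0 (hb ρ).2.1 (hb ρ).2.2 (hb ρ').2.1 (hb ρ').2.2)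
  · exact isOptimalOutcome_of_slope hκ hκ2 hs0 hs1 hA hB (hpol ρ)
      ((hk ρ).slope hs0.le (hb ρ).1 (hb ρ).2.1 (hb ρ).2.2) ((hk ρ).integral_sq (hpol ρ) hBeq)
  · have h1 := hk 0
    rw [mixtureDist_zero] at h1
    exact h1.peaked hs0

lemma Peaked.reflect {s : ℝ} (h : Peaked s q) : Peaked s (reflect q) := by
  intro w hw
  obtain ⟨h1, h2⟩ := h _ (mem_support_reflect.1 hw)
  rw [reflectBelief_zero, meanState_reflectBelief] at *
  refine ⟨?_, by rw [h2]; ring⟩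
  rcases h1 with h | h | h
  · right; right; linarith
  · right; left; linarith
  · left; linarith

lemma kappa2_reflectBelief : kappa2 (reflectBelief μ) = kappa2 μ := by
  rw [kappa2, kappa2, meanState_reflectBelief, reflectBelief_zero, abs_neg]

lemma exists_optimal_continuum (hμ : ∀ θ, 0 < μ θ) (hκ : 0 < κ) (h2 : κ = kappa2 μ) :
    ∃ (e : State) (q : unitInterval → Measure Belief), e ≠ 0 ∧ Function.Injective q ∧
      (∀ ρ, IsOptimalOutcome μ κ (q ρ) ∧ ∃ πm πp, q ρ = mixedPolicy μ e ρ πm πp) ∧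
      (∃ πm πp, q 0 = downplay μ πm πp ∧ OrderICBinds κ (q 0)) ∧
      (q 1 = exaggerate μ 0 ∨ q 1 = exaggerate μ 1) := by
  obtain ⟨hκ2, hs0, hs1, hzA, hzB, -, -⟩ :=
    downplay_regime hμ hκ (h2 ▸ kappa1_lt_kappa2 hμ) h2.le
  have down : ∀ q ∈ policies μ, Peaked (critSlope κ) q →
      ∃ πm πp, q = downplay μ πm πp ∧ OrderICBinds κ q := by
    intro q hq hp
    obtain ⟨⟨πm, πp, h⟩, hb⟩ := hp.eq_downplay hμ hκ hκ2 hs0 hs1.le hzA hzB hq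
    exact ⟨πm, πp, h, hb⟩
  rcases le_total 0 (meanState μ) with ha | ha
  · obtain ⟨q, hinj, hopt, hp, h1⟩ := exists_mixture_family hμ hκ h2 ha
    exact ⟨-1, q, by decide, hinj, hopt,
      down _ (isOptimalOutcome_iff.1 (hopt 0).1).1.1 hp, Or.inr h1⟩
  · obtain ⟨q, hinj, hopt, hp, h1⟩ := exists_mixture_family (reflect_pos hμ) hκ
      (by rw [kappa2_reflectBelief]; exact h2) (by rw [meanState_reflectBelief]; linarith)
    have hopt' : ∀ ρ, IsOptimalOutcome μ κ (reflect (q ρ)) := fun ρ => by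
      have := (hopt ρ).1.reflect
      rwa [reflectBelief_reflectBelief] at this
    refine ⟨1, fun ρ => reflect (q ρ), by decide, fun ρ ρ' h => hinj ?_, fun ρ => ⟨hopt' ρ, ?_⟩,
      down _ (isOptimalOutcome_iff.1 (hopt' 0)).1.1 hp.reflect, Or.inl ?_⟩
    · rw [← reflect_reflect (q ρ), ← reflect_reflect (q ρ')]
      exact congrArg reflect h
    · obtain ⟨πm, πp, e⟩ := (hopt ρ).2
      refine ⟨πp, πm, ?_⟩
      change reflect (q ρ) = _
      rw [e, reflect_mixedPolicy, reflectBelief_reflectBelief, neg_neg]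
    · change reflect (q 1) = _
      rw [h1, reflect_exaggerate, reflectBelief_reflectBelief, unitInterval.symm_one]

end Regimes

end

end AttentionManagement

/-! ### Assembly of the cost regimes -/

open AttentionManagement in
theorem proposition2 (μ : Belief) (hμ : ∀ θ, 0 < μ θ) :
    -- the thresholds are ordered
    (kappa1 < kappa2 μ ∧ kappa2 μ < kappa3 μ ∧ kappa3 μ < kappa4) ∧
    ∀ κ : ℝ, 0 < κ →
      -- full revelation
      (κ ≤ kappa1 → ∀ q, IsOptimalOutcome μ κ q ↔ q = fullInfo μ) ∧
      -- downplaying until order-IC binds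
      (kappa1 < κ → κ ≤ kappa2 μ →
        (∃ πm πp, OrderICBinds κ (downplay μ πm πp)) ∧
        (∀ πm πp, OrderICBinds κ (downplay μ πm πp) →
          IsOptimalOutcome μ κ (downplay μ πm πp)) ∧
        (κ ≠ kappa2 μ → ∀ q, IsOptimalOutcome μ κ q →
          ∃ πm πp, q = downplay μ πm πp ∧ OrderICBinds κ q)) ∧
      -- separating exaggeration
      (kappa2 μ ≤ κ → κ ≤ kappa3 μ →
        (IsOptimalOutcome μ κ (exaggerate μ 1) ↔ 0 ≤ meanState μ) ∧
        (IsOptimalOutcome μ κ (exaggerate μ 0) ↔ meanState μ ≤ 0) ∧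
        (κ ≠ kappa2 μ → ∀ q, IsOptimalOutcome μ κ q →
          q = exaggerate μ 0 ∨ q = exaggerate μ 1)) ∧
      -- exaggeration until order-IC binds
      (kappa3 μ < κ → κ ≤ kappa4 →
        (∃ π, OrderICBinds κ (exaggerate μ π)) ∧
        ∀ q, IsOptimalOutcome μ κ q ↔ ∃ π, q = exaggerate μ π ∧ OrderICBinds κ q) ∧
      -- no information
      (kappa4 < κ → ∀ q, IsOptimalOutcome μ κ q ↔ q = noInfo μ) ∧
      -- uniqueness for every other cost than the second threshold: outright for an asymmetric prior
      -- outside `[kappaTwo μ, kappa4)`, up to reversing the slope inside, and up to exchanging the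
      -- states `1` and `-1` for a symmetric prior
      (κ ≠ kappa2 μ →
        (meanState μ ≠ 0 → (κ < kappaTwo μ ∨ kappa4 ≤ κ) → ∃! q, IsOptimalOutcome μ κ q) ∧
        (meanState μ ≠ 0 → kappaTwo μ ≤ κ → κ < kappa4 →
          ∃ q q', q ≠ q' ∧ (∀ q'', IsOptimalOutcome μ κ q'' ↔ q'' = q ∨ q'' = q') ∧
            (∀ ν ∈ q.support, ν 0 - μ 0 = critSlope κ * (meanState ν - meanState μ)) ∧
            (∀ ν ∈ q'.support, ν 0 - μ 0 = -critSlope κ * (meanState ν - meanState μ))) ∧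
        (meanState μ = 0 → ∃ q, ∀ q', IsOptimalOutcome μ κ q' ↔ q' = q ∨ q' = reflect q)) ∧
      -- at the second threshold, a continuum of optima mixes the two kinds of policy
      (κ = kappa2 μ →
        ∃ (e : State) (q : unitInterval → Measure Belief), e ≠ 0 ∧ Function.Injective q ∧
          (∀ ρ, IsOptimalOutcome μ κ (q ρ) ∧ ∃ πm πp, q ρ = mixedPolicy μ e ρ πm πp) ∧
          (∃ πm πp, q 0 = downplay μ πm πp ∧ OrderICBinds κ (q 0)) ∧
          (q 1 = exaggerate μ 0 ∨ q 1 = exaggerate μ 1)) := by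
  refine ⟨⟨kappa1_lt_kappa2 hμ, kappa2_lt_kappa3 hμ, kappa3_lt_kappa4 hμ⟩, fun κ hκ =>
    ⟨fun h1 q => ?_, fun h1 h2 => ⟨?_, fun πm πp hb => ?_, fun hne q hq => ?_⟩,
      fun h2 h3 => ⟨exaggerate_one_iff_of_regime hμ hκ h2 h3,
        exaggerate_zero_iff_of_regime hμ hκ h2 h3,
        fun hne q hq => eq_exaggerate_of_regime hμ hκ h2 h3 hne hq⟩,
      fun h3 h4 => ⟨?_, fun q => ⟨fun hq => ?_, ?_⟩⟩,
      fun h4 q => isOptimalOutcome_iff_noInfo h4,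
      fun hne => ⟨fun h0 hreg => asymmetric_unique hμ hκ hne h0 hreg,
        fun h0 hreg h4 => asymmetric_two hμ hκ h0 hreg h4,
        fun h0 => symmetric_optimum hμ hκ hne h0⟩,
      fun h2 => exists_optimal_continuum hμ hκ h2⟩⟩
  · have h2 : κ ≤ 2 := h1.trans ((kappa1_lt_kappa2 hμ).trans
      ((kappa2_lt_kappa3 hμ).trans (kappa3_lt_kappa4 hμ))).le
    exact isOptimalOutcome_iff_fullInfo hμ hκ h2 ((le_kappa1_iff hκ).1 h1)
  · obtain ⟨hκ2, hs0, hs1, hzA, hzB, -, -⟩ := downplay_regime hμ hκ h1 h2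
    obtain ⟨q, hq, hp⟩ := exists_peaked hμ hs0 hs1.le hzA hzB
    obtain ⟨⟨πm, πp, rfl⟩, hb⟩ := hp.eq_downplay hμ hκ hκ2 hs0 hs1.le hzA hzB hq
    exact ⟨πm, πp, hb⟩
  · obtain ⟨hκ2, hs0, -, hzA, hzB, -, -⟩ := downplay_regime hμ hκ h1 h2
    exact isOptimalOutcome_of_peaked hμ hκ h1 h2 (downplay_mem_policies μ πm πp)
      (peaked_of_orderICBinds hμ hκ hκ2 hs0 hzA hzB hb)
  · obtain ⟨hκ2, hs0, hs1, hzA, hzB, -, -⟩ := downplay_regime hμ hκ h1 h2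
    obtain ⟨hqμ, hp⟩ := (isOptimalOutcome_iff_peaked hμ hκ h1 (lt_of_le_of_ne h2 hne)).1 hq
    obtain ⟨⟨πm, πp, h⟩, hb⟩ := hp.eq_downplay hμ hκ hκ2 hs0 hs1.le hzA hzB hqμ
    exact ⟨πm, πp, h, hb⟩
  · obtain ⟨q, hq, hl⟩ := exists_onLine_or_of_regime hμ hκ h3 h4
    obtain ⟨⟨π, rfl⟩, hb⟩ :=
      eq_exaggerate_of_onLine_or hμ (binding_regime hμ hκ h3).1 h4 hq hl
    exact ⟨π, hb⟩
  · obtain ⟨hqμ, hl⟩ := (isOptimalOutcome_iff_of_regime hμ hκ h3 h4).1 hq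
    obtain ⟨⟨π, h⟩, hb⟩ :=
      eq_exaggerate_of_onLine_or hμ (binding_regime hμ hκ h3).1 h4 hqμ hl
    exact ⟨π, h, hb⟩
  · rintro ⟨π, rfl, hb⟩
    exact (isOptimalOutcome_iff_of_regime hμ hκ h3 h4).2
      ⟨exaggerate_mem_policies μ π, onLine_of_orderICBinds hμ hκ h4 hb⟩
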